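/- **Setting.** Let $N\ge 2$, $n\ge 1$, $h\ge 1$. Consider $N$ agents $x_i(t+1)=Ax_i(t)+Bu_i(t)$, $x_i(t)\in\mathbb R^n$, in Brunovsky canonical form: $A$ has ones on the superdiagonal, last row $(a_1,\dots,a_n)$ and zeros elsewhere, and $B=(0,\dots,0,1)^T$. Let $G_1,\dots,G_h$ be undirected graphs on $\{1,\dots,N\}$ whose union $G'$ is connected, and let $m(t)$, $t\in\mathbb N$, be a homogeneous irreducible Markov chain on $\{1,\dots,h\}$ with $\pi_u=\lim_{t\to\infty}\mathbb P\{m(t)=u\}$ existing for all $u$; $G_{m(t)}$ is the topology at time $t$, and $N_i^{m(t)}$ is the neighbour set of $i$ in it. The noises $d_{ij}(t)$ are i.i.d. $N(0,\delta^2)$, $\delta>0$, with distribution function $F$ and density $f$, and are independent of $\{m(t)\}$. If $j\in N_i^{m(t)}$, agent $i$ receives the bit $s_{ij}(t)=\mathbb 1\{K_2x_j(t)+d_{ij}(t)\le c_{ij}\}$ with a threshold $c_{ij}\in\mathbb R$. **Algorithm.** Let $b_1,\dots,b_{n-1}\in\mathbb R$ be such that all complex roots of $s^{n-1}+b_{n-1}s^{n-2}+\dots+b_2s+b_1$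 lie inside the open unit disc. Put $K_2=[b_1,\dots,b_{n-1},1]$ and $K_1=[-a_1+b_1,\,-a_2+b_2-b_1,\dots,-a_{n-1}+b_{n-1}-b_{n-2},\,-a_n-b_{n-1}+1]$ (for $n=1$: $K_2=[1]$, $K_1=[-a_1+1]$). Let $\gamma>0$, $\beta\in\mathbb R$, and let the initial time $t_0\ge 1$ be an integer with $t_0>\gamma d_i-1$ for all $i$, where $d_i$ is the degree of $i$ in $G'$. The initial states $x_i(t_0+1)=x_i^0$ and initial estimates $\hat z_{ij}(t_0)=\hat z_{ij}^0$ are deterministic, and $M$ satisfies $|K_2x_i^0|\le M$ for all $i$ and $|\hat z_{ij}^0|\le M$ for all edges $(i,j)$ of $G'$. With $\Pi_M$ the projection of $\mathbb R$ onto $[-M,M]$, for $t\ge t_0+1$ and every edge $(i,j)$ of $G'$, $$\hat z_{ij}(t)=\Pi_M\Big\{\hat z_{ij}(t-1)+\tfrac{\beta}{t}\,\mathbb 1\{j\in N_i^{m(t)}\}\big(F(c_{ij}-\hat z_{ij}(t-1))-s_{ij}(t)\big)\Big\},$$ $$u_i(t)=K_1x_i(t)+\frac{\gamma}{t+1}\sum_{j\in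 N_i^{m(t)}}\big(\hat z_{ij}(t)-K_2x_i(t)\big).$$ **Constants.** Let $L_u$ be the Laplacian of $G_u$, $\check L=\sum_u\pi_uL_u$ with eigenvalues $\lambda_1\le\lambda_2\le\dots\le\lambda_N$, and $T_G$ an orthogonal matrix with $T_G^{-1}\check LT_G=\mathrm{diag}(\lambda_1,\dots,\lambda_N)$; $J_N=I_N-\frac1N\vec 1_N\vec 1_N^T$. Index by the ordered edges $e=(i,j)$ of $G'$: the row of $Q$ at $e$ is the $j$-th unit vector, and the column of $W_u$ at $e$ is the $i$-th unit vector if $e$ is an edge of $G_u$ and $0$ otherwise. With the spectral norm, put $\lambda_G=\max_u\|T_G^{-1}J_NW_u\|^2$, $\lambda_{QW}=\max_u\|QW_u\|^2$, $\lambda_{QL}=\max_u\|QL_uT_G\|^2$, $\alpha=2\sqrt{\lambda_{QW}}+\lambda_{QL}\lambda_2/\lambda_G$, $f_M=\min_{i,j\in\{1,\dots,N\}}f(|c_{ij}|+M)$ and $\pi_{\min}=\min_u\pi_u$. Let $\bar x(t)=\frac1N\sum_{i}x_i(t)$. The agents are said to reach *(mean-square) consensus* if $E\|x_i(t)\|^2<\infty$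 for all $i$ and all $t\ge t_0+1$, and $\lim_{t\to\infty}E\|x_i(t)-\bar x(t)\|^2=0$ for all $i$. **Theorem.** (i) If $\beta>\frac{1}{2f_M\pi_{\min}}\Big(\frac{\gamma\lambda_G^2}{\lambda_2^3}+\gamma\alpha\Big)$, then the agents reach consensus. (ii) If $\gamma>\frac1{\lambda_2}$ and $\beta>\frac{1}{2f_M\pi_{\min}}\Big(\frac{\gamma^2\lambda_G^2}{\lambda_2^2(\gamma\lambda_2-1)}+\gamma\alpha+1\Big)$, then the agents reach consensus at the rate $O(1/t)$: $E\|x_i(t)-\bar x(t)\|^2=O(1/t)$ as $t\to\infty$ for all $i$. -/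

import Mathlib

open MeasureTheory ProbabilityTheory Filter Topology
open scoped NNReal Matrix

noncomputable section

namespace OneBit

/-- The data of the multi-agent system with `N` agents, state dimension `n = r + 1`, and `h`
communication topologies, together with the parameters of the one-bit consensus algorithm. -/
structure Setup (N r h : ℕ) where
  /-- the coefficients `a₁, …, aₙ` of the last row of `A` -/
  a : Fin (r + 1) → ℝ
  /-- the compression coefficients `b₁, …, bₙ₋₁` -/
  b : Fin r → ℝ
  /-- the undirected topologies `G₁, …, G_h`; `(G u).Adj i j` means that, while topology `u` is
  active, `i` and `j` are neighbours -/
  G : Fin h → SimpleGraph (Fin N)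
  /-- the thresholds -/
  c : Fin N → Fin N → ℝ
  /-- the standard deviation of the communication noise -/
  δ : ℝ≥0
  /-- the projection bound -/
  M : ℝ
  /-- the step coefficient of the estimation -/
  β : ℝ
  /-- the step coefficient of the controller -/
  γ : ℝ
  /-- the initial time -/
  t₀ : ℕ
  /-- the initial states `xᵢ⁰` -/
  x₀ : Fin N → EuclideanSpace ℝ (Fin (r + 1))
  /-- the initial estimates `ẑᵢⱼ⁰` -/
  z₀ : Fin N → Fin N → ℝ

namespace Setup

variable {N r h : ℕ} (S : Setup N r h)

/-! ### The system and the algorithm -/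

/-- The system matrix in Brunovsky canonical form. -/
def A : Matrix (Fin (r + 1)) (Fin (r + 1)) ℝ :=
  Matrix.of fun i j => if i = Fin.last r then S.a j else if (j : ℕ) = (i : ℕ) + 1 then 1 else 0

/-- The input vector `B = (0, …, 0, 1)ᵀ` of the Brunovsky canonical form. -/
def B (_S : Setup N r h) : Fin (r + 1) → ℝ := Pi.single (Fin.last r) 1

/-- The compression vector `K₂ = [b₁, …, bₙ₋₁, 1]`. -/
def K₂ : Fin (r + 1) → ℝ := Fin.snoc S.b 1

/-- The stabilizing gain `K₁ = [-a₁ + b₁, -a₂ + b₂ - b₁, …, -aₙ - bₙ₋₁ + 1]`. -/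
def K₁ : Fin (r + 1) → ℝ :=
  fun k => -S.a k + S.K₂ k - (Fin.cons 0 S.b : Fin (r + 1) → ℝ) k

/-- The compression encoding `g(x) = K₂ x`. -/
def g (x : EuclideanSpace ℝ (Fin (r + 1))) : ℝ := S.K₂ ⬝ᵥ x.ofLp

/-- The distribution function of the noise. -/
def F (y : ℝ) : ℝ := cdf (gaussianReal 0 (S.δ ^ 2)) y

/-- The density of the noise. -/
def f (y : ℝ) : ℝ := gaussianPDFReal 0 (S.δ ^ 2) y

/-- The projection of the real line onto `[-M, M]`. -/
def proj (y : ℝ) : ℝ := max (-S.M) (min S.M y)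

open Classical in
/-- The one-bit signal that agent `i` receives from agent `j` when the state of `j` is `xj`
and the noise is `e`. -/
def signal (i j : Fin N) (xj : EuclideanSpace ℝ (Fin (r + 1))) (e : ℝ) : ℝ :=
  if S.g xj + e ≤ S.c i j then 1 else 0

open Classical in
/-- The control of agent `i` at time `t`, when topology `u` is active, its state is `xi`, and its
estimates are `zi j`. -/
def control (u : Fin h) (t : ℕ) (i : Fin N) (xi : EuclideanSpace ℝ (Fin (r + 1)))
    (zi : Fin N → ℝ) : ℝ :=
  S.K₁ ⬝ᵥ xi.ofLp +
    S.γ / ((t : ℝ) + 1) * ∑ j : Fin N, if (S.G u).Adj i j then zi j - S.g xi else 0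

open Classical in
/-- `x` and `z` are the states and the estimates that the algorithm produces along the topologies
`m` and the noises `d`: `x t i` is the state of agent `i` at time `t`, and `z t i j` the estimate by
agent `i` of the compressed state of agent `j`, which is corrected at time `t` exactly when `j` is
a neighbour of `i` in the topology active at time `t`. (Pairs that are never neighbours have a
value `z t i j` too, but it is not used anywhere.) -/
structure IsTrajectory (m : ℕ → Fin h) (d : ℕ → Fin N → Fin N → ℝ)
    (x : ℕ → Fin N → EuclideanSpace ℝ (Fin (r + 1))) (z : ℕ → Fin N → Fin N → ℝ) : Prop where
  init_state : ∀ i, x (S.t₀ + 1) i = S.x₀ i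
  init_estimate : ∀ i j, z S.t₀ i j = S.z₀ i j
  estimate : ∀ t, S.t₀ + 1 ≤ t → ∀ i j,
    z t i j = S.proj (z (t - 1) i j + S.β / (t : ℝ) *
      (if (S.G (m t)).Adj i j then
        S.F (S.c i j - z (t - 1) i j) - S.signal i j (x t j) (d t i j) else 0))
  state : ∀ t, S.t₀ + 1 ≤ t → ∀ i,
    x (t + 1) i = WithLp.toLp 2
      (S.A *ᵥ (x t i).ofLp + S.control (m t) t i (x t i) (z t i) • S.B)

/-! ### The constants -/

/-- The union `G'` of the topologies. -/
def union : SimpleGraph (Fin N) := ⨆ u, S.G u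

/-- The ordered edges of `G'`. -/
abbrev Edge : Type := {e : Fin N × Fin N // S.union.Adj e.1 e.2}

open Classical in
/-- The degree `dᵢ` of agent `i` in `G'`. -/
def deg (i : Fin N) : ℕ := S.union.degree i

open Classical in
/-- The Laplacian of the topology `u`. -/
def L (u : Fin h) : Matrix (Fin N) (Fin N) ℝ := (S.G u).lapMatrix ℝ

/-- The averaged Laplacian `∑ᵤ πᵤ Lᵤ`. -/
def avgL (π : Fin h → ℝ) : Matrix (Fin N) (Fin N) ℝ := ∑ u, π u • S.L u

theorem avgL_isHermitian (π : Fin h → ℝ) : (S.avgL π).IsHermitian := by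
  classical
  unfold avgL Matrix.IsHermitian
  rw [Matrix.conjTranspose_sum]
  refine Finset.sum_congr rfl fun u _ => ?_
  rw [Matrix.conjTranspose_smul, star_trivial]
  congr 1
  exact (S.G u).isHermitian_lapMatrix ℝ

/-- The permutation that puts the eigenvalues of the averaged Laplacian in ascending order. -/
def order (π : Fin h → ℝ) : Equiv.Perm (Fin N) :=
  Tuple.sort (S.avgL_isHermitian π).eigenvalues

/-- The eigenvalues `λ₁ ≤ λ₂ ≤ … ≤ λ_N` of the averaged Laplacian, with multiplicity
(indexed from `0`). -/
def eig (π : Fin h → ℝ) (k : Fin N) : ℝ :=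
  (S.avgL_isHermitian π).eigenvalues (S.order π k)

/-- The second smallest eigenvalue `λ₂` of the averaged Laplacian. -/
def lam₂ (π : Fin h → ℝ) (hN : 2 ≤ N) : ℝ := S.eig π ⟨1, hN⟩

/-- The orthogonal matrix `T_G` whose columns are eigenvectors of the averaged Laplacian for
`λ₁, …, λ_N`. -/
def TG (π : Fin h → ℝ) : Matrix (Fin N) (Fin N) ℝ :=
  ((S.avgL_isHermitian π).eigenvectorUnitary : Matrix (Fin N) (Fin N) ℝ).submatrix id (S.order π)

/-- The matrix `J_N = I - (1/N) 1 1ᵀ`. -/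
def J (_S : Setup N r h) : Matrix (Fin N) (Fin N) ℝ :=
  1 - (1 / (N : ℝ)) • Matrix.of fun _ _ => 1

/-- The matrix `Q`: the row of the edge `(i, j)` is the `j`-th unit vector. -/
def Q : Matrix S.Edge (Fin N) ℝ :=
  Matrix.of fun e k => if k = e.1.2 then 1 else 0

open Classical in
/-- The matrix `Wᵤ`: the entry at agent `k` and edge `(i, j)` is `1` when `k = i` and `(i, j)` is
an edge of the topology `u`, and `0` otherwise. -/
def W (u : Fin h) : Matrix (Fin N) S.Edge ℝ :=
  Matrix.of fun k e => if k = e.1.1 ∧ (S.G u).Adj e.1.1 e.1.2 then 1 else 0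

open Classical in
open scoped Matrix.Norms.L2Operator in
/-- `λ_G = maxᵤ ‖T_G⁻¹ J_N Wᵤ‖²` (spectral norm). -/
def lamG (π : Fin h → ℝ) : ℝ := ⨆ u, ‖(S.TG π)⁻¹ * S.J * S.W u‖ ^ 2

open Classical in
open scoped Matrix.Norms.L2Operator in
/-- `λ_QW = maxᵤ ‖Q Wᵤ‖²` (spectral norm). -/
def lamQW : ℝ := ⨆ u, ‖S.Q * S.W u‖ ^ 2

open Classical in
open scoped Matrix.Norms.L2Operator in
/-- `λ_QL = maxᵤ ‖Q Lᵤ T_G‖²` (spectral norm). -/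
def lamQL (π : Fin h → ℝ) : ℝ := ⨆ u, ‖S.Q * S.L u * S.TG π‖ ^ 2

/-- `α = 2 √λ_QW + λ_QL λ₂ / λ_G`. -/
def alpha (π : Fin h → ℝ) (hN : 2 ≤ N) : ℝ :=
  2 * Real.sqrt S.lamQW + S.lamQL π * S.lam₂ π hN / S.lamG π

/-- `f_M = min_{i,j} f(|cᵢⱼ| + M)`. -/
def fM : ℝ := ⨅ p : Fin N × Fin N, S.f (|S.c p.1 p.2| + S.M)

end Setup

/-- `π_min = minᵤ πᵤ`. -/
def piMin {h : ℕ} (π : Fin h → ℝ) : ℝ := ⨅ u, π u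

/-! ### The randomness and the notion of consensus -/

variable {Ω : Type*} [MeasurableSpace Ω]

/-- `m` is a homogeneous Markov chain with transition matrix `P`:
`ℙ(m(t+1) = v | m(0), …, m(t)) = P_{m(t) v}`. -/
structure IsMarkovChain {h : ℕ} (μ : Measure Ω) (m : ℕ → Ω → Fin h)
    (P : Matrix (Fin h) (Fin h) ℝ) : Prop where
  measurable : ∀ t, Measurable (m t)
  stochastic : P ∈ Matrix.rowStochastic ℝ (Fin h)
  markov : ∀ (t : ℕ) (s : ℕ → Fin h),
    μ.real {ω | ∀ k ≤ t + 1, m k ω = s k} = μ.real {ω | ∀ k ≤ t, m k ω = s k} * P (s t) (s (t + 1))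

/-- The variables `d t i j` are independent and all have the law `N(0, δ²)`. -/
structure IsGaussianNoise {N : ℕ} (μ : Measure Ω) (d : ℕ → Fin N → Fin N → Ω → ℝ) (δ : ℝ≥0) :
    Prop where
  measurable : ∀ t i j, Measurable (d t i j)
  law : ∀ t i j, μ.map (d t i j) = gaussianReal 0 (δ ^ 2)
  indep : iIndepFun (fun (q : ℕ × Fin N × Fin N) => d q.1 q.2.1 q.2.2) μ

/-- The deviation `xᵢ(t) - x̄(t)` of agent `i` from the average `x̄(t) = (1/N) ∑ⱼ xⱼ(t)`. -/
def deviation {N n : ℕ} (x : ℕ → Fin N → Ω → EuclideanSpace ℝ (Fin n)) (t : ℕ) (i : Fin N)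
    (ω : Ω) : EuclideanSpace ℝ (Fin n) :=
  x t i ω - (1 / (N : ℝ)) • ∑ j, x t j ω

/-- Mean-square consensus of a process that starts at time `t₁`. -/
def Consensus {N n : ℕ} (μ : Measure Ω) (t₁ : ℕ)
    (x : ℕ → Fin N → Ω → EuclideanSpace ℝ (Fin n)) : Prop :=
  (∀ t, t₁ ≤ t → ∀ i, MemLp (x t i) 2 μ) ∧
  ∀ i, Tendsto (fun t => ∫ ω, ‖deviation x t i ω‖ ^ 2 ∂μ) atTop (𝓝 0)

end OneBit

end

/-!
The gain `K₁` is chosen so that `K₂ (A + B K₁) = K₂` (`Setup.K₂_dotProduct_closed_loop`): the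
compressed states `y i = K₂ x i` are single integrators driven by the consensus feedback, and the
condition on `t₀` makes each of their steps a convex combination, so that they never leave
`[-M, M]`. The proof first treats the compressed states and the estimates, and then returns to the
states.

*Lyapunov function.* Let `V = ‖J y‖²` be the disagreement and `R` the total squared estimation
error, over the ordered edges of the union graph. In one step, `V` and `R` change by `1 / t` times a
quadratic expression, up to `O(1 / t²)`. The cross terms are bounded by spectral norms and Young's
inequality, with the weights `λ₂` and `λ_G / λ₂`; the correction of an active estimate contracts,
because the distribution function `F` has slope at least `f_M` on the relevant range. The outcome is
that the drift of `p V + q R` is at most `-κ (p V + q R)` as soon as the two inequalities in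
`Setup.lyap_le_of_step` hold. Positive `p`, `q` and some `κ > s` with these two inequalities exist
when the product of the two diagonal coefficients, each diminished by `s`, exceeds the square of the
off-diagonal one (`exists_weights`). With `s = 0` and `s = 1` this is what the two thresholds for
`β` express.

*Averaging over the topologies.* The dissipation in one step involves only the active topology,
while the spectral gap `λ₂` (`Setup.lam₂_mul_le`) and the bound by `π_min` belong to the stationary
average. The difference between the two is the discrete derivative of a bounded corrector: the
Poisson equation of the irreducible chain is solvable (`exists_poisson_solution`), and the Markov
property (`integral_next_switch`) turns `∑ w, P (m t) w * G w` into `G (m (t + 1))` under the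
expectation. Since the corrector enters with the factor `1 / t`, and its ingredients vary by
`O(1 / t)` in a step, it disturbs the recursion only by `O(1 / t²)`
(`exists_le_mul_rpow_of_corrector`). The noise at time `t` is independent of the past, so that the
fluctuation of the signals has mean zero (`integral_indicator_noise`). Altogether
`E (p V + q R) = O(t ^ (-s))` for all `s ≤ 1` with `0 ≤ s < κ`
(`Setup.Model.exists_integral_lyap_le`).

*Return to the states.* The coordinates of `x i - x̄` are time shifts of the first coordinate `ξ`,
and `ξ (t + r) + ∑ k, b k * ξ (t + k)` is a coordinate of `J y`. Over `ℂ` the characteristic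
polynomial splits into factors `X - a` with `‖a‖ < 1`, and each operator `shift - a` on `L²`-valued
sequences can be inverted without loss of a polynomial rate (`SlowRate.isBigO_integral_sq`,
`Setup.Model.isBigO_deviation`).
-/

namespace OneBit

/-! ### Real recursions -/

/-- The sequence `t ^ (-s)` is a supersolution of the recursion with factor `1 - s / t`: this is
Bernoulli's inequality `(1 + 1 / t) ^ s ≤ 1 + s / t`, where `s ≤ 1` enters. -/
theorem one_sub_div_mul_rpow_le {s t : ℝ} (hs : 0 ≤ s) (hs1 : s ≤ 1) (ht : 0 < t) :
    (1 - s / t) * t ^ (-s) ≤ (t + 1) ^ (-s) := by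
  have h1 : (1 + 1 / t) ^ s ≤ 1 + s * (1 / t) :=
    rpow_one_add_le_one_add_mul_self
      (by have := one_div_pos.2 ht; linarith) hs hs1
  have h2 : (t + 1) ^ s = t ^ s * (1 + 1 / t) ^ s := by
    rw [← Real.mul_rpow ht.le (by positivity)]
    congr 1
    field_simp
  rw [Real.rpow_neg ht.le, Real.rpow_neg (by positivity), h2, mul_inv, mul_comm]
  refine mul_le_mul_of_nonneg_left ?_ (by positivity)
  have h3 : (0 : ℝ) < (1 + 1 / t) ^ s := by positivity
  have h4 : 0 ≤ s / t := by positivity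
  calc 1 - s / t ≤ 1 / (1 + s / t) := by
        rw [le_div_iff₀ (by positivity)]
        nlinarith [sq_nonneg (s / t)]
    _ ≤ ((1 + 1 / t) ^ s)⁻¹ := by
        rw [← one_div]
        gcongr
        exact h1.trans_eq (by ring)

/-- A recursion with contraction factor `1 - κ / t` and forcing `O(1 / t²)` decays like `t ^ (-s)`
for every `s ≤ 1` below `κ`. -/
theorem exists_le_mul_rpow_of_contraction {A : ℕ → ℝ} {κ s C : ℝ} {T : ℕ} (hs : 0 ≤ s)
    (hs1 : s ≤ 1) (hsκ : s < κ) (hC : 0 ≤ C)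
    (hA : ∀ t ≥ T, A (t + 1) ≤ (1 - κ / t) * A t + C / (t : ℝ) ^ 2) :
    ∃ K, 0 ≤ K ∧ ∀ᶠ t : ℕ in atTop, A t ≤ K * (t : ℝ) ^ (-s) := by
  obtain ⟨T', hT'⟩ := exists_nat_ge (max κ (max T 1))
  have hκ' : κ ≤ T' := (le_max_left _ _).trans hT'
  have hTT' : T ≤ T' := by
    exact_mod_cast ((le_max_left _ _).trans (le_max_right _ _)).trans hT'
  have h1T' : 1 ≤ T' := by
    exact_mod_cast ((le_max_right _ _).trans (le_max_right _ _)).trans hT'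
  have hT0 : (0 : ℝ) < (T' : ℝ) ^ (-s) := Real.rpow_pos_of_pos (by exact_mod_cast h1T') _
  set K := max (A T' / (T' : ℝ) ^ (-s)) (C / (κ - s)) with hK
  have hκs : 0 < κ - s := sub_pos.2 hsκ
  have hK0 : 0 ≤ K := le_max_of_le_right (by positivity)
  have hKC : C ≤ K * (κ - s) := (div_le_iff₀ hκs).1 (le_max_right _ _)
  refine ⟨K, hK0, eventually_atTop.2 ⟨T', fun t ht => ?_⟩⟩
  induction t, ht using Nat.le_induction with
  | base => exact (div_le_iff₀ hT0).1 (le_max_left _ _)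
  | succ t ht ih =>
    have ht1 : (1 : ℝ) ≤ t := by exact_mod_cast h1T'.trans ht
    have ht0 : (0 : ℝ) < t := by linarith
    have hκt : 0 ≤ 1 - κ / t := by
      rw [sub_nonneg, div_le_one ht0]
      exact hκ'.trans (by exact_mod_cast ht)
    -- `t⁻² ≤ t⁻¹ t⁻ˢ`, because `s ≤ 1`
    have hpow : C / (t : ℝ) ^ 2 ≤ K * ((κ - s) / t * (t : ℝ) ^ (-s)) := by
      have h3 : (1 : ℝ) / t ≤ (t : ℝ) ^ (-s) := by
        rw [one_div, ← Real.rpow_neg_one]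
        exact Real.rpow_le_rpow_of_exponent_le ht1 (by linarith)
      calc C / (t : ℝ) ^ 2 = C / t * (1 / t) := by field_simp
        _ ≤ C / t * (t : ℝ) ^ (-s) := by gcongr
        _ ≤ K * (κ - s) / t * (t : ℝ) ^ (-s) := by gcongr
        _ = _ := by ring
    calc A (t + 1) ≤ (1 - κ / t) * A t + C / (t : ℝ) ^ 2 := hA t (hTT'.trans ht)
      _ ≤ (1 - κ / t) * (K * (t : ℝ) ^ (-s)) + K * ((κ - s) / t * (t : ℝ) ^ (-s)) := by gcongr
      _ = K * ((1 - s / t) * (t : ℝ) ^ (-s)) := by ring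
      _ ≤ K * ((t + 1 : ℝ) ^ (-s)) := by
        gcongr
        exact one_sub_div_mul_rpow_le hs hs1 ht0
      _ = _ := by push_cast; rfl

/-- The square of a quantity `a` that moves by `τ b` up to second order. -/
theorem sq_le_of_abs_sub_le {K τ a b a' : ℝ} (hτ : 0 ≤ τ) (hτ1 : τ ≤ 1) (ha : |a| ≤ K)
    (hb : |b| ≤ K) (h : |a' - a - τ * b| ≤ K * τ ^ 2) :
    a' ^ 2 ≤ a ^ 2 + 2 * τ * (a * b) + 6 * K ^ 2 * τ ^ 2 := by
  obtain ⟨ρ, rfl⟩ : ∃ ρ, a' = a + τ * b + ρ := ⟨a' - a - τ * b, by ring⟩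
  have hρ : |ρ| ≤ K * τ ^ 2 := by convert h using 2; ring
  have hK : 0 ≤ K := (abs_nonneg a).trans ha
  have hb2 : b ^ 2 ≤ K ^ 2 := sq_le_sq' (abs_le.1 hb).1 (abs_le.1 hb).2
  have hsum : |2 * (a + τ * b) + ρ| ≤ 5 * K := by
    have h1 : |τ * b| ≤ K := by
      rw [abs_mul, abs_of_nonneg hτ]; nlinarith [abs_nonneg b]
    have h2 : K * τ ^ 2 ≤ K := mul_le_of_le_one_right hK (pow_le_one₀ hτ hτ1)
    have h3 := hρ.trans h2
    rw [abs_le] at *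
    constructor <;> linarith [ha.1, ha.2, h1.1, h1.2, h3.1, h3.2]
  have hprod : (2 * (a + τ * b) + ρ) * ρ ≤ 5 * K * (K * τ ^ 2) := by
    refine (le_abs_self _).trans ?_
    rw [abs_mul]
    gcongr
  nlinarith [mul_le_mul_of_nonneg_left hb2 (sq_nonneg τ)]

/-- One step of a tracking error `a`: the estimate moves by at most `τ K`, and to within
`|a + τ b₁|` of the tracked value, while the tracked value moves by `τ b₂` up to second order. -/
theorem sq_le_of_tracking {K τ a b₁ b₂ w a' : ℝ} (hτ : 0 ≤ τ) (hτ1 : τ ≤ 1) (ha : |a| ≤ K)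
    (hb₁ : |b₁| ≤ K) (hb₂ : |b₂| ≤ K) (hw : |w| ≤ |a + τ * b₁|) (hwa : |w - a| ≤ τ * K)
    (h : |a' - w + τ * b₂| ≤ K * τ ^ 2) :
    a' ^ 2 ≤ a ^ 2 + 2 * τ * (a * b₁ - a * b₂) + 11 * K ^ 2 * τ ^ 2 := by
  have hK : 0 ≤ K := (abs_nonneg a).trans ha
  have hw2 : w ^ 2 ≤ (a + τ * b₁) ^ 2 := sq_le_sq.2 hw
  have hb12 : b₁ ^ 2 ≤ K ^ 2 := sq_le_sq' (abs_le.1 hb₁).1 (abs_le.1 hb₁).2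
  have hτK : τ * K ≤ K := mul_le_of_le_one_left hK hτ1
  have hwK : |w| ≤ 2 * K := by
    have := hwa.trans hτK
    rw [abs_le] at *
    constructor <;> linarith [ha.1, ha.2, this.1, this.2]
  obtain ⟨ρ, rfl⟩ : ∃ ρ, a' = w - τ * b₂ + ρ := ⟨a' - w + τ * b₂, by ring⟩
  have hρ : |ρ| ≤ K * τ ^ 2 := by convert h using 2; ring
  have hρ' : |ρ| ≤ τ * K := hρ.trans (by nlinarith [mul_nonneg hτ hK])
  have h1 : w * ρ ≤ 2 * K * (K * τ ^ 2) := by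
    refine (le_abs_self _).trans ?_
    rw [abs_mul]; gcongr
  have h2 : -(w - a) * b₂ ≤ τ * K * K := by
    refine (le_abs_self _).trans ?_
    rw [abs_mul, abs_neg]; gcongr
  have h3 : (-(τ * b₂) + ρ) ^ 2 ≤ (2 * (τ * K)) ^ 2 := by
    refine sq_le_sq' ?_ ?_ <;>
    · have : |τ * b₂| ≤ τ * K := by rw [abs_mul, abs_of_nonneg hτ]; gcongr
      rw [abs_le] at this hρ'
      linarith [this.1, this.2, hρ'.1, hρ'.2]
  nlinarith [mul_le_mul_of_nonneg_left hb12 (sq_nonneg τ), mul_le_mul_of_nonneg_left h2 hτ]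

/-- Strict diagonal dominance, up to scaling, of the symmetric matrix with diagonal `a - s`, `d - s`
and off-diagonal entries `-c`, when its determinant is positive. The weights are `p = c` and
`q = a - κ`, for which the first inequality is an equality, and `κ` is slightly larger than `s`. -/
theorem exists_weights {a c d s : ℝ} (hc : 0 < c) (ha : s < a) (h : c ^ 2 < (a - s) * (d - s)) :
    ∃ κ p q, s < κ ∧ 0 < p ∧ 0 < q ∧ q * c ≤ p * (a - κ) ∧ p * c ≤ q * (d - κ) := by
  have ha' : 0 < a - s := sub_pos.2 ha
  have hd' : 0 < d - s := pos_of_mul_pos_right ((sq_nonneg c).trans_lt h) ha'.le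
  set ε := ((a - s) * (d - s) - c ^ 2) / (2 * ((a - s) + (d - s))) with hε
  have hε0 : 0 < ε := by
    apply div_pos <;> linarith
  have hεm : ε * (2 * ((a - s) + (d - s))) = (a - s) * (d - s) - c ^ 2 :=
    div_mul_cancel₀ _ (by positivity)
  have hεa : ε < a - s := by
    by_contra hcon
    push Not at hcon
    nlinarith [mul_le_mul_of_nonneg_right hcon (by positivity : 0 ≤ (2 * ((a - s) + (d - s)))),
      mul_pos ha' ha', mul_pos ha' hd', sq_nonneg c]
  refine ⟨s + ε, c, a - (s + ε), by linarith, hc, by linarith, by linarith, ?_⟩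
  nlinarith [mul_pos hε0 hε0, mul_pos hε0 ha', mul_pos hε0 hd']

/-! ### Stable linear recursions in normed spaces -/

/-- The rates for which forcing a stable recursion at rate `g` gives solutions of rate `g`: `g`
decays more slowly than every geometric sequence. -/
structure SlowRate (g : ℕ → ℝ) : Prop where
  pos : ∀ t, 0 < g t
  slow : ∀ ρ < 1, ∀ᶠ t in atTop, ρ * g t ≤ g (t + 1)

section Shift

variable {E : Type*} [NormedAddCommGroup E] [NormedSpace ℂ E]

/-- The case of a first-order recursion. -/
theorem SlowRate.isBigO_of_shift_sub_smul {g : ℕ → ℝ} (hg : SlowRate g) {a : ℂ} (ha : ‖a‖ < 1)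
    {f : ℕ → E} (hf : (fun t => f (t + 1) - a • f t) =O[atTop] g) : f =O[atTop] g := by
  obtain ⟨ρ, haρ, hρ⟩ := exists_between ha
  obtain ⟨C, hC, hfC⟩ := hf.exists_nonneg
  obtain ⟨T, hT⟩ := eventually_atTop.1 (hfC.bound.and (hg.slow ρ hρ))
  set K := max (‖f T‖ / g T) (C / (ρ - ‖a‖)) with hK
  have hK0 : 0 ≤ K := le_max_of_le_left (div_nonneg (norm_nonneg _) (hg.pos T).le)
  have hKC : C ≤ K * (ρ - ‖a‖) := (div_le_iff₀ (sub_pos.2 haρ)).1 (le_max_right _ _)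
  refine Asymptotics.IsBigO.of_bound K (eventually_atTop.2 ⟨T, fun t ht => ?_⟩)
  rw [Real.norm_of_nonneg (hg.pos t).le]
  induction t, ht using Nat.le_induction with
  | base => exact (div_le_iff₀ (hg.pos T)).1 (le_max_left _ _)
  | succ t ht ih =>
    obtain ⟨h1, h2⟩ := hT t ht
    rw [Real.norm_of_nonneg (hg.pos t).le] at h1
    calc ‖f (t + 1)‖ = ‖(f (t + 1) - a • f t) + a • f t‖ := by rw [sub_add_cancel]
      _ ≤ ‖f (t + 1) - a • f t‖ + ‖a‖ * ‖f t‖ := (norm_add_le _ _).trans_eq (by rw [norm_smul])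
      _ ≤ C * g t + ‖a‖ * (K * g t) := by gcongr
      _ ≤ K * (ρ - ‖a‖) * g t + ‖a‖ * (K * g t) := by
        have := (hg.pos t).le
        gcongr
      _ = K * (ρ * g t) := by ring
      _ ≤ K * g (t + 1) := by gcongr

/-- The shift of sequences. -/
noncomputable def shift (E : Type*) [AddCommGroup E] [Module ℂ E] : Module.End ℂ (ℕ → E) :=
  LinearMap.funLeft ℂ E (· + 1)

theorem shift_pow_apply (k : ℕ) (f : ℕ → E) (t : ℕ) : (shift E ^ k) f t = f (t + k) := by
  induction k generalizing f with
  | zero => rfl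
  | succ k ih =>
    rw [pow_succ, Module.End.mul_apply, ih]
    simp [shift, LinearMap.funLeft_apply, add_assoc]

open Polynomial in
theorem SlowRate.isBigO_of_aeval_prod {g : ℕ → ℝ} (hg : SlowRate g) (m : Multiset ℂ)
    (hm : ∀ a ∈ m, ‖a‖ < 1) {f : ℕ → E}
    (hf : (aeval (shift E) (m.map fun a => X - C a).prod f) =O[atTop] g) : f =O[atTop] g := by
  induction m using Multiset.induction generalizing f with
  | empty => simpa using hf
  | cons a m ih =>
    rw [Multiset.map_cons, Multiset.prod_cons, map_mul, Module.End.mul_apply] at hf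
    refine ih (fun b hb => hm b (Multiset.mem_cons_of_mem hb)) ?_
    refine hg.isBigO_of_shift_sub_smul (hm a (Multiset.mem_cons_self a m)) ?_
    refine hf.congr_left fun t => ?_
    simp [Algebra.algebraMap_eq_smul_one, shift, LinearMap.funLeft_apply]

open Polynomial in
/-- Rates pass through a stable linear recursion. Over `ℂ` its characteristic polynomial is a
product of factors `X - a` with `‖a‖ < 1`, which are removed one at a time. -/
theorem SlowRate.isBigO_of_recursion {g : ℕ → ℝ} (hg : SlowRate g) {r : ℕ} (b : Fin r → ℂ)
    (hb : ∀ s : ℂ, s ^ r + ∑ k : Fin r, b k * s ^ (k : ℕ) = 0 → ‖s‖ < 1) {f : ℕ → E}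
    (hf : (fun t => f (t + r) + ∑ k : Fin r, b k • f (t + k)) =O[atTop] g) :
    f =O[atTop] g := by
  set p : ℂ[X] := X ^ r + ∑ k : Fin r, C (b k) * X ^ (k : ℕ) with hp
  have hmonic : p.Monic := monic_X_pow_add (degree_sum_fin_lt b)
  have hprod : p = (p.roots.map fun a => X - C a).prod :=
    (IsAlgClosed.splits p).eq_prod_roots_of_monic hmonic
  refine hg.isBigO_of_aeval_prod p.roots (fun a ha => hb a ?_) ?_
  · simpa [hp, eval_finsetSum] using (mem_roots'.1 ha).2
  · rw [← hprod]
    refine hf.congr_left fun t => ?_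
    simp [hp, shift_pow_apply, Algebra.algebraMap_eq_smul_one]

theorem slowRate_rpow (s : ℝ) {c : ℝ} (hc : 0 < c) : SlowRate fun t : ℕ => ((t : ℝ) + c) ^ (-s) where
  pos t := by positivity
  slow ρ hρ := by
    have h : Tendsto (fun t : ℕ => (((t : ℝ) + c) / ((t : ℝ) + c + 1)) ^ s) atTop (𝓝 1) := by
      have h1 : Tendsto (fun t : ℕ => ((t : ℝ) + c) / ((t : ℝ) + c + 1)) atTop (𝓝 1) := by
        have h2 : Tendsto (fun t : ℕ => 1 - ((t : ℝ) + c + 1)⁻¹) atTop (𝓝 (1 - 0)) := by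
          refine tendsto_const_nhds.sub (tendsto_inv_atTop_zero.comp ?_)
          exact tendsto_atTop_add_const_right _ _
            (tendsto_atTop_add_const_right _ _ tendsto_natCast_atTop_atTop)
        rw [sub_zero] at h2
        refine h2.congr fun t => ?_
        field_simp
        ring
      simpa using h1.rpow_const (p := s) (Or.inl one_ne_zero)
    filter_upwards [h.eventually_const_le hρ] with t ht
    rw [Real.div_rpow (by positivity) (by positivity), le_div_iff₀ (by positivity)] at ht
    rw [Real.rpow_neg (by positivity), Real.rpow_neg (by positivity), ← div_eq_mul_inv,
      div_le_iff₀ (by positivity), inv_mul_eq_div, le_div_iff₀ (by positivity)]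
    rw [Nat.cast_add, Nat.cast_one, add_right_comm]
    exact ht

end Shift

/-! ### Irreducible stochastic matrices and the Poisson equation -/

section Poisson

variable {h : ℕ} {P : Matrix (Fin h) (Fin h) ℝ} {π : Fin h → ℝ}

theorem pow_mem_rowStochastic (hP : P ∈ Matrix.rowStochastic ℝ (Fin h)) (k : ℕ) :
    P ^ k ∈ Matrix.rowStochastic ℝ (Fin h) := pow_mem hP k

theorem vecMul_pow_eq_self (hπ : π ᵥ* P = π) (k : ℕ) : π ᵥ* P ^ k = π := by
  induction k with
  | zero => simp
  | succ k ih => rw [pow_succ, ← Matrix.vecMul_vecMul, ih, hπ]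

theorem mulVec_pow_eq_self {φ : Fin h → ℝ} (hφ : P *ᵥ φ = φ) (k : ℕ) : P ^ k *ᵥ φ = φ := by
  induction k with
  | zero => simp
  | succ k ih => rw [pow_succ, ← Matrix.mulVec_mulVec, hφ, ih]

/-- A stationary distribution of an irreducible chain charges every state. -/
theorem stationary_pos (hP : P.IsIrreducible) (hπ : π ᵥ* P = π) (h0 : ∀ u, 0 ≤ π u)
    (h1 : ∑ u, π u = 1) (v : Fin h) : 0 < π v := by
  obtain ⟨u, hu⟩ : ∃ u, 0 < π u := by
    by_contra! hcon
    have : ∑ u, π u ≤ 0 := Finset.sum_nonpos fun u _ => hcon u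
    linarith
  obtain ⟨k, -, hk⟩ := (Matrix.isIrreducible_iff_exists_pow_pos hP.nonneg).1 hP u v
  have h2 : π v = ∑ w, π w * (P ^ k) w v := by
    conv_lhs => rw [← vecMul_pow_eq_self hπ k]
    rfl
  rw [h2]
  refine Finset.sum_pos' (fun w _ => mul_nonneg (h0 w) ?_) ⟨u, Finset.mem_univ u, mul_pos hu hk⟩
  exact Matrix.pow_apply_nonneg hP.nonneg k w v

/-- The maximum principle: harmonic functions of an irreducible chain are constant. -/
theorem harmonic_const (hPs : P ∈ Matrix.rowStochastic ℝ (Fin h)) (hP : P.IsIrreducible)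
    {φ : Fin h → ℝ} (hφ : P *ᵥ φ = φ) (u v : Fin h) : φ u = φ v := by
  have : Nonempty (Fin h) := ⟨u⟩
  obtain ⟨w, hw⟩ := Finite.exists_max φ
  suffices H : ∀ v, φ v = φ w by rw [H u, H v]
  intro v
  obtain ⟨k, -, hk⟩ := (Matrix.isIrreducible_iff_exists_pow_pos hP.nonneg).1 hP w v
  have hPk := pow_mem_rowStochastic hPs k
  have h1 : ∑ x, (P ^ k) w x * (φ w - φ x) = 0 := by
    have : φ w = ∑ x, (P ^ k) w x * φ x := by
      conv_lhs => rw [← mulVec_pow_eq_self hφ k]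
      rfl
    simp_rw [mul_sub, Finset.sum_sub_distrib, ← Finset.sum_mul,
      Matrix.sum_row_of_mem_rowStochastic hPk, ← this]
    ring
  have h2 := (Finset.sum_eq_zero_iff_of_nonneg fun x _ =>
    mul_nonneg (Matrix.nonneg_of_mem_rowStochastic hPk) (sub_nonneg.2 (hw x))).1 h1 v
    (Finset.mem_univ v)
  rcases mul_eq_zero.1 h2 with h3 | h3
  · exact absurd h3 hk.ne'
  · linarith

/-- Solvability of the Poisson equation. The matrix `1 - P + 1 πᵀ` is injective by the maximum
principle, hence invertible. -/
theorem exists_poisson_solution (hPs : P ∈ Matrix.rowStochastic ℝ (Fin h)) (hP : P.IsIrreducible)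
    (hπ : π ᵥ* P = π) (h1 : ∑ u, π u = 1) (φ : Fin h → ℝ) :
    ∃ g : Fin h → ℝ, ∀ u, g u - ∑ w, P u w * g w = φ u - ∑ w, π w * φ w := by
  have hone : π ⬝ᵥ 1 = 1 := by simpa [dotProduct] using h1
  set T : (Fin h → ℝ) →ₗ[ℝ] (Fin h → ℝ) := (1 - P + Matrix.vecMulVec 1 π).mulVecLin
  have hT : ∀ x, T x = x - P *ᵥ x + (π ⬝ᵥ x) • 1 := fun x => by
    rw [Matrix.mulVecLin_apply, Matrix.add_mulVec, Matrix.sub_mulVec, Matrix.one_mulVec,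
      Matrix.vecMulVec_mulVec, op_smul_eq_smul]
  have hπT : ∀ x, π ⬝ᵥ T x = π ⬝ᵥ x := fun x => by
    rw [hT, dotProduct_add, dotProduct_sub, Matrix.dotProduct_mulVec, hπ, sub_self, zero_add,
      dotProduct_smul, hone, smul_eq_mul, mul_one]
  have hinj : Function.Injective T := by
    rw [← LinearMap.ker_eq_bot, LinearMap.ker_eq_bot']
    intro x hx
    have hx0 : π ⬝ᵥ x = 0 := by rw [← hπT, hx, dotProduct_zero]
    have hPx : P *ᵥ x = x := by
      have := hT x
      rw [hx, hx0, zero_smul, add_zero] at this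
      exact (sub_eq_zero.1 this.symm).symm
    ext u
    have hc : π ⬝ᵥ x = x u := by
      have : x = x u • (1 : Fin h → ℝ) := by
        ext v
        simpa using harmonic_const hPs hP hPx v u
      rw [this, dotProduct_smul, hone]
      simp
    rw [← hc, hx0, Pi.zero_apply]
  obtain ⟨g, hg⟩ := LinearMap.injective_iff_surjective.1 hinj φ
  refine ⟨g, fun u => ?_⟩
  have h3 := congrFun (hT g) u
  rw [← hπT, hg] at h3
  simp only [Pi.add_apply, Pi.sub_apply, Pi.smul_apply, Pi.one_apply, smul_eq_mul, mul_one] at h3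
  change g u - (P *ᵥ g) u = φ u - π ⬝ᵥ φ
  linarith

end Poisson

/-! ### The switching signal and the noises -/

section History

variable {Ω : Type*} {N h : ℕ} {m : ℕ → Ω → Fin h} {d : ℕ → Fin N → Fin N → Ω → ℝ}

/-- The random history at time `t`: the topologies up to time `t`, and the noises before `t`. -/
def history (m : ℕ → Ω → Fin h) (d : ℕ → Fin N → Fin N → Ω → ℝ) (t : ℕ) (ω : Ω) :
    (Fin (t + 1) → Fin h) × (↥(Finset.range t ×ˢ (Finset.univ : Finset (Fin N × Fin N))) → ℝ) :=
  (fun k => m k ω, fun q => d q.1.1 q.1.2.1 q.1.2.2 ω)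

/-- The `σ`-algebra of the history at time `t`. -/
abbrev past (m : ℕ → Ω → Fin h) (d : ℕ → Fin N → Fin N → Ω → ℝ) (t : ℕ) : MeasurableSpace Ω :=
  MeasurableSpace.comap (history m d t) inferInstance

theorem measurable_past_switch {k t : ℕ} (hk : k ≤ t) : Measurable[past m d t] (m k) := by
  have h1 : Measurable[past m d t] (history m d t) := comap_measurable _
  exact (measurable_pi_apply (⟨k, Nat.lt_succ_of_le hk⟩ : Fin (t + 1))).comp (measurable_fst.comp h1)

theorem measurable_past_noise {k t : ℕ} (hk : k < t) (i j : Fin N) :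
    Measurable[past m d t] (d k i j) := by
  have h1 : Measurable[past m d t] (history m d t) := comap_measurable _
  exact (measurable_pi_apply (⟨(k, i, j), by simpa using hk⟩ :
    ↥(Finset.range t ×ˢ (Finset.univ : Finset (Fin N × Fin N))))).comp (measurable_snd.comp h1)

theorem past_mono (t : ℕ) : past m d t ≤ past m d (t + 1) := by
  let _ := past m d (t + 1)
  rw [past, ← measurable_iff_comap_le]
  refine Measurable.prodMk (measurable_pi_lambda _ fun k => ?_) (measurable_pi_lambda _ fun q => ?_)
  · exact measurable_past_switch (by omega)
  · refine measurable_past_noise ?_ _ _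
    have := (Finset.mem_product.1 q.2).1
    rw [Finset.mem_range] at this
    omega

end History

section Randomness

variable {Ω : Type*} [MeasurableSpace Ω] {μ : Measure Ω} [IsProbabilityMeasure μ]
  {N h : ℕ} {m : ℕ → Ω → Fin h} {P : Matrix (Fin h) (Fin h) ℝ} {π : Fin h → ℝ}
  {d : ℕ → Fin N → Fin N → Ω → ℝ} {δ : ℝ≥0}

theorem measurable_history (hm : ∀ t, Measurable (m t)) (hd : ∀ t i j, Measurable (d t i j))
    (t : ℕ) : Measurable (history m d t) :=
  (measurable_pi_lambda _ fun _ => hm _).prodMk (measurable_pi_lambda _ fun _ => hd _ _ _)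

theorem past_le (hm : ∀ t, Measurable (m t)) (hd : ∀ t i j, Measurable (d t i j)) (t : ℕ) :
    past m d t ≤ ‹MeasurableSpace Ω› :=
  (measurable_history hm hd t).comap_le

/-- The noise at time `t` is independent of the history, which contains the topology at time `t`. -/
theorem indepFun_noise_history (hd : IsGaussianNoise μ d δ) (hm : ∀ t, Measurable (m t))
    (hdm : IndepFun (fun ω (q : ℕ × Fin N × Fin N) => d q.1 q.2.1 q.2.2 ω)
      (fun ω t => m t ω) μ) (t : ℕ) (i j : Fin N) :
    IndepFun (d t i j) (history m d t) μ := by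
  set D : Ω → (↥(Finset.range t ×ˢ (Finset.univ : Finset (Fin N × Fin N))) → ℝ) :=
    fun ω q => d q.1.1 q.1.2.1 q.1.2.2 ω
  set m' : Ω → Fin (t + 1) → Fin h := fun ω k => m k ω
  have hmD : Measurable D := measurable_pi_lambda _ fun _ => hd.measurable _ _ _
  have hmm' : Measurable m' := measurable_pi_lambda _ fun _ => hm _
  have hmd := hd.measurable t i j
  have h1 : IndepFun (d t i j) D μ := by
    have := hd.indep.indepFun_finset {(t, i, j)}
      (Finset.range t ×ˢ (Finset.univ : Finset (Fin N × Fin N))) (by simp)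
      (fun q => hd.measurable _ _ _)
    exact this.comp (measurable_pi_apply (⟨(t, i, j), by simp⟩ :
      ↥({(t, i, j)} : Finset (ℕ × Fin N × Fin N)))) measurable_id
  have h2 : IndepFun (fun ω => (d t i j ω, D ω)) m' μ := by
    refine hdm.comp (φ := fun f => (f (t, i, j),
      fun q : ↥(Finset.range t ×ˢ (Finset.univ : Finset (Fin N × Fin N))) => f q.1))
      (ψ := fun f (k : Fin (t + 1)) => f k) ?_ ?_
    · fun_prop
    · fun_prop
  have h3 : IndepFun (d t i j) (fun ω => (D ω, m' ω)) μ := by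
    rw [indepFun_iff_map_prod_eq_prod_map_map hmd.aemeasurable (hmD.prodMk hmm').aemeasurable]
    rw [indepFun_iff_map_prod_eq_prod_map_map (hmd.prodMk hmD).aemeasurable hmm'.aemeasurable,
      (indepFun_iff_map_prod_eq_prod_map_map hmd.aemeasurable hmD.aemeasurable).1 h1] at h2
    have h4 : IndepFun D m' μ := by
      refine hdm.comp
        (φ := fun f (q : ↥(Finset.range t ×ˢ (Finset.univ : Finset (Fin N × Fin N)))) => f q.1)
        (ψ := fun f (k : Fin (t + 1)) => f k) ?_ ?_
      · fun_prop
      · fun_prop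
    rw [(indepFun_iff_map_prod_eq_prod_map_map hmD.aemeasurable hmm'.aemeasurable).1 h4]
    have := Measure.isProbabilityMeasure_map (μ := μ) hmd.aemeasurable
    have := Measure.isProbabilityMeasure_map (μ := μ) hmD.aemeasurable
    have := Measure.isProbabilityMeasure_map (μ := μ) hmm'.aemeasurable
    rw [← Measure.prodAssoc_prod, ← h2, Measure.map_map (by fun_prop) (by fun_prop)]
    rfl
  exact h3.comp measurable_id measurable_swap

/-- The noise is fresh: a one-bit signal with threshold in the past can be averaged out. -/
theorem integral_indicator_noise (hd : IsGaussianNoise μ d δ) (hm : ∀ t, Measurable (m t))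
    (hdm : IndepFun (fun ω (q : ℕ × Fin N × Fin N) => d q.1 q.2.1 q.2.2 ω)
      (fun ω t => m t ω) μ) (t : ℕ) (i j : Fin N) {Y Z : Ω → ℝ}
    (hY : Measurable[past m d t] Y) (hZ : Measurable[past m d t] Z) {C : ℝ}
    (hZC : ∀ ω, |Z ω| ≤ C) :
    ∫ ω, Z ω * {ω | d t i j ω ≤ Y ω}.indicator 1 ω ∂μ =
      ∫ ω, Z ω * cdf (gaussianReal 0 (δ ^ 2)) (Y ω) ∂μ := by
  obtain ⟨Φ, hΦ, hYZ⟩ := (hY.prodMk hZ).exists_eq_measurable_comp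
  have hind : IndepFun (d t i j) (fun ω => (Y ω, Z ω)) μ := by
    rw [hYZ]
    exact (indepFun_noise_history hd hm hdm t i j).comp measurable_id hΦ
  have hle := past_le hm hd.measurable t
  have hY' := hY.mono hle le_rfl
  have hZ' := hZ.mono hle le_rfl
  have hmd := hd.measurable t i j
  have hmap := (indepFun_iff_map_prod_eq_prod_map_map hmd.aemeasurable
    (hY'.prodMk hZ').aemeasurable).1 hind
  rw [hd.law] at hmap
  have := Measure.isProbabilityMeasure_map (μ := μ) (hY'.prodMk hZ').aemeasurable
  set G : ℝ × ℝ × ℝ → ℝ := fun p => p.2.2 * {p : ℝ × ℝ × ℝ | p.1 ≤ p.2.1}.indicator 1 p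
  have hset : MeasurableSet {p : ℝ × ℝ × ℝ | p.1 ≤ p.2.1} :=
    measurableSet_le measurable_fst (measurable_fst.comp measurable_snd)
  have hG : Measurable G :=
    (measurable_snd.comp measurable_snd).mul (measurable_one.indicator hset)
  have hbound : ∀ᵐ ω ∂μ, ‖G (d t i j ω, Y ω, Z ω)‖ ≤ C := by
    refine ae_of_all _ fun ω => ?_
    have h0 := hZC ω
    by_cases hlt : d t i j ω ≤ Y ω
    · simpa [G, Set.indicator, hlt] using h0
    · simpa [G, Set.indicator, hlt] using (abs_nonneg _).trans h0
  have hGint : Integrable G ((gaussianReal 0 (δ ^ 2)).prod (μ.map fun ω => (Y ω, Z ω))) := by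
    rw [← hmap]
    refine (integrable_map_measure hG.aestronglyMeasurable
      (hmd.prodMk (hY'.prodMk hZ')).aemeasurable).2 ?_
    exact .of_bound (hG.comp (hmd.prodMk (hY'.prodMk hZ'))).aestronglyMeasurable C hbound
  calc ∫ ω, Z ω * {ω | d t i j ω ≤ Y ω}.indicator 1 ω ∂μ
      = ∫ p, G p ∂(μ.map fun ω => (d t i j ω, Y ω, Z ω)) :=
        (integral_map (hmd.prodMk (hY'.prodMk hZ')).aemeasurable hG.aestronglyMeasurable).symm
    _ = ∫ q, ∫ x, G (x, q) ∂(gaussianReal 0 (δ ^ 2)) ∂(μ.map fun ω => (Y ω, Z ω)) := by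
        rw [hmap, integral_prod_symm _ hGint]
    _ = ∫ q, q.2 * cdf (gaussianReal 0 (δ ^ 2)) q.1 ∂(μ.map fun ω => (Y ω, Z ω)) := by
        refine integral_congr_ae (ae_of_all _ fun q => ?_)
        change ∫ x, q.2 * (Set.Iic q.1).indicator 1 x ∂_ = _
        rw [integral_const_mul, integral_indicator_one measurableSet_Iic, ← cdf_eq_real]
    _ = _ := by
        rw [integral_map (hY'.prodMk hZ').aemeasurable]
        exact (measurable_snd.mul
          ((monotone_cdf _).measurable.comp measurable_fst)).aestronglyMeasurable

/-- The Markov property, relative to the history of the topologies and the noises. -/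
theorem integral_next_switch (hd : IsGaussianNoise μ d δ) (hm : IsMarkovChain μ m P)
    (hdm : IndepFun (fun ω (q : ℕ × Fin N × Fin N) => d q.1 q.2.1 q.2.2 ω)
      (fun ω t => m t ω) μ) (t : ℕ) (v : Fin h) {Z : Ω → ℝ}
    (hZ : Measurable[past m d t] Z) {C : ℝ} (hZC : ∀ ω, |Z ω| ≤ C) :
    ∫ ω, {ω | m (t + 1) ω = v}.indicator Z ω ∂μ = ∫ ω, P (m t ω) v * Z ω ∂μ := by
  obtain ⟨Φ₀, hΦ₀, hZΦ₀⟩ := hZ.exists_eq_measurable_comp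
  -- truncation makes `Φ` bounded off the range of the history as well
  set Φ := fun p => max (-C) (min C (Φ₀ p)) with hΦdef
  have hΦ : Measurable Φ := by fun_prop
  have hΦC : ∀ p, |Φ p| ≤ |C| := fun p => by
    simp only [hΦdef, abs_le]
    have := neg_abs_le C
    have := le_abs_self C
    constructor
    · exact le_max_of_le_left (by linarith)
    · exact max_le (by linarith) ((min_le_left _ _).trans (by linarith))
  have hZΦ : ∀ ω, Z ω = Φ (history m d t ω) := fun ω => by
    have h1 : Z ω = Φ₀ (history m d t ω) := congrFun hZΦ₀ ω
    have h2 := abs_le.1 (hZC ω)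
    simp only [hΦdef, ← h1]
    rw [min_eq_right h2.2, max_eq_right h2.1]
  set D : Ω → (↥(Finset.range t ×ˢ (Finset.univ : Finset (Fin N × Fin N))) → ℝ) :=
    fun ω q => d q.1.1 q.1.2.1 q.1.2.2 ω
  set m' : Ω → Fin (t + 1) → Fin h := fun ω k => m k ω with hm'
  have hmD : Measurable D := measurable_pi_lambda _ fun _ => hd.measurable _ _ _
  have hmm' : Measurable m' := measurable_pi_lambda _ fun _ => hm.measurable _
  have hDm : IndepFun (fun ω => (m' ω, m (t + 1) ω)) D μ := by
    refine (hdm.comp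
      (φ := fun f (q : ↥(Finset.range t ×ˢ (Finset.univ : Finset (Fin N × Fin N)))) => f q.1)
      (ψ := fun f : ℕ → Fin h => (fun k : Fin (t + 1) => f k, f (t + 1))) ?_ ?_).symm
    · fun_prop
    · fun_prop
  have hφ : ∀ s, Measurable fun p => Φ (s, p) := fun s => hΦ.comp measurable_prodMk_left
  -- for a fixed path `s`, the noises and the chain separate
  have hsplit : ∀ (A : Set ((Fin (t + 1) → Fin h) × Fin h)) (s : Fin (t + 1) → Fin h),
      ∫ ω, A.indicator 1 (m' ω, m (t + 1) ω) * Φ (s, D ω) ∂μ =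
        μ.real {ω | (m' ω, m (t + 1) ω) ∈ A} * ∫ ω, Φ (s, D ω) ∂μ := fun A s => by
    have hA : MeasurableSet A := A.toFinite.measurableSet
    have hmA : MeasurableSet {ω | (m' ω, m (t + 1) ω) ∈ A} :=
      (hmm'.prodMk (hm.measurable _)) hA
    have h1 := (hDm.comp (φ := A.indicator (1 : (Fin (t + 1) → Fin h) × Fin h → ℝ)) (ψ := fun p => Φ (s, p))
      (measurable_one.indicator hA) (hφ s)).integral_fun_mul_eq_mul_integral
      ((measurable_one.indicator hA).comp (hmm'.prodMk (hm.measurable _))).aestronglyMeasurable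
      ((hφ s).comp hmD).aestronglyMeasurable
    refine h1.trans ?_
    congr 1
    rw [← integral_indicator_one hmA]
    rfl
  have hint : ∀ (A : Set ((Fin (t + 1) → Fin h) × Fin h)) (s : Fin (t + 1) → Fin h),
      Integrable (fun ω => A.indicator 1 (m' ω, m (t + 1) ω) * Φ (s, D ω)) μ := fun A s => by
    have hA : MeasurableSet A := A.toFinite.measurableSet
    refine .of_bound (((measurable_one.indicator hA).comp (hmm'.prodMk (hm.measurable _))).mul
      ((hφ s).comp hmD)).aestronglyMeasurable |C| (ae_of_all _ fun ω => ?_)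
    rw [norm_mul]
    refine (mul_le_of_le_one_left (norm_nonneg _) ?_).trans (hΦC _)
    by_cases h : (m' ω, m (t + 1) ω) ∈ A <;> simp [h]
  -- the Markov property on each path of the chain up to time `t`
  have hlaw : ∀ s : Fin (t + 1) → Fin h,
      μ.real {ω | (m' ω, m (t + 1) ω) ∈ ({(s, v)} : Set _)} =
        P (s (Fin.last t)) v * μ.real {ω | (m' ω, m (t + 1) ω) ∈ Prod.fst ⁻¹' {s}} := fun s => by
    have h1 := hm.markov t fun k => if hk : k < t + 1 then s ⟨k, hk⟩ else v
    have h2 : {ω | ∀ k ≤ t, m k ω = if hk : k < t + 1 then s ⟨k, hk⟩ else v} =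
        {ω | (m' ω, m (t + 1) ω) ∈ Prod.fst ⁻¹' {s}} := by
      ext ω
      simp only [Set.mem_ofPred_eq, Set.mem_preimage, Set.mem_singleton_iff, funext_iff, hm']
      constructor
      · intro H k
        simpa [k.2] using H k (Nat.le_of_lt_succ k.2)
      · intro H k hk
        rw [dif_pos (Nat.lt_succ_of_le hk), ← H]
    have h3 : {ω | ∀ k ≤ t + 1, m k ω = if hk : k < t + 1 then s ⟨k, hk⟩ else v} =
        {ω | (m' ω, m (t + 1) ω) ∈ ({(s, v)} : Set _)} := by
      ext ω
      simp only [Set.mem_ofPred_eq, Set.mem_singleton_iff, Prod.mk.injEq, funext_iff, hm']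
      constructor
      · intro H
        refine ⟨fun k => ?_, by simpa using H (t + 1) le_rfl⟩
        simpa [k.2] using H k (by omega)
      · rintro ⟨H1, H2⟩ k hk
        rcases hk.lt_or_eq with hk | rfl
        · rw [dif_pos hk, ← H1]
        · simpa using H2
    rw [h2, h3] at h1
    rw [h1, mul_comm]
    simp [Fin.last]
  calc ∫ ω, {ω | m (t + 1) ω = v}.indicator Z ω ∂μ
      = ∫ ω, ∑ s, ({(s, v)} : Set _).indicator 1 (m' ω, m (t + 1) ω) * Φ (s, D ω) ∂μ := by
        refine integral_congr_ae (ae_of_all _ fun ω => ?_)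
        change _ = ∑ s, _
        rw [Finset.sum_eq_single (m' ω) (fun s _ hs => ?_) (by simp)]
        · by_cases hv : m (t + 1) ω = v
          · simp only [Set.indicator, Set.mem_ofPred_eq, Set.mem_singleton_iff, hv, if_true,
              Pi.one_apply, one_mul]
            exact hZΦ ω
          · simp [Set.indicator, hv]
        · simp [Set.indicator, hs.symm]
    _ = ∑ s, P (s (Fin.last t)) v *
          ∫ ω, (Prod.fst ⁻¹' {s} : Set _).indicator 1 (m' ω, m (t + 1) ω) * Φ (s, D ω) ∂μ := by
        rw [integral_finsetSum _ fun s _ => hint _ s]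
        refine Finset.sum_congr rfl fun s _ => ?_
        rw [hsplit, hsplit, hlaw, mul_assoc]
    _ = ∫ ω, ∑ s, P (s (Fin.last t)) v *
          ((Prod.fst ⁻¹' {s} : Set _).indicator 1 (m' ω, m (t + 1) ω) * Φ (s, D ω)) ∂μ := by
        rw [integral_finsetSum _ fun s _ => (hint _ s).const_mul _]
        simp_rw [integral_const_mul]
    _ = _ := by
        refine integral_congr_ae (ae_of_all _ fun ω => ?_)
        change ∑ s, _ = _
        rw [Finset.sum_eq_single (m' ω) (fun s _ hs => ?_) (by simp)]
        · simp only [Set.indicator, Set.mem_preimage, Set.mem_singleton_iff, if_true,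
            Pi.one_apply, one_mul]
          rw [hZΦ ω]
          rfl
        · simp [Set.indicator, hs.symm]

theorem sum_switch_law (hm : IsMarkovChain μ m P) (t : ℕ) : ∑ u, μ.real {ω | m t ω = u} = 1 := by
  have hmap := Measure.isProbabilityMeasure_map (μ := μ) (hm.measurable t).aemeasurable
  have h1 : ∀ u, μ.real {ω | m t ω = u} = (μ.map (m t)).real {u} := fun u => by
    rw [map_measureReal_apply (hm.measurable t) (measurableSet_singleton u)]
    rfl
  simp_rw [h1]
  rw [sum_measureReal_singleton]
  simp

theorem limit_law_sum (hm : IsMarkovChain μ m P)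
    (hπ : ∀ u, Tendsto (fun t => μ.real {ω | m t ω = u}) atTop (𝓝 (π u))) : ∑ u, π u = 1 := by
  refine tendsto_nhds_unique (tendsto_finsetSum _ fun u _ => hπ u) ?_
  simp_rw [sum_switch_law hm]
  exact tendsto_const_nhds

/-- The limit of the laws of the chain is stationary. -/
theorem limit_law_vecMul (hd : IsGaussianNoise μ d δ) (hm : IsMarkovChain μ m P)
    (hdm : IndepFun (fun ω (q : ℕ × Fin N × Fin N) => d q.1 q.2.1 q.2.2 ω)
      (fun ω t => m t ω) μ)
    (hπ : ∀ u, Tendsto (fun t => μ.real {ω | m t ω = u}) atTop (𝓝 (π u))) : π ᵥ* P = π := by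
  ext v
  have h1 : ∀ t, μ.real {ω | m (t + 1) ω = v} = ∑ u, μ.real {ω | m t ω = u} * P u v := fun t => by
    have hmeas : ∀ t u, MeasurableSet {ω | m t ω = u} := fun t u =>
      hm.measurable t (measurableSet_singleton u)
    have h2 := integral_next_switch hd hm hdm t v (Z := fun _ => 1) (@measurable_const _ _ _ (past m d t) _)
      (C := 1) (by simp)
    rw [← Pi.one_def, integral_indicator_one (hmeas _ _)] at h2
    rw [h2]
    calc ∫ ω, P (m t ω) v * (1 : ℝ) ∂μ
        = ∫ ω, ∑ u, {ω | m t ω = u}.indicator 1 ω * P u v ∂μ := by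
          refine integral_congr_ae (ae_of_all _ fun ω => ?_)
          simp [Set.indicator]
      _ = _ := by
          rw [integral_finsetSum]
          · simp_rw [integral_mul_const, integral_indicator_one (hmeas _ _)]
          · intro u _
            exact ((integrable_const (1 : ℝ)).indicator (hmeas t u)).mul_const _
  have h2 : Tendsto (fun t => μ.real {ω | m (t + 1) ω = v}) atTop (𝓝 (∑ u, π u * P u v)) := by
    simp_rw [h1]
    exact tendsto_finsetSum _ fun u _ => (hπ u).mul_const _
  exact tendsto_nhds_unique h2 ((tendsto_add_atTop_iff_nat 1).2 (hπ v))

end Randomness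

/-! ### Spectral bounds for quadratic forms -/

theorem sqrt_dotProduct_self {ι : Type*} [Fintype ι] (x : ι → ℝ) :
    √(x ⬝ᵥ x) = ‖WithLp.toLp 2 x‖ := by
  rw [EuclideanSpace.norm_eq]
  congr 1
  exact Finset.sum_congr rfl fun i _ => by simp [sq]

section OpNorm

open scoped Matrix.Norms.L2Operator

variable {ι κ : Type*} [Fintype ι] [Fintype κ] [DecidableEq κ]

theorem dotProduct_mulVec_le_opNorm (A : Matrix ι κ ℝ) (x : ι → ℝ) (y : κ → ℝ) :
    x ⬝ᵥ A *ᵥ y ≤ ‖A‖ * √(x ⬝ᵥ x) * √(y ⬝ᵥ y) := by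
  rw [sqrt_dotProduct_self, sqrt_dotProduct_self]
  have h1 : x ⬝ᵥ A *ᵥ y = inner ℝ (WithLp.toLp 2 (A *ᵥ y)) (WithLp.toLp 2 x) := by
    rw [EuclideanSpace.inner_toLp_toLp, star_trivial]
  rw [h1]
  refine (real_inner_le_norm _ _).trans ?_
  have h2 := Matrix.l2_opNorm_mulVec A (WithLp.toLp 2 y)
  calc _ ≤ ‖A‖ * ‖WithLp.toLp 2 y‖ * ‖WithLp.toLp 2 x‖ := by
        gcongr
        exact h2
    _ = _ := by ring

/-- Young's inequality for a bilinear form, with weight `k`. -/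
theorem two_mul_dotProduct_mulVec_le (A : Matrix ι κ ℝ) (x : ι → ℝ) (y : κ → ℝ) {l k : ℝ}
    (hA : ‖A‖ ^ 2 ≤ l) (hk : 0 < k) :
    2 * (x ⬝ᵥ A *ᵥ y) ≤ l / k * (x ⬝ᵥ x) + k * (y ⬝ᵥ y) := by
  have hx : 0 ≤ x ⬝ᵥ x := Finset.sum_nonneg fun i _ => mul_self_nonneg _
  have hy : 0 ≤ y ⬝ᵥ y := Finset.sum_nonneg fun i _ => mul_self_nonneg _
  have h1 := dotProduct_mulVec_le_opNorm A x y
  have h2 : 2 * (‖A‖ * √(x ⬝ᵥ x) * √(y ⬝ᵥ y)) ≤ ‖A‖ ^ 2 / k * (x ⬝ᵥ x) + k * (y ⬝ᵥ y) := by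
    have h3 : ‖A‖ ^ 2 / k * (x ⬝ᵥ x) + k * (y ⬝ᵥ y) - 2 * (‖A‖ * √(x ⬝ᵥ x) * √(y ⬝ᵥ y)) =
        (‖A‖ * √(x ⬝ᵥ x) - k * √(y ⬝ᵥ y)) ^ 2 / k := by
      nth_rw 1 [← Real.sq_sqrt hx, ← Real.sq_sqrt hy]
      field_simp
      ring
    have h4 := div_nonneg (sq_nonneg (‖A‖ * √(x ⬝ᵥ x) - k * √(y ⬝ᵥ y))) hk.le
    linarith
  have h5 : ‖A‖ ^ 2 / k * (x ⬝ᵥ x) ≤ l / k * (x ⬝ᵥ x) := by gcongr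
  linarith

theorem neg_two_mul_dotProduct_mulVec_le {ι : Type*} [Fintype ι] [DecidableEq ι]
    (A : Matrix ι ι ℝ) (x : ι → ℝ) {l : ℝ} (hA : ‖A‖ ^ 2 ≤ l) :
    -2 * (x ⬝ᵥ A *ᵥ x) ≤ 2 * √l * (x ⬝ᵥ x) := by
  have hx : 0 ≤ x ⬝ᵥ x := Finset.sum_nonneg fun i _ => mul_self_nonneg _
  have h1 := dotProduct_mulVec_le_opNorm A (-x) x
  rw [neg_dotProduct, neg_dotProduct_neg, mul_assoc, Real.mul_self_sqrt hx] at h1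
  have h2 : ‖A‖ * (x ⬝ᵥ x) ≤ √l * (x ⬝ᵥ x) :=
    mul_le_mul_of_nonneg_right (Real.le_sqrt_of_sq_le hA) hx
  linarith

end OpNorm

namespace Setup

variable {N r h : ℕ} (S : Setup N r h) {π : Fin h → ℝ}

theorem adj_union_of_adj {u : Fin h} {i j : Fin N} (hij : (S.G u).Adj i j) : S.union.Adj i j :=
  le_iSup S.G u hij

theorem exists_adj_of_adj_union {i j : Fin N} (hij : S.union.Adj i j) : ∃ u, (S.G u).Adj i j := by
  simpa [union] using hij

theorem J_mulVec_apply (y : Fin N → ℝ) (i : Fin N) : (S.J *ᵥ y) i = y i - 1 / (N : ℝ) * ∑ j, y j := by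
  rw [J, Matrix.sub_mulVec, Matrix.one_mulVec, Matrix.smul_mulVec]
  simp [Matrix.mulVec, dotProduct]

theorem J_mulVec_eq_sub_smul (y : Fin N → ℝ) :
    S.J *ᵥ y = y - (1 / (N : ℝ) * ∑ j, y j) • (1 : Fin N → ℝ) := by
  ext i
  simp [J_mulVec_apply]

theorem L_mulVec_one (u : Fin h) : S.L u *ᵥ (1 : Fin N → ℝ) = 0 := by
  classical
  exact SimpleGraph.lapMatrix_mulVec_const_eq_zero (R := ℝ) (S.G u)

theorem L_mulVec_J_mulVec (u : Fin h) (y : Fin N → ℝ) : S.L u *ᵥ (S.J *ᵥ y) = S.L u *ᵥ y := by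
  rw [J_mulVec_eq_sub_smul, Matrix.mulVec_sub, Matrix.mulVec_smul, L_mulVec_one, smul_zero, sub_zero]

theorem avgL_mulVec (y : Fin N → ℝ) : S.avgL π *ᵥ y = ∑ u, π u • S.L u *ᵥ y := by
  simp [avgL, Matrix.sum_mulVec, Matrix.smul_mulVec]

theorem sum_J_mulVec (hN : 2 ≤ N) (y : Fin N → ℝ) : ∑ i, (S.J *ᵥ y) i = 0 := by
  have : (N : ℝ) ≠ 0 := by positivity
  simp only [J_mulVec_apply, Finset.sum_sub_distrib, Finset.sum_const, Finset.card_univ,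
    Fintype.card_fin, nsmul_eq_mul]
  field_simp
  ring

theorem dotProduct_L_mulVec_nonneg (u : Fin h) (y : Fin N → ℝ) : 0 ≤ y ⬝ᵥ S.L u *ᵥ y := by
  classical
  exact ((S.G u).posSemidef_lapMatrix ℝ).dotProduct_mulVec_nonneg y

theorem dotProduct_L_mulVec_eq (u : Fin h) (y : Fin N → ℝ) :
    y ⬝ᵥ S.L u *ᵥ y = (S.J *ᵥ y) ⬝ᵥ S.L u *ᵥ (S.J *ᵥ y) := by
  classical
  have hsymm : (S.L u)ᵀ = S.L u := SimpleGraph.isSymm_lapMatrix (R := ℝ) (S.G u)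
  rw [L_mulVec_J_mulVec, Matrix.dotProduct_mulVec, Matrix.dotProduct_mulVec, ← Matrix.mulVec_transpose,
    ← Matrix.mulVec_transpose, hsymm, L_mulVec_J_mulVec]

theorem avgL_posSemidef (hπ : ∀ u, 0 ≤ π u) : (S.avgL π).PosSemidef := by
  refine Matrix.PosSemidef.of_dotProduct_mulVec_nonneg (S.avgL_isHermitian π) fun y => ?_
  rw [avgL_mulVec, dotProduct_sum, star_trivial]
  refine Finset.sum_nonneg fun u _ => ?_
  rw [dotProduct_smul]
  exact mul_nonneg (hπ u) (S.dotProduct_L_mulVec_nonneg u y)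

/-- Joint connectivity: only the constant vectors are in the kernel of the averaged Laplacian. -/
theorem eq_of_avgL_mulVec_eq_zero (hconn : S.union.Connected) (hπ : ∀ u, 0 < π u) {y : Fin N → ℝ}
    (hy : S.avgL π *ᵥ y = 0) (i j : Fin N) : y i = y j := by
  classical
  have h1 : ∑ u, π u * (y ⬝ᵥ S.L u *ᵥ y) = 0 := by
    have := congrArg (y ⬝ᵥ ·) hy
    simpa [avgL_mulVec, dotProduct_sum, dotProduct_smul] using this
  have h2 : ∀ u, y ⬝ᵥ S.L u *ᵥ y = 0 := fun u => by
    have := (Finset.sum_eq_zero_iff_of_nonneg fun u _ =>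
      mul_nonneg (hπ u).le (S.dotProduct_L_mulVec_nonneg u y)).1 h1 u (Finset.mem_univ u)
    exact (mul_eq_zero.1 this).resolve_left (hπ u).ne'
  have h3 : ∀ i j, S.union.Adj i j → y i = y j := fun i j hij => by
    obtain ⟨u, hu⟩ := S.exists_adj_of_adj_union hij
    refine ((S.G u).lapMatrix_toLinearMap₂'_apply'_eq_zero_iff_forall_adj ℝ y).1 ?_ i j hu
    rw [Matrix.toLinearMap₂'_apply']
    exact h2 u
  obtain ⟨w⟩ := hconn.preconnected i j
  induction w with
  | nil => rfl
  | cons hadj _ ih => exact (h3 _ _ hadj).trans ih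

/-! ### The spectral decomposition of the averaged Laplacian -/

theorem TG_transpose_mul_self (π : Fin h → ℝ) : (S.TG π)ᵀ * S.TG π = 1 := by
  have h1 : star ((S.avgL_isHermitian π).eigenvectorUnitary : Matrix (Fin N) (Fin N) ℝ) *
      ((S.avgL_isHermitian π).eigenvectorUnitary : Matrix (Fin N) (Fin N) ℝ) = 1 :=
    Unitary.coe_star_mul_self _
  rw [TG, Matrix.transpose_submatrix, ← Matrix.submatrix_mul _ _ _ id _ Function.bijective_id]
  rw [Matrix.star_eq_conjTranspose, Matrix.conjTranspose_eq_transpose_of_trivial] at h1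
  rw [h1, Matrix.submatrix_one_equiv]

theorem TG_inv (π : Fin h → ℝ) : (S.TG π)⁻¹ = (S.TG π)ᵀ :=
  Matrix.inv_eq_left_inv (S.TG_transpose_mul_self π)

theorem TG_mul_transpose (π : Fin h → ℝ) : S.TG π * (S.TG π)ᵀ = 1 :=
  mul_eq_one_comm.1 (S.TG_transpose_mul_self π)

theorem TG_transpose_dotProduct (π : Fin h → ℝ) (x y : Fin N → ℝ) :
    ((S.TG π)ᵀ *ᵥ x) ⬝ᵥ ((S.TG π)ᵀ *ᵥ y) = x ⬝ᵥ y := by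
  rw [Matrix.dotProduct_mulVec, ← Matrix.mulVec_transpose, Matrix.transpose_transpose,
    Matrix.mulVec_mulVec, TG_mul_transpose, Matrix.one_mulVec]

theorem avgL_mulVec_TG_col (π : Fin h → ℝ) (k : Fin N) :
    S.avgL π *ᵥ (S.TG π).col k = S.eig π k • (S.TG π).col k := by
  have h1 := (S.avgL_isHermitian π).mulVec_eigenvectorBasis (S.order π k)
  exact h1

theorem TG_col_dotProduct (π : Fin h → ℝ) (k l : Fin N) :
    (S.TG π).col k ⬝ᵥ (S.TG π).col l = if k = l then 1 else 0 := by
  have := congrFun (congrFun (S.TG_transpose_mul_self π) k) l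
  rwa [Matrix.one_apply] at this

theorem eig_mono (π : Fin h → ℝ) : Monotone (S.eig π) :=
  Tuple.monotone_sort (S.avgL_isHermitian π).eigenvalues

theorem eig_zero (hN : 2 ≤ N) (hπ : ∀ u, 0 ≤ π u) : S.eig π ⟨0, by omega⟩ = 0 := by
  have h0 : ∀ k, 0 ≤ (S.avgL_isHermitian π).eigenvalues k :=
    (S.avgL_posSemidef hπ).eigenvalues_nonneg
  have hdet : (S.avgL π).det = 0 := by
    refine Matrix.exists_mulVec_eq_zero_iff.1 ⟨1, fun h1 => ?_, ?_⟩
    · simpa using congrFun h1 ⟨0, by omega⟩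
    · simp [avgL_mulVec, L_mulVec_one]
  rw [(S.avgL_isHermitian π).det_eq_prod_eigenvalues, Finset.prod_eq_zero_iff] at hdet
  obtain ⟨k, -, hk⟩ := hdet
  refine le_antisymm ?_ (h0 _)
  have h1 := S.eig_mono π (a := ⟨0, by omega⟩) (b := (S.order π).symm k) (Nat.zero_le _)
  refine h1.trans_eq ?_
  simpa [eig] using hk

/-- Eigenvectors of the averaged Laplacian for the eigenvalue `0` are constant. -/
theorem TG_col_zero_const (hconn : S.union.Connected) (hπ : ∀ u, 0 < π u)
    {k : Fin N} (hk : S.eig π k = 0) (i j : Fin N) : (S.TG π).col k i = (S.TG π).col k j := by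
  refine S.eq_of_avgL_mulVec_eq_zero hconn hπ ?_ i j
  rw [avgL_mulVec_TG_col, hk, zero_smul]

/-- If `λ₂` vanished, two orthonormal eigenvectors would be constant. -/
theorem lam₂_pos (hN : 2 ≤ N) (hconn : S.union.Connected) (hπ : ∀ u, 0 < π u) :
    0 < S.lam₂ π hN := by
  have h0 : 0 ≤ S.lam₂ π hN := (S.avgL_posSemidef fun u => (hπ u).le).eigenvalues_nonneg _
  refine lt_of_le_of_ne h0 fun heq => ?_
  set z : Fin N := ⟨0, by omega⟩
  have hc0 : ∀ i j, (S.TG π).col z i = (S.TG π).col z j :=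
    S.TG_col_zero_const hconn hπ (S.eig_zero hN fun u => (hπ u).le)
  have hc1 := S.TG_col_zero_const hconn hπ heq.symm
  have hne : z ≠ ⟨1, hN⟩ := by simp [z]
  have h00 := S.TG_col_dotProduct π z z
  have h11 := S.TG_col_dotProduct π ⟨1, hN⟩ ⟨1, hN⟩
  have h01 := S.TG_col_dotProduct π z ⟨1, hN⟩
  simp only [dotProduct, if_true, if_neg hne] at h00 h11 h01
  simp only [hc0 _ z, hc1 _ z, Finset.sum_const, Finset.card_univ, Fintype.card_fin,
    nsmul_eq_mul] at h00 h11 h01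
  have : (N : ℝ) * ((S.TG π).col z z * (S.TG π).col z z) *
      ((N : ℝ) * ((S.TG π).col ⟨1, hN⟩ z * (S.TG π).col ⟨1, hN⟩ z)) = 0 := by
    linear_combination (N : ℝ) * ((S.TG π).col z z * (S.TG π).col ⟨1, hN⟩ z) * h01
  rw [h00, h11] at this
  norm_num at this

/-- The spectral gap of the averaged Laplacian. -/
theorem lam₂_mul_le (hN : 2 ≤ N) (hconn : S.union.Connected) (hπ : ∀ u, 0 < π u) (y : Fin N → ℝ) :
    S.lam₂ π hN * ((S.J *ᵥ y) ⬝ᵥ (S.J *ᵥ y)) ≤ ∑ u, π u * (y ⬝ᵥ S.L u *ᵥ y) := by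
  set w := S.J *ᵥ y with hw
  set c := (S.TG π)ᵀ *ᵥ w with hc
  have hwc : w = S.TG π *ᵥ c := by
    rw [hc, Matrix.mulVec_mulVec, TG_mul_transpose, Matrix.one_mulVec]
  have hLT : S.avgL π * S.TG π = S.TG π * Matrix.diagonal (S.eig π) := by
    ext i k
    rw [Matrix.mul_diagonal, mul_comm]
    exact congrFun (S.avgL_mulVec_TG_col π k) i
  have h1 : ∑ u, π u * (y ⬝ᵥ S.L u *ᵥ y) = ∑ k, S.eig π k * c k ^ 2 := by
    calc ∑ u, π u * (y ⬝ᵥ S.L u *ᵥ y) = w ⬝ᵥ S.avgL π *ᵥ w := by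
          rw [avgL_mulVec, dotProduct_sum]
          refine Finset.sum_congr rfl fun u _ => ?_
          rw [dotProduct_smul, smul_eq_mul, S.dotProduct_L_mulVec_eq u y]
      _ = ((S.TG π)ᵀ *ᵥ w) ⬝ᵥ ((S.TG π)ᵀ *ᵥ (S.avgL π *ᵥ w)) :=
          (S.TG_transpose_dotProduct π _ _).symm
      _ = c ⬝ᵥ (Matrix.diagonal (S.eig π) *ᵥ c) := by
          rw [← hc]
          congr 1
          rw [hwc, Matrix.mulVec_mulVec, Matrix.mulVec_mulVec, mul_assoc, hLT, ← mul_assoc,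
            TG_transpose_mul_self, one_mul]
      _ = _ := by
          refine Finset.sum_congr rfl fun k _ => ?_
          rw [Matrix.mulVec_diagonal]
          ring
  have h2 : w ⬝ᵥ w = ∑ k, c k ^ 2 := by
    rw [← S.TG_transpose_dotProduct π]
    exact Finset.sum_congr rfl fun k _ => (sq _).symm
  have h3 : c ⟨0, by omega⟩ = 0 := by
    have hc0 := S.TG_col_zero_const hconn hπ (S.eig_zero hN fun u => (hπ u).le)
    change ∑ i, (S.TG π).col ⟨0, by omega⟩ i * w i = 0
    simp_rw [hc0 _ ⟨0, by omega⟩, ← Finset.mul_sum, hw, S.sum_J_mulVec hN, mul_zero]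
  rw [h1, h2, Finset.mul_sum]
  refine Finset.sum_le_sum fun k _ => ?_
  by_cases hk : k = ⟨0, by omega⟩
  · rw [hk, h3]
    simp
  · refine mul_le_mul_of_nonneg_right (S.eig_mono π ?_) (sq_nonneg _)
    rw [Fin.le_def]
    exact Nat.one_le_iff_ne_zero.2 fun h0 => hk (Fin.ext h0)

/-! ### Bounds by the constants of the theorem -/

section Bounds

open scoped Classical
open scoped Matrix.Norms.L2Operator

theorem norm_sq_le_lamG (π : Fin h → ℝ) (u : Fin h) :
    ‖(S.TG π)⁻¹ * S.J * S.W u‖ ^ 2 ≤ S.lamG π :=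
  le_ciSup (f := fun u => ‖(S.TG π)⁻¹ * S.J * S.W u‖ ^ 2) (Set.finite_range _).bddAbove u

theorem norm_sq_le_lamQW (u : Fin h) : ‖S.Q * S.W u‖ ^ 2 ≤ S.lamQW :=
  le_ciSup (f := fun u => ‖S.Q * S.W u‖ ^ 2) (Set.finite_range _).bddAbove u

theorem norm_sq_le_lamQL (π : Fin h → ℝ) (u : Fin h) :
    ‖S.Q * S.L u * S.TG π‖ ^ 2 ≤ S.lamQL π :=
  le_ciSup (f := fun u => ‖S.Q * S.L u * S.TG π‖ ^ 2) (Set.finite_range _).bddAbove u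

theorem lamQL_nonneg (π : Fin h → ℝ) : 0 ≤ S.lamQL π :=
  Real.iSup_nonneg fun _ => sq_nonneg _

theorem alpha_nonneg (π : Fin h → ℝ) {hN : 2 ≤ N} (hl : 0 ≤ S.lam₂ π hN) (hG : 0 ≤ S.lamG π) :
    0 ≤ S.alpha π hN :=
  add_nonneg (mul_nonneg zero_le_two (Real.sqrt_nonneg _))
    (div_nonneg (mul_nonneg (S.lamQL_nonneg π) hl) hG)

theorem lamG_pos (hN : 2 ≤ N) (hconn : S.union.Connected) (π : Fin h → ℝ) : 0 < S.lamG π := by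
  have : Nontrivial (Fin N) := Fin.nontrivial_iff_two_le.2 hN
  obtain ⟨j, hj⟩ := hconn.preconnected.exists_adj_of_nontrivial (⟨0, by omega⟩ : Fin N)
  obtain ⟨u, hu⟩ := S.exists_adj_of_adj_union hj
  refine lt_of_lt_of_le ?_ (S.norm_sq_le_lamG π u)
  refine pow_pos (norm_pos_iff.2 fun h0 => ?_) 2
  have h1 : S.J * S.W u = 0 := by
    have := congrArg (S.TG π * ·) h0
    simpa only [← mul_assoc, TG_inv, TG_mul_transpose, one_mul, mul_zero, ← Matrix.mul_assoc,
      Matrix.mul_zero, Matrix.one_mul] using this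
  set i : Fin N := ⟨0, by omega⟩
  have h2 := congrFun (congrFun h1 i) ⟨(i, j), hj⟩
  have h3 : (S.W u).col ⟨(i, j), hj⟩ = Pi.single i 1 := by
    ext k
    simp [W, Pi.single_apply, hu]
  have h4 : (S.J * S.W u) i ⟨(i, j), hj⟩ = (S.J *ᵥ (S.W u).col ⟨(i, j), hj⟩) i := rfl
  rw [h4, h3, J_mulVec_apply] at h2
  have hN' : (2 : ℝ) ≤ N := by exact_mod_cast hN
  have h5 : 1 / (N : ℝ) ≤ 1 / 2 := one_div_le_one_div_of_le (by norm_num) hN'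
  simp only [Pi.single_eq_same, Finset.sum_pi_single', Finset.mem_univ, if_true, mul_one,
    Matrix.zero_apply] at h2
  linarith

/-- The disagreement `‖J y‖²` of the compressed states `y`. -/
noncomputable def disagreement (y : Fin N → ℝ) : ℝ := (S.J *ᵥ y) ⬝ᵥ (S.J *ᵥ y)

theorem disagreement_nonneg (y : Fin N → ℝ) : 0 ≤ S.disagreement y := by
  unfold disagreement
  exact Finset.sum_nonneg fun _ _ => mul_self_nonneg _

/-- The total squared estimation error. -/
noncomputable def sqErr (η : S.Edge → ℝ) : ℝ := η ⬝ᵥ η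

theorem sqErr_nonneg (η : S.Edge → ℝ) : 0 ≤ S.sqErr η :=
  Finset.sum_nonneg fun _ _ => mul_self_nonneg _

/-- The influence of the estimation errors on the disagreement. -/
theorem two_mul_J_dotProduct_W_le (u : Fin h) {l₂ : ℝ} (hl₂ : 0 < l₂)
    (hG : 0 < S.lamG π) (y : Fin N → ℝ) (η : S.Edge → ℝ) :
    2 * ((S.J *ᵥ y) ⬝ᵥ S.J *ᵥ (S.W u *ᵥ η)) ≤
      l₂ * S.disagreement y + S.lamG π / l₂ * S.sqErr η := by
  have h1 := two_mul_dotProduct_mulVec_le ((S.TG π)⁻¹ * S.J * S.W u) ((S.TG π)⁻¹ *ᵥ (S.J *ᵥ y)) η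
    (S.norm_sq_le_lamG π u) (div_pos hG hl₂)
  rw [← Matrix.mulVec_mulVec, ← Matrix.mulVec_mulVec, TG_inv, TG_transpose_dotProduct,
    TG_transpose_dotProduct, div_div_cancel₀ hG.ne'] at h1
  exact h1

/-- The influence of the estimation errors on themselves, through the motion of the estimated
states. -/
theorem neg_two_mul_dotProduct_QW_le (u : Fin h) (η : S.Edge → ℝ) :
    -2 * (η ⬝ᵥ S.Q *ᵥ (S.W u *ᵥ η)) ≤ 2 * √S.lamQW * S.sqErr η := by
  rw [Matrix.mulVec_mulVec]
  exact neg_two_mul_dotProduct_mulVec_le _ η (S.norm_sq_le_lamQW u)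

/-- The influence of the disagreement on the estimation errors. The weight is chosen such that
both off-diagonal coefficients, here and in `two_mul_J_dotProduct_W_le`, are `λ_G / λ₂`. -/
theorem two_mul_dotProduct_QL_le (u : Fin h) {l₂ : ℝ} (hl₂ : 0 < l₂)
    (hG : 0 < S.lamG π) (y : Fin N → ℝ) (η : S.Edge → ℝ) :
    2 * (η ⬝ᵥ S.Q *ᵥ (S.L u *ᵥ y)) ≤
      S.lamQL π * l₂ / S.lamG π * S.sqErr η + S.lamG π / l₂ * S.disagreement y := by
  have h1 := two_mul_dotProduct_mulVec_le (S.Q * S.L u * S.TG π) η ((S.TG π)ᵀ *ᵥ (S.J *ᵥ y))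
    (S.norm_sq_le_lamQL π u) (div_pos hG hl₂)
  rw [TG_transpose_dotProduct, ← Matrix.mulVec_mulVec, Matrix.mulVec_mulVec _ (S.TG π) (S.TG π)ᵀ,
    TG_mul_transpose, Matrix.one_mulVec, ← Matrix.mulVec_mulVec, L_mulVec_J_mulVec, div_div_eq_mul_div] at h1
  exact h1

end Bounds
end Setup

namespace Setup

variable {N r h : ℕ} (S : Setup N r h)

/-! ### The noise distribution -/

theorem F_nonneg (x : ℝ) : 0 ≤ S.F x := cdf_nonneg _ _

theorem F_le_one (x : ℝ) : S.F x ≤ 1 := cdf_le_one _ _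

theorem f_antitone_abs {x y : ℝ} (hxy : |x| ≤ |y|) : S.f y ≤ S.f x := by
  have := sq_le_sq.2 hxy
  simp only [f, gaussianPDFReal, sub_zero]
  gcongr

/-- On `[-B, B]` the density is at least `f B`. -/
theorem mul_sub_le_F_sub (hδ : 0 < S.δ) {x y B : ℝ} (hx : |x| ≤ B) (hy : |y| ≤ B) (hxy : x ≤ y) :
    S.f B * (y - x) ≤ S.F y - S.F x := by
  have hv : S.δ ^ 2 ≠ 0 := (pow_pos hδ 2).ne'
  have h1 : S.F y - S.F x = (gaussianReal 0 (S.δ ^ 2)).real (Set.Ioc x y) := by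
    rw [F, F, cdf_eq_real, cdf_eq_real, ← measureReal_sdiff (Set.Iic_subset_Iic.2 hxy)
      measurableSet_Iic, Set.Iic_sdiff_Iic]
  have h2 : (gaussianReal 0 (S.δ ^ 2)).real (Set.Ioc x y) = ∫ z in Set.Ioc x y, S.f z := by
    rw [measureReal_def, gaussianReal_apply_eq_integral _ hv, ENNReal.toReal_ofReal]
    · rfl
    · exact integral_nonneg fun z => gaussianPDFReal_nonneg _ _ _
  rw [h1, h2]
  have h3 : ∫ _ in Set.Ioc x y, S.f B = S.f B * (y - x) := by
    rw [setIntegral_const, Real.volume_real_Ioc_of_le hxy, smul_eq_mul, mul_comm]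
  rw [← h3]
  refine setIntegral_mono_on (by simp) (integrable_gaussianPDFReal _ _).integrableOn
    measurableSet_Ioc fun z hz => S.f_antitone_abs ?_
  refine le_trans ?_ (le_abs_self B)
  rw [abs_le] at *
  constructor <;> linarith [hz.1, hz.2, hx.1, hy.2]

theorem fM_le (i j : Fin N) : S.fM ≤ S.f (|S.c i j| + S.M) :=
  ciInf_le (f := fun p : Fin N × Fin N => S.f (|S.c p.1 p.2| + S.M))
    (Set.finite_range _).bddBelow (i, j)

theorem fM_pos (hN : 2 ≤ N) (hδ : 0 < S.δ) : 0 < S.fM := by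
  have : Nonempty (Fin N) := ⟨⟨0, by omega⟩⟩
  obtain ⟨p, hp⟩ := exists_eq_ciInf_of_finite (f := fun p : Fin N × Fin N =>
    S.f (|S.c p.1 p.2| + S.M))
  rw [fM, ← hp]
  exact gaussianPDFReal_pos _ _ _ (pow_pos hδ 2).ne'

/-- The averaged correction of an estimate `ζ` of `y` is a contraction with factor `f_M`. -/
theorem sub_mul_F_sub_le (hδ : 0 < S.δ) (i j : Fin N) {ζ y : ℝ} (hζ : |ζ| ≤ S.M) (hy : |y| ≤ S.M) :
    (ζ - y) * (S.F (S.c i j - ζ) - S.F (S.c i j - y)) ≤ -S.fM * (ζ - y) ^ 2 := by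
  have hB : ∀ {x : ℝ}, |x| ≤ S.M → |S.c i j - x| ≤ |S.c i j| + S.M := fun {x} hx =>
    (abs_sub _ _).trans (by linarith)
  have hf := S.fM_le i j
  rcases le_total y ζ with hle | hle
  · have h1 := S.mul_sub_le_F_sub hδ (hB hζ) (hB hy) (by linarith)
    have h2 : S.fM * (ζ - y) ≤ S.F (S.c i j - y) - S.F (S.c i j - ζ) := by
      refine le_trans ?_ h1
      nlinarith
    nlinarith
  · have h1 := S.mul_sub_le_F_sub hδ (hB hy) (hB hζ) (by linarith)
    have h2 : S.fM * (y - ζ) ≤ S.F (S.c i j - ζ) - S.F (S.c i j - y) := by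
      refine le_trans ?_ h1
      nlinarith
    nlinarith

/-! ### The projection -/

theorem abs_proj_le (hM : 0 ≤ S.M) (x : ℝ) : |S.proj x| ≤ S.M := by
  rw [abs_le]
  exact ⟨le_max_left _ _, max_le (by linarith) (min_le_left _ _)⟩

theorem proj_of_abs_le {x : ℝ} (hx : |x| ≤ S.M) : S.proj x = x := by
  rw [abs_le] at hx
  rw [proj, min_eq_right hx.2, max_eq_right hx.1]

theorem abs_proj_sub_proj_le (x y : ℝ) : |S.proj x - S.proj y| ≤ |x - y| := by
  refine (abs_max_sub_max_le_max _ _ _ _).trans ?_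
  rw [sub_self, abs_zero]
  refine max_le (abs_nonneg _) ((abs_min_sub_min_le_max _ _ _ _).trans ?_)
  rw [sub_self, abs_zero]
  exact max_le (abs_nonneg _) le_rfl

/-! ### One step of the compressed dynamics -/

open scoped Classical

/-- The estimation errors on the edges, for the compressed states `y` and the estimates `ζ`. -/
def err (y : Fin N → ℝ) (ζ : Fin N → Fin N → ℝ) (e : S.Edge) : ℝ := ζ e.1.1 e.1.2 - y e.1.2

/-- The consensus feedback on the compressed states. -/
noncomputable def drift (u : Fin h) (y : Fin N → ℝ) (ζ : Fin N → Fin N → ℝ) (i : Fin N) : ℝ :=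
  ∑ j, if (S.G u).Adj i j then ζ i j - y i else 0

/-- The squared estimation error on the edges of the active topology. -/
noncomputable def activeErr (u : Fin h) (η : S.Edge → ℝ) : ℝ :=
  ∑ e : S.Edge, if (S.G u).Adj e.1.1 e.1.2 then η e ^ 2 else 0

/-- The effect on the squared estimation error of the fluctuation of the signals `s`; it has mean
zero. -/
noncomputable def fluct (u : Fin h) (y : Fin N → ℝ) (ζ s : Fin N → Fin N → ℝ) : ℝ :=
  ∑ e : S.Edge, if (S.G u).Adj e.1.1 e.1.2 then
    S.err y ζ e * (S.F (S.c e.1.1 e.1.2 - y e.1.2) - s e.1.1 e.1.2) else 0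

/-- The feedback is the Laplacian flow, disturbed by the estimation errors. -/
theorem drift_eq (u : Fin h) (y : Fin N → ℝ) (ζ : Fin N → Fin N → ℝ) :
    S.drift u y ζ = S.W u *ᵥ S.err y ζ - S.L u *ᵥ y := by
  ext i
  have h1 : (S.W u *ᵥ S.err y ζ) i = ∑ j, if (S.G u).Adj i j then ζ i j - y j else 0 := by
    set φ : Fin N × Fin N → ℝ :=
      fun p => if i = p.1 ∧ (S.G u).Adj p.1 p.2 then ζ p.1 p.2 - y p.2 else 0 with hφ
    have h2 : (S.W u *ᵥ S.err y ζ) i = ∑ e : S.Edge, φ e.1 := by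
      simp [hφ, W, err, Matrix.mulVec, dotProduct]
    rw [h2, ← Finset.sum_subtype (f := φ) (p := fun p => S.union.Adj p.1 p.2)
      (Finset.univ.filter fun p : Fin N × Fin N => S.union.Adj p.1 p.2)
      (fun p => by rw [Finset.mem_filter]; simp),
      Finset.sum_filter_of_ne, Fintype.sum_prod_type, Finset.sum_eq_single i]
    · simp [hφ]
    · intro k _ hk
      simp [hφ, hk.symm]
    · simp
    · intro p _ hp
      simp only [hφ, ne_eq, ite_eq_right_iff, not_forall] at hp
      exact S.adj_union_of_adj hp.1.2
  have h3 : (S.L u *ᵥ y) i = ∑ j, if (S.G u).Adj i j then y i - y j else 0 := by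
    rw [L, SimpleGraph.lapMatrix_mulVec_apply, ← Finset.sum_filter, Finset.sum_sub_distrib,
      Finset.sum_const, ← SimpleGraph.neighborFinset_eq_filter, nsmul_eq_mul,
      SimpleGraph.card_neighborFinset_eq_degree]
  rw [Pi.sub_apply, h1, h3, drift, ← Finset.sum_sub_distrib]
  refine Finset.sum_congr rfl fun j _ => ?_
  split_ifs <;> ring

theorem Q_mulVec_apply (v : Fin N → ℝ) (e : S.Edge) : (S.Q *ᵥ v) e = v e.1.2 := by
  simp [Q, Matrix.mulVec, dotProduct]

/-- The averaging in `J` may be dropped, because the rows and columns of a Laplacian sum to zero. -/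
theorem J_dotProduct_J_L (u : Fin h) (y : Fin N → ℝ) :
    (S.J *ᵥ y) ⬝ᵥ S.J *ᵥ (S.L u *ᵥ y) = y ⬝ᵥ S.L u *ᵥ y := by
  have hsymm : (S.L u)ᵀ = S.L u := SimpleGraph.isSymm_lapMatrix (R := ℝ) (S.G u)
  have h1 : (1 : Fin N → ℝ) ⬝ᵥ S.L u *ᵥ y = 0 := by
    rw [Matrix.dotProduct_mulVec, ← Matrix.mulVec_transpose, hsymm, L_mulVec_one, zero_dotProduct]
  have h2 : ∑ i, (S.L u *ᵥ y) i = 0 := by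
    rw [← h1]
    simp [dotProduct]
  rw [S.J_mulVec_eq_sub_smul (S.L u *ᵥ y), h2, mul_zero, zero_smul, sub_zero,
    S.J_mulVec_eq_sub_smul y, sub_dotProduct, smul_dotProduct, h1, smul_zero, sub_zero]

theorem abs_drift_le (hM : 0 ≤ S.M) (u : Fin h) {y : Fin N → ℝ} {ζ : Fin N → Fin N → ℝ}
    (hy : ∀ i, |y i| ≤ S.M) (hζ : ∀ i j, S.union.Adj i j → |ζ i j| ≤ S.M) (i : Fin N) :
    |S.drift u y ζ i| ≤ N * (2 * S.M) := by
  refine (Finset.abs_sum_le_sum_abs _ _).trans ?_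
  refine (Finset.sum_le_card_nsmul _ _ (2 * S.M) fun j _ => ?_).trans_eq (by simp)
  split_ifs with hij
  · exact (abs_sub _ _).trans (by linarith [hζ i j (S.adj_union_of_adj hij), hy i])
  · simpa using hM

theorem abs_drift_sub_le (u : Fin h) {y : Fin N → ℝ} {ζ ζ' : Fin N → Fin N → ℝ} {ε : ℝ}
    (hε : 0 ≤ ε) (hζ : ∀ i j, S.union.Adj i j → |ζ' i j - ζ i j| ≤ ε) (i : Fin N) :
    |S.drift u y ζ' i - S.drift u y ζ i| ≤ N * ε := by
  rw [drift, drift, ← Finset.sum_sub_distrib]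
  refine (Finset.abs_sum_le_sum_abs _ _).trans ?_
  refine (Finset.sum_le_card_nsmul _ _ ε fun j _ => ?_).trans_eq (by simp)
  split_ifs with hij
  · rw [sub_sub_sub_cancel_right]
    exact hζ i j (S.adj_union_of_adj hij)
  · simpa using hε

theorem abs_J_mulVec_le (hN : 2 ≤ N) {y : Fin N → ℝ} {B : ℝ} (hy : ∀ i, |y i| ≤ B) (i : Fin N) :
    |(S.J *ᵥ y) i| ≤ 2 * B := by
  have hN' : (0 : ℝ) < N := by positivity
  rw [J_mulVec_apply]
  have h1 : |1 / (N : ℝ) * ∑ j, y j| ≤ B := by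
    rw [abs_mul, abs_of_pos (by positivity), one_div, inv_mul_le_iff₀ hN']
    refine (Finset.abs_sum_le_sum_abs _ _).trans ?_
    exact (Finset.sum_le_card_nsmul _ _ B fun j _ => hy j).trans_eq (by simp)
  exact (abs_sub _ _).trans (by linarith [hy i])

/-- The compressed states remain bounded, because the step is a convex combination. -/
theorem abs_step_le (u : Fin h) {t : ℕ} {y : Fin N → ℝ} {ζ : Fin N → Fin N → ℝ}
    (hγ : 0 ≤ S.γ) (i : Fin N) (ht : S.γ * S.deg i ≤ t + 1)
    (hy : |y i| ≤ S.M) (hζ : ∀ j, S.union.Adj i j → |ζ i j| ≤ S.M) :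
    |y i + S.γ / (t + 1) * S.drift u y ζ i| ≤ S.M := by
  set a := S.γ / ((t : ℝ) + 1) with ha
  have ht0 : (0 : ℝ) < t + 1 := by positivity
  have ha0 : 0 ≤ a := by positivity
  set D : ℝ := (((Finset.univ.filter fun j => (S.G u).Adj i j).card : ℕ) : ℝ) with hD
  have hdeg : D ≤ S.deg i := by
    rw [hD, deg, ← SimpleGraph.card_neighborFinset_eq_degree]
    exact_mod_cast Finset.card_le_card fun j hj => by
      simpa using S.adj_union_of_adj (by simpa using hj)
  have haD : a * D ≤ 1 := by
    rw [ha, div_mul_eq_mul_div, div_le_one ht0]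
    exact (mul_le_mul_of_nonneg_left hdeg hγ).trans ht
  have h1 : y i + a * S.drift u y ζ i =
      (1 - a * D) * y i + a * ∑ j ∈ Finset.univ.filter (fun j => (S.G u).Adj i j), ζ i j := by
    rw [drift, ← Finset.sum_filter, Finset.sum_sub_distrib, Finset.sum_const, nsmul_eq_mul, ← hD]
    ring
  rw [h1]
  have h2 : |∑ j ∈ Finset.univ.filter (fun j => (S.G u).Adj i j), ζ i j| ≤ D * S.M := by
    refine (Finset.abs_sum_le_sum_abs _ _).trans ?_
    refine (Finset.sum_le_card_nsmul _ _ S.M fun j hj => hζ j ?_).trans_eq (by simp [hD])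
    exact S.adj_union_of_adj (by simpa using hj)
  calc _ ≤ (1 - a * D) * |y i| + a * |∑ j ∈ Finset.univ.filter (fun j => (S.G u).Adj i j), ζ i j| := by
        refine (abs_add_le _ _).trans_eq ?_
        rw [abs_mul, abs_mul, abs_of_nonneg (sub_nonneg.2 haD), abs_of_nonneg ha0]
    _ ≤ (1 - a * D) * S.M + a * (D * S.M) := by
        have := sub_nonneg.2 haD
        gcongr
    _ = S.M := by ring

end Setup

namespace Setup

variable {N r h : ℕ} (S : Setup N r h) {π : Fin h → ℝ}

open scoped Classical

/-- One step of the algorithm at time `t` in the compressed variables: `y` are the compressed states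
at time `t`, `ζ` the estimates at time `t - 1`, `s` the signals, and `y'`, `ζ'` the compressed
states and the estimates one step later. The bounds by `M` are part of the structure. -/
structure Step (u : Fin h) (t : ℕ) (y y' : Fin N → ℝ) (ζ ζ' s : Fin N → Fin N → ℝ) : Prop where
  pos : 1 ≤ t
  abs_state_le : ∀ i, |y i| ≤ S.M
  abs_est_le : ∀ i j, S.union.Adj i j → |ζ i j| ≤ S.M
  signal_mem : ∀ i j, s i j ∈ Set.Icc (0 : ℝ) 1
  est : ∀ i j, ζ' i j = S.proj (ζ i j + S.β / (t : ℝ) *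
    (if (S.G u).Adj i j then S.F (S.c i j - ζ i j) - s i j else 0))
  state : ∀ i, y' i = y i + S.γ / ((t : ℝ) + 1) * S.drift u y ζ' i

/-- A bound for all the increments in one step of the algorithm, in units of the step size. -/
def stepConst : ℝ := 2 * S.M + S.β + 2 * (S.γ * N * (2 * S.M + S.β))

/-- The correction of the estimate on the edge `e`, in units of the step size. -/
noncomputable def correction (u : Fin h) (ζ s : Fin N → Fin N → ℝ) (e : S.Edge) : ℝ :=
  S.β * (if (S.G u).Adj e.1.1 e.1.2 then
    S.F (S.c e.1.1 e.1.2 - ζ e.1.1 e.1.2) - s e.1.1 e.1.2 else 0)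

namespace Step

variable {S} {u : Fin h} {t : ℕ} {y y' : Fin N → ℝ} {ζ ζ' s : Fin N → Fin N → ℝ}

theorem M_nonneg (hN : 2 ≤ N) (H : S.Step u t y y' ζ ζ' s) : 0 ≤ S.M :=
  (abs_nonneg _).trans (H.abs_state_le ⟨0, by omega⟩)

theorem abs_correction_le (H : S.Step u t y y' ζ ζ' s) (hβ : 0 ≤ S.β) (e : S.Edge) :
    |S.correction u ζ s e| ≤ S.β := by
  rw [correction, abs_mul, abs_of_nonneg hβ]
  refine mul_le_of_le_one_right hβ ?_
  split_ifs with he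
  · have h1 := S.F_nonneg (S.c e.1.1 e.1.2 - ζ e.1.1 e.1.2)
    have h2 := S.F_le_one (S.c e.1.1 e.1.2 - ζ e.1.1 e.1.2)
    have h3 := H.signal_mem e.1.1 e.1.2
    rw [abs_le]
    constructor <;> linarith [h3.1, h3.2]
  · simp

theorem est_eq (H : S.Step u t y y' ζ ζ' s) (e : S.Edge) :
    ζ' e.1.1 e.1.2 = S.proj (ζ e.1.1 e.1.2 + 1 / t * S.correction u ζ s e) := by
  rw [H.est, correction]
  congr 2
  ring

theorem abs_est_sub_le (H : S.Step u t y y' ζ ζ' s) (hβ : 0 ≤ S.β) (e : S.Edge) :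
    |ζ' e.1.1 e.1.2 - ζ e.1.1 e.1.2| ≤ 1 / t * S.β := by
  rw [← S.proj_of_abs_le (H.abs_est_le _ _ e.2)]
  rw [H.est_eq]
  refine (S.abs_proj_sub_proj_le _ _).trans ?_
  rw [add_sub_cancel_left, abs_mul, abs_of_nonneg (by positivity)]
  exact mul_le_mul_of_nonneg_left (H.abs_correction_le hβ e) (by positivity)

theorem one_div_le_one (H : S.Step u t y y' ζ ζ' s) : 1 / (t : ℝ) ≤ 1 := by
  rw [div_le_one (by exact_mod_cast H.pos)]
  exact_mod_cast H.pos

theorem abs_state_sub_sub_le (H : S.Step u t y y' ζ ζ' s) (hN : 2 ≤ N) (hβ : 0 ≤ S.β)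
    (hγ : 0 ≤ S.γ) (i : Fin N) :
    |y' i - y i - 1 / t * (S.γ * S.drift u y ζ i)| ≤
      S.γ * N * (2 * S.M + S.β) * (1 / (t : ℝ)) ^ 2 := by
  have ht : (0 : ℝ) < t := by exact_mod_cast H.pos
  have h1 := S.abs_drift_le (H.M_nonneg hN) u H.abs_state_le H.abs_est_le i
  have h2 := S.abs_drift_sub_le u (y := y) (ζ := ζ) (ζ' := ζ') (ε := 1 / t * S.β) (by positivity)
    (fun i j hij => H.abs_est_sub_le hβ ⟨(i, j), hij⟩) i
  have h3 : y' i - y i - 1 / t * (S.γ * S.drift u y ζ i) =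
      S.γ * (1 / ((t : ℝ) + 1) * (S.drift u y ζ' i - S.drift u y ζ i) -
        1 / (t * ((t : ℝ) + 1)) * S.drift u y ζ i) := by
    rw [H.state]
    field_simp
    ring
  have h4 : 1 / ((t : ℝ) + 1) ≤ 1 / t := one_div_le_one_div_of_le ht (by linarith)
  have h5 : 1 / ((t : ℝ) * (t + 1)) ≤ (1 / t) ^ 2 := by
    rw [div_pow, one_pow]
    exact one_div_le_one_div_of_le (by positivity) (by nlinarith)
  rw [h3, abs_mul, abs_of_nonneg hγ]
  have h6 : |1 / ((t : ℝ) + 1) * (S.drift u y ζ' i - S.drift u y ζ i) -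
      1 / (t * ((t : ℝ) + 1)) * S.drift u y ζ i| ≤
      1 / t * (N * (1 / t * S.β)) + (1 / (t : ℝ)) ^ 2 * (N * (2 * S.M)) := by
    refine (abs_sub _ _).trans ?_
    rw [abs_mul, abs_mul, abs_of_nonneg (by positivity : 0 ≤ 1 / ((t : ℝ) + 1)),
      abs_of_nonneg (by positivity : 0 ≤ 1 / ((t : ℝ) * (t + 1)))]
    gcongr
  refine (mul_le_mul_of_nonneg_left h6 hγ).trans_eq ?_
  ring

theorem abs_state_sub_le (H : S.Step u t y y' ζ ζ' s) (hN : 2 ≤ N) (hβ : 0 ≤ S.β)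
    (hγ : 0 ≤ S.γ) (i : Fin N) : |y' i - y i| ≤ S.stepConst * (1 / t) := by
  have hM := H.M_nonneg hN
  have h1 := H.abs_state_sub_sub_le hN hβ hγ i
  have h2 := S.abs_drift_le hM u H.abs_state_le H.abs_est_le i
  have ht : (0 : ℝ) ≤ 1 / t := by positivity
  have h3 : |1 / t * (S.γ * S.drift u y ζ i)| ≤ 1 / t * (S.γ * (N * (2 * S.M))) := by
    rw [abs_mul, abs_mul, abs_of_nonneg ht, abs_of_nonneg hγ]
    gcongr
  have h4 : S.γ * N * (2 * S.M + S.β) * (1 / (t : ℝ)) ^ 2 ≤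
      S.γ * N * (2 * S.M + S.β) * (1 / (t : ℝ)) := by
    refine mul_le_mul_of_nonneg_left ?_ (by positivity)
    rw [sq]
    exact mul_le_of_le_one_left ht H.one_div_le_one
  calc |y' i - y i| = |(y' i - y i - 1 / t * (S.γ * S.drift u y ζ i)) +
        1 / t * (S.γ * S.drift u y ζ i)| := by rw [sub_add_cancel]
    _ ≤ S.γ * N * (2 * S.M + S.β) * (1 / (t : ℝ)) + 1 / t * (S.γ * (N * (2 * S.M))) :=
        (abs_add_le _ _).trans (add_le_add (h1.trans h4) h3)
    _ ≤ _ := by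
      rw [stepConst]
      have : 0 ≤ 1 / (t : ℝ) * (2 * S.M + S.β + S.γ * N * S.β) := by positivity
      linarith

/-- The step of the disagreement to first order in the step size. -/
theorem disagreement_le_of_drift (H : S.Step u t y y' ζ ζ' s) (hN : 2 ≤ N) (hβ : 0 ≤ S.β)
    (hγ : 0 ≤ S.γ) :
    S.disagreement y' ≤ S.disagreement y +
      1 / t * (S.γ * (2 * ((S.J *ᵥ y) ⬝ᵥ S.J *ᵥ S.drift u y ζ))) +
      N * (6 * S.stepConst ^ 2) * (1 / (t : ℝ)) ^ 2 := by
  have hM := H.M_nonneg hN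
  have hK : 0 ≤ S.γ * N * (2 * S.M + S.β) := by positivity
  have h1 : ∀ i, (S.J *ᵥ y') i ^ 2 ≤ (S.J *ᵥ y) i ^ 2 +
      2 * (1 / t) * ((S.J *ᵥ y) i * (S.J *ᵥ (S.γ • S.drift u y ζ)) i) +
      6 * S.stepConst ^ 2 * (1 / (t : ℝ)) ^ 2 := fun i => by
    refine sq_le_of_abs_sub_le (by positivity) H.one_div_le_one ?_ ?_ ?_
    · refine (S.abs_J_mulVec_le hN H.abs_state_le i).trans ?_
      rw [stepConst]
      linarith
    · refine (S.abs_J_mulVec_le hN (B := S.γ * (N * (2 * S.M))) (fun j => ?_) i).trans ?_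
      · rw [Pi.smul_apply, smul_eq_mul, abs_mul, abs_of_nonneg hγ]
        exact mul_le_mul_of_nonneg_left
          (S.abs_drift_le hM u H.abs_state_le H.abs_est_le j) hγ
      · rw [stepConst]
        have : 0 ≤ S.γ * N * S.β := by positivity
        linarith
    · have h2 : (S.J *ᵥ y') i - (S.J *ᵥ y) i - 1 / t * (S.J *ᵥ (S.γ • S.drift u y ζ)) i =
          (S.J *ᵥ (y' - y - (1 / (t : ℝ)) • (S.γ • S.drift u y ζ))) i := by
        rw [Matrix.mulVec_sub, Matrix.mulVec_sub, Matrix.mulVec_smul _ (1 / (t : ℝ))]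
        rfl
      rw [h2]
      refine (S.abs_J_mulVec_le hN (H.abs_state_sub_sub_le hN hβ hγ) i).trans ?_
      rw [← mul_assoc]
      refine mul_le_mul_of_nonneg_right ?_ (sq_nonneg _)
      rw [stepConst]
      linarith
  have h2 := Finset.sum_le_sum fun i (_ : i ∈ Finset.univ) => h1 i
  rw [Finset.sum_add_distrib, Finset.sum_add_distrib, ← Finset.mul_sum] at h2
  simp only [disagreement, dotProduct, ← sq]
  refine h2.trans_eq ?_
  rw [Matrix.mulVec_smul]
  simp only [Pi.smul_apply, smul_eq_mul, mul_left_comm _ S.γ, ← Finset.mul_sum, Finset.sum_const,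
    Finset.card_univ, Fintype.card_fin, nsmul_eq_mul]
  ring

/-- The step of the squared estimation error to first order in the step size. The projection does no
harm, because the estimated values lie in `[-M, M]`. -/
theorem sqErr_le_of_drift (H : S.Step u t y y' ζ ζ' s) (hN : 2 ≤ N) (hβ : 0 ≤ S.β) (hγ : 0 ≤ S.γ) :
    S.sqErr (S.err y' ζ') ≤ S.sqErr (S.err y ζ) +
      1 / t * (2 * (S.err y ζ ⬝ᵥ S.correction u ζ s) -
        S.γ * (2 * (S.err y ζ ⬝ᵥ S.Q *ᵥ S.drift u y ζ))) +
      Fintype.card S.Edge * (11 * S.stepConst ^ 2) * (1 / (t : ℝ)) ^ 2 := by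
  have hM := H.M_nonneg hN
  have hK : 0 ≤ S.γ * N * (2 * S.M + S.β) := by positivity
  have hβK : S.β ≤ S.stepConst := by rw [stepConst]; linarith
  have h1 : ∀ e, S.err y' ζ' e ^ 2 ≤ S.err y ζ e ^ 2 +
      2 * (1 / t) * (S.err y ζ e * S.correction u ζ s e -
        S.err y ζ e * (S.γ * (S.Q *ᵥ S.drift u y ζ) e)) +
      11 * S.stepConst ^ 2 * (1 / (t : ℝ)) ^ 2 := fun e => by
    refine sq_le_of_tracking (w := ζ' e.1.1 e.1.2 - y e.1.2) (by positivity) H.one_div_le_one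
      ?_ ?_ ?_ ?_ ?_ ?_
    · refine (abs_sub _ _).trans ?_
      rw [stepConst]
      linarith [H.abs_est_le _ _ e.2, H.abs_state_le e.1.2]
    · exact (H.abs_correction_le hβ e).trans hβK
    · rw [Q_mulVec_apply, abs_mul, abs_of_nonneg hγ]
      refine (mul_le_mul_of_nonneg_left
        (S.abs_drift_le hM u H.abs_state_le H.abs_est_le _) hγ).trans ?_
      rw [stepConst]
      have : 0 ≤ S.γ * N * S.β := by positivity
      have : 0 ≤ S.γ * N * S.M := by positivity
      linarith
    · nth_rw 1 [← S.proj_of_abs_le (H.abs_state_le e.1.2)]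
      rw [H.est_eq]
      refine (S.abs_proj_sub_proj_le _ _).trans_eq ?_
      rw [err]
      congr 1
      ring
    · rw [err, sub_sub_sub_cancel_right]
      exact (H.abs_est_sub_le hβ e).trans (mul_le_mul_of_nonneg_left hβK (by positivity))
    · rw [Q_mulVec_apply, ← abs_neg, err]
      have := H.abs_state_sub_sub_le hN hβ hγ e.1.2
      refine le_trans (le_of_eq ?_) (this.trans (mul_le_mul_of_nonneg_right ?_ (sq_nonneg _)))
      · congr 1
        ring
      · rw [stepConst]
        linarith
  have h2 := Finset.sum_le_sum fun e (_ : e ∈ Finset.univ) => h1 e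
  rw [Finset.sum_add_distrib, Finset.sum_add_distrib, ← Finset.mul_sum,
    Finset.sum_sub_distrib] at h2
  simp only [sqErr, dotProduct, ← sq]
  refine h2.trans_eq ?_
  simp only [mul_left_comm _ S.γ, ← Finset.mul_sum, Finset.sum_const, Finset.card_univ,
    nsmul_eq_mul]
  ring

/-- The correction of the estimates contracts the active errors, up to the fluctuation of the
signals. -/
theorem err_dotProduct_correction_le (H : S.Step u t y y' ζ ζ' s) (hδ : 0 < S.δ) (hβ : 0 ≤ S.β) :
    S.err y ζ ⬝ᵥ S.correction u ζ s ≤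
      S.β * (-S.fM * S.activeErr u (S.err y ζ) + S.fluct u y ζ s) := by
  have h1 : S.err y ζ ⬝ᵥ S.correction u ζ s = S.β * ∑ e : S.Edge,
      if (S.G u).Adj e.1.1 e.1.2 then S.err y ζ e *
        (S.F (S.c e.1.1 e.1.2 - ζ e.1.1 e.1.2) - s e.1.1 e.1.2) else 0 := by
    rw [dotProduct, Finset.mul_sum]
    refine Finset.sum_congr rfl fun e _ => ?_
    rw [correction]
    split_ifs <;> ring
  rw [h1]
  refine mul_le_mul_of_nonneg_left ?_ hβ
  rw [activeErr, fluct, Finset.mul_sum, ← Finset.sum_add_distrib]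
  refine Finset.sum_le_sum fun e _ => ?_
  split_ifs
  · have := S.sub_mul_F_sub_le hδ e.1.1 e.1.2 (H.abs_est_le _ _ e.2) (H.abs_state_le e.1.2)
    rw [err]
    linarith
  · simp

/-- The drift of the disagreement. -/
theorem disagreement_le (H : S.Step u t y y' ζ ζ' s) (hN : 2 ≤ N) (hβ : 0 ≤ S.β)
    (hγ : 0 ≤ S.γ) {l₂ : ℝ} (hl₂ : 0 < l₂) (hG : 0 < S.lamG π) :
    S.disagreement y' ≤ S.disagreement y +
      1 / t * (S.γ * (l₂ * S.disagreement y + S.lamG π / l₂ * S.sqErr (S.err y ζ) -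
        2 * (y ⬝ᵥ S.L u *ᵥ y))) +
      N * (6 * S.stepConst ^ 2) * (1 / (t : ℝ)) ^ 2 := by
  refine (H.disagreement_le_of_drift hN hβ hγ).trans ?_
  have h1 := S.two_mul_J_dotProduct_W_le u hl₂ hG y (S.err y ζ)
  rw [drift_eq, Matrix.mulVec_sub, dotProduct_sub, J_dotProduct_J_L]
  gcongr
  linarith

/-- The drift of the squared estimation error. -/
theorem sqErr_le (H : S.Step u t y y' ζ ζ' s) (hN : 2 ≤ N) (hδ : 0 < S.δ) (hβ : 0 ≤ S.β)
    (hγ : 0 ≤ S.γ) {l₂ : ℝ} (hl₂ : 0 < l₂) (hG : 0 < S.lamG π) :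
    S.sqErr (S.err y' ζ') ≤ S.sqErr (S.err y ζ) +
      1 / t * (S.γ * ((2 * √S.lamQW + S.lamQL π * l₂ / S.lamG π) * S.sqErr (S.err y ζ) +
        S.lamG π / l₂ * S.disagreement y) -
        2 * S.β * S.fM * S.activeErr u (S.err y ζ) + 2 * S.β * S.fluct u y ζ s) +
      Fintype.card S.Edge * (11 * S.stepConst ^ 2) * (1 / (t : ℝ)) ^ 2 := by
  refine (H.sqErr_le_of_drift hN hβ hγ).trans ?_
  have h1 := S.neg_two_mul_dotProduct_QW_le u (S.err y ζ)
  have h2 := S.two_mul_dotProduct_QL_le u hl₂ hG y (S.err y ζ)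
  have h3 := H.err_dotProduct_correction_le hδ hβ
  rw [drift_eq, Matrix.mulVec_sub, dotProduct_sub]
  gcongr
  have h4 := mul_le_mul_of_nonneg_left (add_le_add h1 h2) hγ
  linarith

end Step
end Setup

/-- Averaging by a corrector: if the drift of `a` is `-κ a` up to the discrete derivative of a
bounded sequence `b`, then `a + b / t` satisfies a contractive recursion. -/
theorem exists_le_mul_rpow_of_corrector {a b b' : ℕ → ℝ} {κ s B C : ℝ} {T : ℕ} (hs : 0 ≤ s)
    (hs1 : s ≤ 1) (hsκ : s < κ) (hT : 1 ≤ T) (hC : 0 ≤ C)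
    (hb : ∀ t ≥ T, |b t| ≤ B) (hb' : ∀ t ≥ T, |b (t + 1) - b' t| ≤ C * (1 / t))
    (ha : ∀ t ≥ T, a (t + 1) ≤ a t + 1 / t * (-κ * a t + (b t - b' t)) + C * (1 / (t : ℝ)) ^ 2) :
    ∃ K, ∀ᶠ t : ℕ in atTop, a t ≤ K * (t : ℝ) ^ (-s) := by
  have hB : 0 ≤ B := (abs_nonneg _).trans (hb T le_rfl)
  have hκ : 0 ≤ κ := hs.trans hsκ.le
  obtain ⟨K, -, hK⟩ := exists_le_mul_rpow_of_contraction (A := fun t => a t + b t * (1 / t))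
    (C := 2 * C + B + κ * B) (T := T) hs hs1 hsκ (by positivity) (fun t ht => by
      have ht1 : (1 : ℝ) ≤ t := by exact_mod_cast hT.trans ht
      have ht0 : (0 : ℝ) < t := by linarith
      set τ : ℝ := 1 / t with hτ
      have hτ0 : 0 ≤ τ := by positivity
      have h1 : 1 / ((t + 1 : ℕ) : ℝ) ≤ τ := by
        push_cast
        exact one_div_le_one_div_of_le ht0 (by linarith)
      have h2 : τ - 1 / ((t + 1 : ℕ) : ℝ) ≤ τ ^ 2 := by
        push_cast
        rw [hτ, div_sub_div _ _ (by positivity) (by positivity), div_pow, one_pow,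
          div_le_div_iff₀ (by positivity) (by positivity)]
        nlinarith
      have h3 : (b (t + 1) - b' t) * τ ≤ C * τ ^ 2 := by
        have := mul_le_mul_of_nonneg_right ((le_abs_self _).trans (hb' t ht)) hτ0
        linarith
      have h4 : -(b (t + 1) * (τ - 1 / ((t + 1 : ℕ) : ℝ))) ≤ B * τ ^ 2 := by
        refine (neg_le_abs _).trans ?_
        rw [abs_mul, abs_of_nonneg (by linarith : 0 ≤ τ - 1 / ((t + 1 : ℕ) : ℝ))]
        exact mul_le_mul (hb _ (by omega)) h2 (by linarith) hB
      have h5 : κ * b t * τ ^ 2 ≤ κ * B * τ ^ 2 := by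
        gcongr
        exact (le_abs_self _).trans (hb t ht)
      have h6 : κ / t = κ * τ := by rw [hτ]; ring
      have h7 : (2 * C + B + κ * B) / (t : ℝ) ^ 2 = (2 * C + B + κ * B) * τ ^ 2 := by
        rw [hτ]; field_simp
      rw [h6, h7]
      have := ha t ht
      linarith)
  refine ⟨K + B, ?_⟩
  filter_upwards [hK, eventually_ge_atTop T] with t hKt htT
  have ht1 : (1 : ℝ) ≤ t := by exact_mod_cast hT.trans htT
  have h1 : 1 / (t : ℝ) ≤ (t : ℝ) ^ (-s) := by
    rw [one_div, ← Real.rpow_neg_one]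
    exact Real.rpow_le_rpow_of_exponent_le ht1 (by linarith)
  have h2 : -(b t * (1 / t)) ≤ B * (t : ℝ) ^ (-s) := by
    refine (neg_le_abs _).trans ?_
    rw [abs_mul, abs_of_nonneg (by positivity : 0 ≤ 1 / (t : ℝ))]
    exact mul_le_mul (hb t htT) h1 (by positivity) hB
  linarith

theorem piMin_le {h : ℕ} (π : Fin h → ℝ) (v : Fin h) : piMin π ≤ π v :=
  ciInf_le (Set.finite_range π).bddBelow v

theorem piMin_pos {h : ℕ} {π : Fin h → ℝ} [Nonempty (Fin h)] (hπ : ∀ v, 0 < π v) : 0 < piMin π := by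
  obtain ⟨v, hv⟩ := exists_eq_ciInf_of_finite (f := π)
  rw [piMin, ← hv]
  exact hπ v

namespace Setup

variable {N r h : ℕ} (S : Setup N r h) {π : Fin h → ℝ}

open scoped Classical

/-! ### The Lyapunov function -/

/-- The Lyapunov function, a weighted sum of the disagreement and of the estimation error. -/
noncomputable def lyap (p q : ℝ) (y : Fin N → ℝ) (ζ : Fin N → Fin N → ℝ) : ℝ :=
  p * S.disagreement y + q * S.sqErr (S.err y ζ)

/-- The part of the dissipation of the Lyapunov function that depends on the active topology. -/
noncomputable def dissip (p q : ℝ) (u : Fin h) (y : Fin N → ℝ) (ζ : Fin N → Fin N → ℝ) : ℝ :=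
  2 * p * S.γ * (y ⬝ᵥ S.L u *ᵥ y) + 2 * q * S.β * S.fM * S.activeErr u (S.err y ζ)

/-- A combination of the dissipations with weights `g`, evaluated at the topology `u`. For the
solution `g v` of the Poisson equation with right-hand side the indicator of `v`, it corrects the
difference between the active dissipation and its stationary average. -/
noncomputable def corrector (p q : ℝ) (g : Fin h → Fin h → ℝ) (u : Fin h) (y : Fin N → ℝ)
    (ζ : Fin N → Fin N → ℝ) : ℝ :=
  ∑ v, g v u * S.dissip p q v y ζ

/-- Every edge of the union graph is active in some topology, hence has stationary weight at least
`π_min`. -/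
theorem sqErr_mul_le_sum_activeErr (hπ : ∀ v, 0 ≤ π v) (η : S.Edge → ℝ) :
    piMin π * S.sqErr η ≤ ∑ v, π v * S.activeErr v η := by
  simp only [sqErr, dotProduct, activeErr, Finset.mul_sum]
  rw [Finset.sum_comm]
  refine Finset.sum_le_sum fun e _ => ?_
  obtain ⟨v, hv⟩ := S.exists_adj_of_adj_union e.2
  refine le_trans ?_ (Finset.single_le_sum (fun w _ => ?_) (Finset.mem_univ v))
  · rw [if_pos hv, ← sq]
    exact mul_le_mul_of_nonneg_right (piMin_le π v) (sq_nonneg _)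
  · refine mul_nonneg (hπ w) ?_
    split_ifs
    · exact sq_nonneg _
    · exact le_rfl

/-- One step of the Lyapunov function. The hypotheses on `p` and `q` say that, for the averaged
dissipation, the coefficients of the disagreement and of the estimation error decay at rate `κ`. The
remaining terms are the difference between the averaged and the active dissipation, and the
fluctuation of the signals. -/
theorem lyap_le_of_step {u : Fin h} {t : ℕ} {y y' : Fin N → ℝ} {ζ ζ' s : Fin N → Fin N → ℝ}
    (H : S.Step u t y y' ζ ζ' s) (hN : 2 ≤ N) (hconn : S.union.Connected) (hδ : 0 < S.δ)
    (hβ : 0 ≤ S.β) (hγ : 0 ≤ S.γ) (hπ : ∀ v, 0 < π v) {p q κ : ℝ} (hp : 0 ≤ p) (hq : 0 ≤ q)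
    (h1 : q * (S.γ * S.lamG π / S.lam₂ π hN) ≤ p * (S.γ * S.lam₂ π hN - κ))
    (h2 : p * (S.γ * S.lamG π / S.lam₂ π hN) ≤
      q * (2 * S.β * S.fM * piMin π - S.γ * S.alpha π hN - κ)) :
    S.lyap p q y' ζ' ≤ S.lyap p q y ζ +
      1 / t * (-κ * S.lyap p q y ζ + ((∑ v, π v * S.dissip p q v y ζ) - S.dissip p q u y ζ) +
        2 * q * S.β * S.fluct u y ζ s) +
      (p * (N * (6 * S.stepConst ^ 2)) + q * (Fintype.card S.Edge * (11 * S.stepConst ^ 2))) *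
        (1 / (t : ℝ)) ^ 2 := by
  have hl := S.lam₂_pos hN hconn hπ
  have hG := S.lamG_pos hN hconn π
  have hV := H.disagreement_le hN hβ hγ hl hG
  have hR := H.sqErr_le hN hδ hβ hγ hl hG
  have hgap := S.lam₂_mul_le hN hconn hπ y
  have hact := S.sqErr_mul_le_sum_activeErr (fun v => (hπ v).le) (S.err y ζ)
  have hfM := S.fM_pos hN hδ
  set V := S.disagreement y with hVdef
  set R := S.sqErr (S.err y ζ) with hRdef
  have hV0 : 0 ≤ V := S.disagreement_nonneg y
  have hR0 : 0 ≤ R := S.sqErr_nonneg _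
  have havg : 2 * p * S.γ * (S.lam₂ π hN * V) + 2 * q * S.β * S.fM * (piMin π * R) ≤
      ∑ v, π v * S.dissip p q v y ζ := by
    have : ∑ v, π v * S.dissip p q v y ζ = 2 * p * S.γ * ∑ v, π v * (y ⬝ᵥ S.L v *ᵥ y) +
        2 * q * S.β * S.fM * ∑ v, π v * S.activeErr v (S.err y ζ) := by
      rw [Finset.mul_sum, Finset.mul_sum, ← Finset.sum_add_distrib]
      refine Finset.sum_congr rfl fun v _ => ?_
      rw [dissip]
      ring
    rw [this]
    gcongr
    exact hgap
  have hmain : p * (S.γ * (S.lam₂ π hN * V + S.lamG π / S.lam₂ π hN * R)) +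
      q * (S.γ * (S.alpha π hN * R + S.lamG π / S.lam₂ π hN * V)) ≤
      -κ * S.lyap p q y ζ + ∑ v, π v * S.dissip p q v y ζ := by
    have e1 := mul_le_mul_of_nonneg_right h1 hV0
    have e2 := mul_le_mul_of_nonneg_right h2 hR0
    rw [mul_div_assoc] at e1 e2
    rw [lyap, ← hVdef, ← hRdef]
    linarith
  have hfinal : 1 / (t : ℝ) * (p * (S.γ * (S.lam₂ π hN * V + S.lamG π / S.lam₂ π hN * R)) +
      q * (S.γ * (S.alpha π hN * R + S.lamG π / S.lam₂ π hN * V))) ≤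
      1 / (t : ℝ) * (-κ * S.lyap p q y ζ + ∑ v, π v * S.dissip p q v y ζ) :=
    mul_le_mul_of_nonneg_left hmain (by positivity)
  have e1 := mul_le_mul_of_nonneg_left hV hp
  have e2 := mul_le_mul_of_nonneg_left hR hq
  rw [← alpha] at e2
  have e3 : S.lyap p q y ζ = p * V + q * R := rfl
  have e4 : S.lyap p q y' ζ' = p * S.disagreement y' + q * S.sqErr (S.err y' ζ') := rfl
  have e5 : S.dissip p q u y ζ = 2 * p * S.γ * (y ⬝ᵥ S.L u *ᵥ y) +
    2 * q * S.β * S.fM * S.activeErr u (S.err y ζ) := rfl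
  rw [e4]
  -- the remaining inequality is linear in these two quantities
  generalize S.lyap p q y ζ = U at *
  generalize ∑ v, π v * S.dissip p q v y ζ = D at *
  rw [e3] at hfinal
  rw [e5, e3]
  linarith

/-- By the Poisson equation, the averaged dissipation minus the active one is the expected increment
of the corrector under a jump of the topology. -/
theorem dissip_sub_eq_corrector {P : Matrix (Fin h) (Fin h) ℝ} {g : Fin h → Fin h → ℝ}
    (hg : ∀ v u, g v u - ∑ w, P u w * g v w = (if u = v then 1 else 0) - π v)
    (p q : ℝ) (u : Fin h) (y : Fin N → ℝ) (ζ : Fin N → Fin N → ℝ) :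
    (∑ v, π v * S.dissip p q v y ζ) - S.dissip p q u y ζ =
      (∑ w, P u w * S.corrector p q g w y ζ) - S.corrector p q g u y ζ := by
  have h1 : ∑ w, P u w * S.corrector p q g w y ζ =
      ∑ v, (∑ w, P u w * g v w) * S.dissip p q v y ζ := by
    simp only [corrector, Finset.mul_sum, Finset.sum_mul]
    rw [Finset.sum_comm]
    simp only [mul_assoc]
  have h2 : S.dissip p q u y ζ = ∑ v, (if u = v then 1 else 0) * S.dissip p q v y ζ := by simp
  rw [h1, h2, corrector, ← Finset.sum_sub_distrib, ← Finset.sum_sub_distrib]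
  refine Finset.sum_congr rfl fun v _ => ?_
  rw [← sub_mul, ← sub_mul]
  congr 1
  have := hg v u
  linarith

/-! ### Bounds and regularity of the Lyapunov function and of the corrector -/

theorem continuous_disagreement : Continuous S.disagreement := by
  unfold disagreement
  fun_prop

theorem continuous_sqErr : Continuous S.sqErr := by
  unfold sqErr
  fun_prop

theorem continuous_activeErr (u : Fin h) : Continuous (S.activeErr u) := by
  unfold activeErr
  refine continuous_finsetSum _ fun e _ => ?_
  split_ifs <;> fun_prop

theorem abs_dotProduct_L_le (u : Fin h) {x y : Fin N → ℝ} {a b : ℝ} (hb : 0 ≤ b)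
    (hx : ∀ i, |x i| ≤ a) (hy : ∀ i, |y i| ≤ b) : |x ⬝ᵥ S.L u *ᵥ y| ≤ N * (a * (N * (2 * b))) := by
  have hL : ∀ i, |(S.L u *ᵥ y) i| ≤ N * (2 * b) := fun i => by
    have h1 : (S.L u *ᵥ y) i = -S.drift u y (fun _ j => y j) i := by
      have h0 : S.err y (fun _ j => y j) = 0 := by
        ext e
        simp [err]
      rw [drift_eq, h0]
      simp
    rw [h1, abs_neg, drift]
    refine (Finset.abs_sum_le_sum_abs _ _).trans ?_
    refine (Finset.sum_le_card_nsmul _ _ (2 * b) fun j _ => ?_).trans_eq (by simp)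
    split_ifs with hij
    · exact (abs_sub _ _).trans (by linarith [hy i, hy j])
    · simpa using hb
  refine (Finset.abs_sum_le_sum_abs _ _).trans ?_
  refine (Finset.sum_le_card_nsmul _ _ (a * (N * (2 * b))) fun i _ => ?_).trans_eq (by simp)
  rw [abs_mul]
  exact mul_le_mul (hx i) (hL i) (abs_nonneg _) ((abs_nonneg _).trans (hx i))

theorem abs_activeErr_le (u : Fin h) {η : S.Edge → ℝ} {a : ℝ} (hη : ∀ e, |η e| ≤ a) :
    |S.activeErr u η| ≤ Fintype.card S.Edge * a ^ 2 := by
  refine (Finset.abs_sum_le_sum_abs _ _).trans ?_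
  refine (Finset.sum_le_card_nsmul _ _ (a ^ 2) fun e _ => ?_).trans_eq (by simp)
  split_ifs
  · rw [abs_pow]
    exact pow_le_pow_left₀ (abs_nonneg _) (hη e) 2
  · simpa using sq_nonneg a

theorem abs_activeErr_sub_le (u : Fin h) {η η' : S.Edge → ℝ} {a ε : ℝ} (ha : 0 ≤ a) (hε : 0 ≤ ε)
    (hη : ∀ e, |η e| ≤ a) (hη' : ∀ e, |η' e| ≤ a) (hηη' : ∀ e, |η' e - η e| ≤ ε) :
    |S.activeErr u η' - S.activeErr u η| ≤ Fintype.card S.Edge * (ε * (2 * a)) := by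
  rw [activeErr, activeErr, ← Finset.sum_sub_distrib]
  refine (Finset.abs_sum_le_sum_abs _ _).trans ?_
  refine (Finset.sum_le_card_nsmul _ _ (ε * (2 * a)) fun e _ => ?_).trans_eq (by simp)
  split_ifs
  · rw [sq_sub_sq, mul_comm, abs_mul]
    exact mul_le_mul (hηη' e) ((abs_add_le _ _).trans (by linarith [hη e, hη' e])) (abs_nonneg _) hε
  · simpa using by positivity

theorem abs_err_le {y : Fin N → ℝ} {ζ : Fin N → Fin N → ℝ} (hy : ∀ i, |y i| ≤ S.M)
    (hζ : ∀ i j, S.union.Adj i j → |ζ i j| ≤ S.M) (e : S.Edge) : |S.err y ζ e| ≤ 2 * S.M :=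
  (abs_sub _ _).trans (by linarith [hy e.1.2, hζ _ _ e.2])

/-- On the region where all quantities are bounded by `M`, the dissipation is bounded. -/
theorem exists_dissip_bound (hM : 0 ≤ S.M) (p q : ℝ) :
    ∃ C, 0 ≤ C ∧ ∀ v (y : Fin N → ℝ) (ζ : Fin N → Fin N → ℝ), (∀ i, |y i| ≤ S.M) →
      (∀ i j, S.union.Adj i j → |ζ i j| ≤ S.M) → |S.dissip p q v y ζ| ≤ C := by
  refine ⟨|2 * p * S.γ| * (N * (S.M * (N * (2 * S.M)))) +
    |2 * q * S.β * S.fM| * (Fintype.card S.Edge * (2 * S.M) ^ 2), by positivity,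
    fun v y ζ hy hζ => ?_⟩
  refine (abs_add_le _ _).trans ?_
  rw [abs_mul, abs_mul (2 * q * S.β * S.fM)]
  gcongr
  · exact S.abs_dotProduct_L_le v hM hy hy
  · exact S.abs_activeErr_le v (S.abs_err_le hy hζ)

/-- In one step of the algorithm, the dissipation changes by the order of the step size. -/
theorem exists_dissip_sub_bound (hN : 2 ≤ N) (hM : 0 ≤ S.M) (hβ : 0 ≤ S.β) (hγ : 0 ≤ S.γ)
    (p q : ℝ) :
    ∃ C, 0 ≤ C ∧ ∀ v u t (y y' : Fin N → ℝ) (ζ ζ' s : Fin N → Fin N → ℝ),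
      S.Step u t y y' ζ ζ' s → (∀ i, |y' i| ≤ S.M) → (∀ i j, S.union.Adj i j → |ζ' i j| ≤ S.M) →
      |S.dissip p q v y' ζ' - S.dissip p q v y ζ| ≤ C * (1 / t) := by
  have hK : 0 ≤ S.stepConst := by
    rw [stepConst]
    positivity
  have hβK : S.β ≤ S.stepConst := by
    rw [stepConst]
    have : 0 ≤ S.γ * N * (2 * S.M + S.β) := by positivity
    linarith
  refine ⟨|2 * p * S.γ| * (N * (N * (4 * S.M * S.stepConst))) +
    |2 * q * S.β * S.fM| * (Fintype.card S.Edge * (2 * S.stepConst * (2 * (2 * S.M)))), by positivity,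
    fun v u t y y' ζ ζ' s H hy' hζ' => ?_⟩
  have ht : 0 ≤ 1 / (t : ℝ) := by positivity
  set ε := S.stepConst * (1 / t) with hε
  have hε0 : 0 ≤ ε := by positivity
  have hyy' := H.abs_state_sub_le hN hβ hγ
  have h1 : |y' ⬝ᵥ S.L v *ᵥ y' - y ⬝ᵥ S.L v *ᵥ y| ≤
      N * (ε * (N * (2 * S.M))) + N * (S.M * (N * (2 * ε))) := by
    have : y' ⬝ᵥ S.L v *ᵥ y' - y ⬝ᵥ S.L v *ᵥ y =
        (y' - y) ⬝ᵥ S.L v *ᵥ y' + y ⬝ᵥ S.L v *ᵥ (y' - y) := by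
      rw [Matrix.mulVec_sub, dotProduct_sub, sub_dotProduct]
      ring
    rw [this]
    refine (abs_add_le _ _).trans (add_le_add ?_ ?_)
    · exact S.abs_dotProduct_L_le v hM hyy' hy'
    · exact S.abs_dotProduct_L_le v hε0 H.abs_state_le hyy'
  have h2 : |S.activeErr v (S.err y' ζ') - S.activeErr v (S.err y ζ)| ≤
      Fintype.card S.Edge * (2 * ε * (2 * (2 * S.M))) := by
    refine S.abs_activeErr_sub_le v (by positivity) (by positivity)
      (S.abs_err_le H.abs_state_le H.abs_est_le) (S.abs_err_le hy' hζ') fun e => ?_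
    have h3 : S.err y' ζ' e - S.err y ζ e =
        (ζ' e.1.1 e.1.2 - ζ e.1.1 e.1.2) - (y' e.1.2 - y e.1.2) := by
      rw [err, err]
      ring
    rw [h3]
    refine (abs_sub _ _).trans ?_
    have h4 := H.abs_est_sub_le hβ e
    have h5 : 1 / (t : ℝ) * S.β ≤ ε := by
      rw [hε, mul_comm]
      gcongr
    linarith [hyy' e.1.2]
  have h3 : S.dissip p q v y' ζ' - S.dissip p q v y ζ =
      2 * p * S.γ * (y' ⬝ᵥ S.L v *ᵥ y' - y ⬝ᵥ S.L v *ᵥ y) +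
      2 * q * S.β * S.fM * (S.activeErr v (S.err y' ζ') - S.activeErr v (S.err y ζ)) := by
    rw [dissip, dissip]
    ring
  rw [h3]
  refine (abs_add_le _ _).trans ?_
  rw [abs_mul, abs_mul (2 * q * S.β * S.fM)]
  refine (add_le_add (mul_le_mul_of_nonneg_left h1 (abs_nonneg _))
    (mul_le_mul_of_nonneg_left h2 (abs_nonneg _))).trans_eq ?_
  rw [hε]
  ring

end Setup

namespace Setup

variable {N r h : ℕ} {S : Setup N r h}

open scoped Classical

/-! ### Trajectories of the algorithm -/

section Deterministic

variable {m : ℕ → Fin h} {d : ℕ → Fin N → Fin N → ℝ}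
  {x : ℕ → Fin N → EuclideanSpace ℝ (Fin (r + 1))} {z : ℕ → Fin N → Fin N → ℝ}

theorem A_mulVec_castSucc (v : Fin (r + 1) → ℝ) (k : Fin r) :
    (S.A *ᵥ v) k.castSucc = v k.succ := by
  simp only [Matrix.mulVec, dotProduct, A, Matrix.of_apply, (Fin.castSucc_lt_last k).ne, if_false]
  rw [Finset.sum_eq_single k.succ]
  · simp
  · intro j _ hj
    rw [if_neg, zero_mul]
    intro hjk
    exact hj (Fin.ext (by simpa using hjk))
  · simp

theorem A_mulVec_last (v : Fin (r + 1) → ℝ) : (S.A *ᵥ v) (Fin.last r) = S.a ⬝ᵥ v := by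
  simp [Matrix.mulVec, A, dotProduct]

/-- The gain `K₁` makes the compressed state a single integrator: `K₂ (A + B K₁) = K₂`. -/
theorem K₂_dotProduct_closed_loop (v : Fin (r + 1) → ℝ) (w : ℝ) :
    S.K₂ ⬝ᵥ (S.A *ᵥ v + (S.K₁ ⬝ᵥ v + w) • S.B) = S.K₂ ⬝ᵥ v + w := by
  have h1 : S.K₂ ⬝ᵥ (S.A *ᵥ v) = ∑ k, S.b k * v k.succ + S.a ⬝ᵥ v := by
    rw [dotProduct, Fin.sum_univ_castSucc]
    simp [A_mulVec_castSucc, A_mulVec_last, K₂]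
  have h2 : S.K₂ ⬝ᵥ S.B = 1 := by simp [B, K₂]
  have h3 : S.K₁ ⬝ᵥ v = -(S.a ⬝ᵥ v) + S.K₂ ⬝ᵥ v - ∑ k, S.b k * v k.succ := by
    have h4 : (Fin.cons 0 S.b : Fin (r + 1) → ℝ) ⬝ᵥ v = ∑ k, S.b k * v k.succ := by
      rw [dotProduct, Fin.sum_univ_succ]
      simp
    have h5 : S.K₁ = -S.a + S.K₂ - (Fin.cons 0 S.b : Fin (r + 1) → ℝ) := rfl
    rw [h5, sub_dotProduct, add_dotProduct, neg_dotProduct, h4]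
  rw [dotProduct_add, dotProduct_smul, h1, h2, h3, smul_eq_mul]
  ring

/-- The compressed states. -/
def compressed (S : Setup N r h) (x : Fin N → EuclideanSpace ℝ (Fin (r + 1))) (i : Fin N) : ℝ :=
  S.g (x i)

/-- The one-bit signals. -/
noncomputable def signals (S : Setup N r h) (x : Fin N → EuclideanSpace ℝ (Fin (r + 1)))
    (d : Fin N → Fin N → ℝ) (i j : Fin N) : ℝ :=
  S.signal i j (x j) (d i j)

/-- The compressed states follow the consensus feedback. -/
theorem IsTrajectory.compressed_succ (H : S.IsTrajectory m d x z) {t : ℕ} (ht : S.t₀ + 1 ≤ t)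
    (i : Fin N) : S.compressed (x (t + 1)) i = S.compressed (x t) i +
      S.γ / ((t : ℝ) + 1) * S.drift (m t) (S.compressed (x t)) (z t) i := by
  rw [compressed, H.state t ht, g]
  exact K₂_dotProduct_closed_loop _ _

/-- The compressed states and the estimates never leave `[-M, M]`. -/
theorem IsTrajectory.bounded (H : S.IsTrajectory m d x z) (hN : 2 ≤ N) (hγ : 0 ≤ S.γ)
    (ht₀γ : ∀ i, S.γ * (S.deg i : ℝ) - 1 < (S.t₀ : ℝ)) (hMx : ∀ i, |S.g (S.x₀ i)| ≤ S.M)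
    (hMz : ∀ i j, S.union.Adj i j → |S.z₀ i j| ≤ S.M) {t : ℕ} (ht : S.t₀ + 1 ≤ t) :
    (∀ i, |S.compressed (x t) i| ≤ S.M) ∧ ∀ i j, S.union.Adj i j → |z (t - 1) i j| ≤ S.M := by
  have hM : 0 ≤ S.M := (abs_nonneg _).trans (hMx ⟨0, by omega⟩)
  induction t, ht using Nat.le_induction with
  | base =>
    simp only [compressed, H.init_state, Nat.add_sub_cancel, H.init_estimate]
    exact ⟨hMx, hMz⟩
  | succ t ht ih =>
    have hz : ∀ i j, S.union.Adj i j → |z t i j| ≤ S.M := fun i j _ => by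
      rw [H.estimate t ht]
      exact S.abs_proj_le hM _
    refine ⟨fun i => ?_, hz⟩
    rw [H.compressed_succ ht]
    refine S.abs_step_le _ hγ i ?_ (ih.1 i) (hz i)
    have h1 := ht₀γ i
    have h2 : (S.t₀ : ℝ) + 1 ≤ t := by exact_mod_cast ht
    linarith

theorem signal_mem_Icc (i j : Fin N) (v : EuclideanSpace ℝ (Fin (r + 1))) (e : ℝ) :
    S.signal i j v e ∈ Set.Icc (0 : ℝ) 1 := by
  rw [signal]
  split_ifs <;> simp

theorem IsTrajectory.step (H : S.IsTrajectory m d x z) (hN : 2 ≤ N) (hγ : 0 ≤ S.γ)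
    (ht₀γ : ∀ i, S.γ * (S.deg i : ℝ) - 1 < (S.t₀ : ℝ)) (hMx : ∀ i, |S.g (S.x₀ i)| ≤ S.M)
    (hMz : ∀ i j, S.union.Adj i j → |S.z₀ i j| ≤ S.M) {t : ℕ} (ht : S.t₀ + 1 ≤ t) :
    S.Step (m t) t (S.compressed (x t)) (S.compressed (x (t + 1))) (z (t - 1)) (z t)
      (S.signals (x t) (d t)) where
  pos := by omega
  abs_state_le := (H.bounded hN hγ ht₀γ hMx hMz ht).1
  abs_est_le := (H.bounded hN hγ ht₀γ hMx hMz ht).2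
  signal_mem i j := signal_mem_Icc i j _ _
  est i j := H.estimate t ht i j
  state i := H.compressed_succ ht i

theorem g_eq (v : EuclideanSpace ℝ (Fin (r + 1))) :
    S.g v = ∑ k, S.b k * v k.castSucc + v (Fin.last r) := by
  rw [g, dotProduct, Fin.sum_univ_castSucc]
  simp [K₂]

/-- The plant is a chain of delays: all coordinates but the last are shifts of the next one. -/
theorem IsTrajectory.state_castSucc (H : S.IsTrajectory m d x z) {t : ℕ} (ht : S.t₀ + 1 ≤ t)
    (i : Fin N) (k : Fin r) : x (t + 1) i k.castSucc = x t i k.succ := by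
  rw [H.state t ht]
  simp [A_mulVec_castSucc, B, (Fin.castSucc_lt_last k).ne]

end Deterministic

/-! ### Adaptedness and integrability -/

section Measurability

theorem measurable_g : Measurable S.g := by
  unfold g dotProduct
  fun_prop

theorem measurable_F : Measurable S.F := (monotone_cdf _).measurable

theorem measurable_proj : Measurable S.proj := by
  unfold proj
  fun_prop

variable {Ω : Type*}

theorem measurable_ite_adj [MeasurableSpace Ω] {m : Ω → Fin h} (hm : Measurable m) (i j : Fin N)
    {φ : Ω → ℝ} (hφ : Measurable φ) :
    Measurable fun ω => if (S.G (m ω)).Adj i j then φ ω else 0 :=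
  Measurable.ite (hm (Set.toFinite {u | (S.G u).Adj i j}).measurableSet) hφ measurable_const

theorem measurable_next_est [MeasurableSpace Ω] {m : Ω → Fin h} (hm : Measurable m) (i j : Fin N)
    {ζ e : Ω → ℝ} {v : Ω → EuclideanSpace ℝ (Fin (r + 1))} (hζ : Measurable ζ) (he : Measurable e)
    (hv : Measurable v) (τ : ℝ) :
    Measurable fun ω => S.proj (ζ ω + τ * (if (S.G (m ω)).Adj i j then
      S.F (S.c i j - ζ ω) - S.signal i j (v ω) (e ω) else 0)) := by
  refine measurable_proj.comp (hζ.add ((measurable_ite_adj hm i j ?_).const_mul τ))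
  refine (measurable_F.comp (measurable_const.sub hζ)).sub ?_
  unfold signal
  refine Measurable.ite ?_ measurable_const measurable_const
  exact measurableSet_le ((measurable_g.comp hv).add he) measurable_const

theorem measurable_next_state [MeasurableSpace Ω] {m : Ω → Fin h} (hm : Measurable m) (i : Fin N)
    {ζ : Fin N → Ω → ℝ} {v : Ω → EuclideanSpace ℝ (Fin (r + 1))} (hζ : ∀ j, Measurable (ζ j))
    (hv : Measurable v) (t : ℕ) :
    Measurable fun ω => WithLp.toLp 2
      (S.A *ᵥ (v ω).ofLp + S.control (m ω) t i (v ω) (fun j => ζ j ω) • S.B) := by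
  refine (WithLp.measurable_toLp 2 _).comp ?_
  have hv' : Measurable fun ω => (v ω).ofLp := (WithLp.measurable_ofLp 2 _).comp hv
  have hA : Continuous fun w : Fin (r + 1) → ℝ => S.A *ᵥ w := by fun_prop
  have hK : Continuous fun w : Fin (r + 1) → ℝ => S.K₁ ⬝ᵥ w := by fun_prop
  refine (hA.measurable.comp hv').add (Measurable.smul_const ?_ _)
  unfold control
  refine (hK.measurable.comp hv').add (Measurable.const_mul ?_ _)
  exact Finset.measurable_sum _ fun j _ =>
    measurable_ite_adj hm i j ((hζ j).sub (measurable_g.comp hv))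

variable {m : ℕ → Ω → Fin h} {d : ℕ → Fin N → Fin N → Ω → ℝ}
  {x : ℕ → Fin N → Ω → EuclideanSpace ℝ (Fin (r + 1))} {z : ℕ → Fin N → Fin N → Ω → ℝ}

/-- The state at time `t` and the estimates at time `t - 1` only depend on the past. -/
theorem measurable_past_trajectory
    (hxz : ∀ ω, S.IsTrajectory (fun t => m t ω) (fun t i j => d t i j ω)
      (fun t i => x t i ω) (fun t i j => z t i j ω)) {t : ℕ} (ht : S.t₀ + 1 ≤ t) :
    (∀ i, Measurable[past m d t] (x t i)) ∧
      ∀ i j, Measurable[past m d t] (z (t - 1) i j) := by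
  induction t, ht using Nat.le_induction with
  | base =>
    refine ⟨fun i => ?_, fun i j => ?_⟩
    · rw [show x (S.t₀ + 1) i = fun _ => S.x₀ i from funext fun ω => (hxz ω).init_state i]
      exact @measurable_const _ _ _ (past m d _) _
    · rw [Nat.add_sub_cancel,
        show z S.t₀ i j = fun _ => S.z₀ i j from funext fun ω => (hxz ω).init_estimate i j]
      exact @measurable_const _ _ _ (past m d _) _
  | succ t ht ih =>
    let _ := past m d (t + 1)
    have hm : Measurable (m t) := measurable_past_switch (Nat.le_succ t)
    have hx : ∀ i, Measurable (x t i) := fun i => (ih.1 i).mono (past_mono t) le_rfl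
    have hz : ∀ i j, Measurable (z (t - 1) i j) := fun i j => (ih.2 i j).mono (past_mono t) le_rfl
    have hz' : ∀ i j, Measurable (z t i j) := fun i j => by
      rw [show z t i j = _ from funext fun ω => (hxz ω).estimate t ht i j]
      exact measurable_next_est hm i j (hz i j) (measurable_past_noise (Nat.lt_succ_self t) i j)
        (hx j) _
    refine ⟨fun i => ?_, hz'⟩
    rw [show x (t + 1) i = _ from funext fun ω => (hxz ω).state t ht i]
    exact measurable_next_state hm i (hz' i) (hx i) t

theorem measurable_past_compressed
    (hxz : ∀ ω, S.IsTrajectory (fun t => m t ω) (fun t i j => d t i j ω)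
      (fun t i => x t i ω) (fun t i j => z t i j ω)) {t : ℕ} (ht : S.t₀ + 1 ≤ t) :
    Measurable[past m d t] fun ω => S.compressed fun i => x t i ω := by
  let _ := past m d t
  exact measurable_pi_lambda _ fun i => measurable_g.comp ((measurable_past_trajectory hxz ht).1 i)

theorem measurable_past_err
    (hxz : ∀ ω, S.IsTrajectory (fun t => m t ω) (fun t i j => d t i j ω)
      (fun t i => x t i ω) (fun t i j => z t i j ω)) {t : ℕ} (ht : S.t₀ + 1 ≤ t) :
    Measurable[past m d t] fun ω =>
      S.err (S.compressed fun i => x t i ω) (fun i j => z (t - 1) i j ω) := by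
  let _ := past m d t
  exact measurable_pi_lambda _ fun e =>
    ((measurable_past_trajectory hxz ht).2 e.1.1 e.1.2).sub
      ((measurable_pi_apply e.1.2).comp (measurable_past_compressed hxz ht))

/-- At every time, the states are bounded by a deterministic constant. -/
theorem exists_norm_state_le (hN : 2 ≤ N) (hγ : 0 ≤ S.γ)
    (ht₀γ : ∀ i, S.γ * (S.deg i : ℝ) - 1 < (S.t₀ : ℝ)) (hMx : ∀ i, |S.g (S.x₀ i)| ≤ S.M)
    (hMz : ∀ i j, S.union.Adj i j → |S.z₀ i j| ≤ S.M)
    (hxz : ∀ ω, S.IsTrajectory (fun t => m t ω) (fun t i j => d t i j ω)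
      (fun t i => x t i ω) (fun t i j => z t i j ω)) {t : ℕ} (ht : S.t₀ + 1 ≤ t) (i : Fin N) :
    ∃ C, ∀ ω, ‖x t i ω‖ ≤ C := by
  have H : ∀ k, ∃ C, ∀ ω, |x t i ω k| ≤ C := by
    induction t, ht using Nat.le_induction with
    | base => exact fun k => ⟨|S.x₀ i k|, fun ω => by rw [(hxz ω).init_state i]⟩
    | succ t ht ih =>
      have hcast : ∀ k : Fin r, ∃ C, ∀ ω, |x (t + 1) i ω k.castSucc| ≤ C := fun k => by
        obtain ⟨C, hC⟩ := ih k.succ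
        exact ⟨C, fun ω => by rw [(hxz ω).state_castSucc ht]; exact hC ω⟩
      refine Fin.lastCases ?_ hcast
      choose C hC using hcast
      refine ⟨S.M + ∑ k, |S.b k| * C k, fun ω => ?_⟩
      have h1 := ((hxz ω).bounded hN hγ ht₀γ hMx hMz (Nat.le_succ_of_le ht)).1 i
      have h2 : x (t + 1) i ω (Fin.last r) = S.compressed (fun i => x (t + 1) i ω) i -
          ∑ k, S.b k * x (t + 1) i ω k.castSucc := by
        rw [compressed, g_eq]
        ring
      rw [h2]
      refine (abs_sub _ _).trans (add_le_add h1 ((Finset.abs_sum_le_sum_abs _ _).trans ?_))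
      refine Finset.sum_le_sum fun k _ => ?_
      rw [abs_mul]
      exact mul_le_mul_of_nonneg_left (hC k ω) (abs_nonneg _)
  choose C hC using H
  refine ⟨√(∑ k, C k ^ 2), fun ω => ?_⟩
  rw [EuclideanSpace.norm_eq]
  refine Real.sqrt_le_sqrt (Finset.sum_le_sum fun k _ => ?_)
  exact pow_le_pow_left₀ (norm_nonneg _) (hC k ω) 2

end Measurability

end Setup

namespace Setup

variable {N r h : ℕ} {S : Setup N r h}

open scoped Classical

/-! ### The expected Lyapunov function -/

/-- Integration of a pointwise bound for one step, with a mean-zero fluctuation `φ`. -/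
theorem integral_le_of_forall_le {Ω : Type*} [MeasurableSpace Ω] {μ : Measure Ω}
    [IsProbabilityMeasure μ] {U' U D E φ : Ω → ℝ} {τ κ b C : ℝ} (hU' : Integrable U' μ)
    (hU : Integrable U μ) (hD : Integrable D μ) (hE : Integrable E μ) (hφ : Integrable φ μ)
    (hφ0 : ∫ ω, φ ω ∂μ = 0)
    (h : ∀ ω, U' ω ≤ U ω + τ * (-κ * U ω + (D ω - E ω) + b * φ ω) + C) :
    ∫ ω, U' ω ∂μ ≤ ∫ ω, U ω ∂μ +
      τ * (-κ * ∫ ω, U ω ∂μ + (∫ ω, D ω ∂μ - ∫ ω, E ω ∂μ)) + C := by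
  have h1 : Integrable (fun ω => D ω - E ω) μ := hD.sub hE
  have h2 : Integrable (fun ω => -κ * U ω + (D ω - E ω)) μ := (hU.const_mul _).add h1
  have h3 : Integrable (fun ω => -κ * U ω + (D ω - E ω) + b * φ ω) μ := h2.add (hφ.const_mul _)
  have h4 : Integrable (fun ω => U ω + τ * (-κ * U ω + (D ω - E ω) + b * φ ω)) μ :=
    hU.add (h3.const_mul _)
  refine (integral_mono hU' (h4.add (integrable_const C)) h).trans_eq ?_
  simp only [Pi.add_apply]
  rw [integral_add h4 (integrable_const C), integral_add hU (h3.const_mul _), integral_const_mul,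
    integral_add h2 (hφ.const_mul _), integral_add (hU.const_mul _) h1, integral_const_mul,
    integral_const_mul, hφ0, integral_sub hD hE]
  simp

/-- The standing assumptions on the algorithm and on its randomness. -/
structure Model (S : Setup N r h) {Ω : Type*} [MeasurableSpace Ω] (μ : Measure Ω)
    (d : ℕ → Fin N → Fin N → Ω → ℝ) (m : ℕ → Ω → Fin h) (P : Matrix (Fin h) (Fin h) ℝ)
    (π : Fin h → ℝ) (x : ℕ → Fin N → Ω → EuclideanSpace ℝ (Fin (r + 1)))
    (z : ℕ → Fin N → Fin N → Ω → ℝ) : Prop where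
  two_le : 2 ≤ N
  connected : S.union.Connected
  δ_pos : 0 < S.δ
  γ_pos : 0 < S.γ
  γ_deg : ∀ i, S.γ * (S.deg i : ℝ) - 1 < (S.t₀ : ℝ)
  abs_init_state : ∀ i, |S.g (S.x₀ i)| ≤ S.M
  abs_init_est : ∀ i j, S.union.Adj i j → |S.z₀ i j| ≤ S.M
  noise : IsGaussianNoise μ d S.δ
  chain : IsMarkovChain μ m P
  irreducible : P.IsIrreducible
  limit : ∀ u, Tendsto (fun t => μ.real {ω | m t ω = u}) atTop (𝓝 (π u))
  indep : IndepFun (fun ω (q : ℕ × Fin N × Fin N) => d q.1 q.2.1 q.2.2 ω) (fun ω t => m t ω) μ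
  trajectory : ∀ ω, S.IsTrajectory (fun t => m t ω) (fun t i j => d t i j ω)
    (fun t i => x t i ω) (fun t i j => z t i j ω)

theorem signals_eq_indicator {Ω : Type*} {d : ℕ → Fin N → Fin N → Ω → ℝ}
    {x : ℕ → Fin N → Ω → EuclideanSpace ℝ (Fin (r + 1))} (t : ℕ) (ω : Ω) (i j : Fin N) :
    S.signals (fun i => x t i ω) (fun i j => d t i j ω) i j =
      {ω | d t i j ω ≤ S.c i j - S.compressed (fun i => x t i ω) j}.indicator 1 ω := by
  simp only [signals, signal, Set.indicator, compressed, Set.mem_ofPred_eq, Pi.one_apply,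
    le_sub_iff_add_le']

namespace Model

variable {Ω : Type*} [MeasurableSpace Ω] {μ : Measure Ω}
  {d : ℕ → Fin N → Fin N → Ω → ℝ} {m : ℕ → Ω → Fin h} {P : Matrix (Fin h) (Fin h) ℝ}
  {π : Fin h → ℝ} {x : ℕ → Fin N → Ω → EuclideanSpace ℝ (Fin (r + 1))}
  {z : ℕ → Fin N → Fin N → Ω → ℝ}

theorem step (H : S.Model μ d m P π x z) {t : ℕ} (ht : S.t₀ + 1 ≤ t) (ω : Ω) :
    S.Step (m t ω) t (S.compressed fun i => x t i ω) (S.compressed fun i => x (t + 1) i ω)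
      (fun i j => z (t - 1) i j ω) (fun i j => z t i j ω)
      (S.signals (fun i => x t i ω) fun i j => d t i j ω) :=
  (H.trajectory ω).step H.two_le H.γ_pos.le H.γ_deg H.abs_init_state H.abs_init_est ht

theorem M_nonneg (H : S.Model μ d m P π x z) : 0 ≤ S.M :=
  (abs_nonneg _).trans (H.abs_init_state ⟨0, by have := H.two_le; omega⟩)

theorem past_le (H : S.Model μ d m P π x z) (t : ℕ) : past m d t ≤ ‹MeasurableSpace Ω› :=
  OneBit.past_le H.chain.measurable H.noise.measurable t

theorem measurable_lyap (H : S.Model μ d m P π x z) {t : ℕ} (ht : S.t₀ + 1 ≤ t) (p q : ℝ) :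
    Measurable fun ω =>
      S.lyap p q (S.compressed fun i => x t i ω) (fun i j => z (t - 1) i j ω) :=
  ((S.continuous_disagreement.measurable.comp
    ((measurable_past_compressed H.trajectory ht).mono (H.past_le t) le_rfl)).const_mul p).add
    ((S.continuous_sqErr.measurable.comp
      ((measurable_past_err H.trajectory ht).mono (H.past_le t) le_rfl)).const_mul q)

theorem measurable_dissip (H : S.Model μ d m P π x z) {t : ℕ} (ht : S.t₀ + 1 ≤ t) (p q : ℝ)
    (v : Fin h) : Measurable[past m d t] fun ω =>
      S.dissip p q v (S.compressed fun i => x t i ω) (fun i j => z (t - 1) i j ω) := by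
  have hL : Continuous fun y : Fin N → ℝ => y ⬝ᵥ S.L v *ᵥ y := by fun_prop
  exact ((hL.measurable.comp (measurable_past_compressed H.trajectory ht)).const_mul _).add
    (((S.continuous_activeErr v).measurable.comp (measurable_past_err H.trajectory ht)).const_mul _)

theorem abs_err_le (H : S.Model μ d m P π x z) {t : ℕ} (ht : S.t₀ + 1 ≤ t) (ω : Ω) (e : S.Edge) :
    |S.err (S.compressed fun i => x t i ω) (fun i j => z (t - 1) i j ω) e| ≤ 2 * S.M :=
  S.abs_err_le (H.step ht ω).abs_state_le (H.step ht ω).abs_est_le e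

variable [IsProbabilityMeasure μ]

/-- The limit law of the switching signal charges every topology. -/
theorem limit_pos (H : S.Model μ d m P π x z) (v : Fin h) : 0 < π v :=
  stationary_pos H.irreducible (limit_law_vecMul H.noise H.chain H.indep H.limit)
    (fun u => ge_of_tendsto' (H.limit u) fun _ => measureReal_nonneg) (limit_law_sum H.chain H.limit) v

/-- The solutions `g v` of the Poisson equations for the indicators of the topologies `v`. -/
theorem exists_poisson (H : S.Model μ d m P π x z) :
    ∃ g : Fin h → Fin h → ℝ,
      ∀ v u, g v u - ∑ w, P u w * g v w = (if u = v then 1 else 0) - π v := by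
  have h1 := fun v => exists_poisson_solution H.chain.stochastic H.irreducible
    (limit_law_vecMul H.noise H.chain H.indep H.limit) (limit_law_sum H.chain H.limit)
    (fun u => if u = v then (1 : ℝ) else 0)
  choose g hg using h1
  exact ⟨g, fun v u => by simpa using hg v u⟩

theorem integrable_lyap (H : S.Model μ d m P π x z) {t : ℕ} (ht : S.t₀ + 1 ≤ t) (p q : ℝ) :
    Integrable (fun ω =>
      S.lyap p q (S.compressed fun i => x t i ω) (fun i j => z (t - 1) i j ω)) μ := by
  refine .of_bound (H.measurable_lyap ht p q).aestronglyMeasurable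
    (|p| * (N * (2 * S.M) ^ 2) + |q| * (Fintype.card S.Edge * (2 * S.M) ^ 2))
    (ae_of_all _ fun ω => ?_)
  refine (norm_add_le _ _).trans ?_
  rw [norm_mul, norm_mul, Real.norm_of_nonneg (S.disagreement_nonneg _),
    Real.norm_of_nonneg (S.sqErr_nonneg _), Real.norm_eq_abs, Real.norm_eq_abs]
  unfold disagreement sqErr dotProduct
  gcongr
  · refine (Finset.sum_le_card_nsmul _ _ ((2 * S.M) ^ 2) fun i _ => ?_).trans_eq (by simp)
    rw [← sq, ← sq_abs]
    exact pow_le_pow_left₀ (abs_nonneg _)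
      (S.abs_J_mulVec_le H.two_le (H.step ht ω).abs_state_le i) 2
  · refine (Finset.sum_le_card_nsmul _ _ ((2 * S.M) ^ 2) fun e _ => ?_).trans_eq (by simp)
    rw [← sq, ← sq_abs]
    exact pow_le_pow_left₀ (abs_nonneg _) (H.abs_err_le ht ω e) 2

/-- The fluctuation of the signals integrates to zero. -/
theorem integral_fluct (H : S.Model μ d m P π x z) {t : ℕ} (ht : S.t₀ + 1 ≤ t) :
    Integrable (fun ω => S.fluct (m t ω) (S.compressed fun i => x t i ω)
      (fun i j => z (t - 1) i j ω) (S.signals (fun i => x t i ω) fun i j => d t i j ω)) μ ∧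
    ∫ ω, S.fluct (m t ω) (S.compressed fun i => x t i ω)
      (fun i j => z (t - 1) i j ω) (S.signals (fun i => x t i ω) fun i j => d t i j ω) ∂μ = 0 := by
  set Z : S.Edge → Ω → ℝ := fun e ω => if (S.G (m t ω)).Adj e.1.1 e.1.2 then
    S.err (S.compressed fun i => x t i ω) (fun i j => z (t - 1) i j ω) e else 0 with hZdef
  set Y : S.Edge → Ω → ℝ := fun e ω =>
    S.c e.1.1 e.1.2 - S.compressed (fun i => x t i ω) e.1.2 with hYdef
  have hZ : ∀ e, Measurable[past m d t] (Z e) := fun e =>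
    @measurable_ite_adj _ _ _ S Ω (past m d t) _ (measurable_past_switch le_rfl) _ _ _
      ((measurable_pi_apply e).comp (measurable_past_err H.trajectory ht))
  have hY : ∀ e, Measurable[past m d t] (Y e) := fun e =>
    measurable_const.sub ((measurable_pi_apply e.1.2).comp (measurable_past_compressed H.trajectory ht))
  have hZC : ∀ e ω, |Z e ω| ≤ 2 * S.M := fun e ω => by
    simp only [hZdef]
    split_ifs
    · exact H.abs_err_le ht ω e
    · simpa using H.M_nonneg
  have hYset : ∀ e : S.Edge, MeasurableSet {ω | d t e.1.1 e.1.2 ω ≤ Y e ω} := fun e =>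
    measurableSet_le (H.noise.measurable _ _ _) ((hY e).mono (H.past_le t) le_rfl)
  have hZint : ∀ e, ∀ φ : Ω → ℝ, Measurable φ → (∀ ω, |φ ω| ≤ 1) →
      Integrable (fun ω => Z e ω * φ ω) μ := fun e φ hφ hφ1 => by
    refine .of_bound (((hZ e).mono (H.past_le t) le_rfl).mul hφ).aestronglyMeasurable (2 * S.M)
      (ae_of_all _ fun ω => ?_)
    rw [norm_mul]
    exact (mul_le_of_le_one_right (norm_nonneg _) (hφ1 ω)).trans (hZC e ω)
  have hint1 : ∀ e, Integrable (fun ω => Z e ω * S.F (Y e ω)) μ := fun e =>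
    hZint e _ (measurable_F.comp ((hY e).mono (H.past_le t) le_rfl)) fun ω => by
      rw [abs_of_nonneg (S.F_nonneg _)]
      exact S.F_le_one _
  have hint2 : ∀ e : S.Edge, Integrable
      (fun ω => Z e ω * {ω | d t e.1.1 e.1.2 ω ≤ Y e ω}.indicator 1 ω) μ := fun e =>
    hZint e _ (measurable_one.indicator (hYset e)) fun ω => by
      rw [Set.indicator]
      split_ifs <;> simp
  have heq : ∀ ω, S.fluct (m t ω) (S.compressed fun i => x t i ω)
      (fun i j => z (t - 1) i j ω) (S.signals (fun i => x t i ω) fun i j => d t i j ω) =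
      ∑ e, (Z e ω * S.F (Y e ω) - Z e ω * {ω | d t e.1.1 e.1.2 ω ≤ Y e ω}.indicator 1 ω) := by
    intro ω
    rw [fluct]
    refine Finset.sum_congr rfl fun e _ => ?_
    rw [signals_eq_indicator, ← mul_sub]
    simp only [hZdef, hYdef]
    split_ifs
    · rfl
    · rw [zero_mul]
  simp_rw [heq]
  have hint : ∀ e : S.Edge, Integrable (fun ω => Z e ω * S.F (Y e ω) -
      Z e ω * {ω | d t e.1.1 e.1.2 ω ≤ Y e ω}.indicator 1 ω) μ := fun e => (hint1 e).sub (hint2 e)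
  refine ⟨integrable_finsetSum _ fun e _ => hint e, ?_⟩
  rw [integral_finsetSum _ fun e _ => hint e]
  refine Finset.sum_eq_zero fun e _ => ?_
  rw [integral_sub (hint1 e) (hint2 e), integral_indicator_noise H.noise H.chain.measurable H.indep t
    e.1.1 e.1.2 (hY e) (hZ e) (hZC e), sub_eq_zero]
  rfl

/-- The expectation of the Lyapunov function decays like `t ^ (-s)` for every `s ≤ 1` below its
dissipation rate `κ`. -/
theorem exists_integral_lyap_le (H : S.Model μ d m P π x z) (hβ : 0 ≤ S.β) {p q κ s : ℝ}
    (hp : 0 ≤ p) (hq : 0 ≤ q)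
    (h1 : q * (S.γ * S.lamG π / S.lam₂ π H.two_le) ≤ p * (S.γ * S.lam₂ π H.two_le - κ))
    (h2 : p * (S.γ * S.lamG π / S.lam₂ π H.two_le) ≤
      q * (2 * S.β * S.fM * piMin π - S.γ * S.alpha π H.two_le - κ))
    (hs : 0 ≤ s) (hs1 : s ≤ 1) (hsκ : s < κ) :
    ∃ K, ∀ᶠ t : ℕ in atTop, ∫ ω, S.lyap p q (S.compressed fun i => x t i ω)
      (fun i j => z (t - 1) i j ω) ∂μ ≤ K * (t : ℝ) ^ (-s) := by
  obtain ⟨g, hg⟩ := H.exists_poisson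
  obtain ⟨C₁, hC₁, hdissip⟩ := S.exists_dissip_bound H.M_nonneg p q
  obtain ⟨C₂, hC₂, hdissip'⟩ := S.exists_dissip_sub_bound H.two_le H.M_nonneg hβ H.γ_pos.le p q
  set D : Fin h → ℕ → Ω → ℝ := fun v t ω =>
    S.dissip p q v (S.compressed fun i => x t i ω) (fun i j => z (t - 1) i j ω) with hD
  set G : Fin h → ℕ → Ω → ℝ := fun u t ω => ∑ v, g v u * D v t ω with hG
  set Cg : ℝ := ∑ v, ∑ u, |g v u| with hCg
  have hgle : ∀ v u, |g v u| ≤ ∑ u, |g v u| := fun v u =>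
    Finset.single_le_sum (f := fun u => |g v u|) (fun _ _ => abs_nonneg _) (Finset.mem_univ u)
  have hDm : ∀ v, ∀ t ≥ S.t₀ + 1, Measurable[past m d t] (D v t) := fun v t ht =>
    H.measurable_dissip ht p q v
  have hDC : ∀ v, ∀ t ≥ S.t₀ + 1, ∀ ω, |D v t ω| ≤ C₁ := fun v t ht ω =>
    hdissip v _ _ (H.step ht ω).abs_state_le (H.step ht ω).abs_est_le
  have hGm : ∀ u, ∀ t ≥ S.t₀ + 1, Measurable[past m d t] (G u t) := fun u t ht =>
    Finset.measurable_sum _ fun v _ => (hDm v t ht).const_mul _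
  have hsumC : ∀ (u : Fin h) (φ : Fin h → ℝ) (C : ℝ), 0 ≤ C → (∀ v, |φ v| ≤ C) →
      |∑ v, g v u * φ v| ≤ Cg * C := fun u φ C hC hφ => by
    refine (Finset.abs_sum_le_sum_abs _ _).trans ?_
    rw [hCg, Finset.sum_mul]
    refine Finset.sum_le_sum fun v _ => ?_
    rw [abs_mul]
    exact mul_le_mul (hgle v u) (hφ v) (abs_nonneg _) (Finset.sum_nonneg fun _ _ => abs_nonneg _)
  have hGC : ∀ u, ∀ t ≥ S.t₀ + 1, ∀ ω, |G u t ω| ≤ Cg * C₁ := fun u t ht ω =>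
    hsumC u _ C₁ hC₁ fun v => hDC v t ht ω
  have hGmix : ∀ t ≥ S.t₀ + 1, ∀ k, Integrable (fun ω => G (m k ω) t ω) μ := fun t ht k => by
    refine .of_bound (Measurable.aestronglyMeasurable ?_) (Cg * C₁)
      (ae_of_all _ fun ω => hGC _ t ht ω)
    exact Finset.measurable_sum _ fun v _ =>
      ((measurable_of_finite (g v)).comp (H.chain.measurable k)).mul
        ((hDm v t ht).mono (H.past_le t) le_rfl)
  have hPG : ∀ t ≥ S.t₀ + 1, ∀ w, Integrable (fun ω => P (m t ω) w * G w t ω) μ := fun t ht w => by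
    refine .of_bound (Measurable.aestronglyMeasurable ?_) (1 * (Cg * C₁)) (ae_of_all _ fun ω => ?_)
    · exact ((measurable_of_finite fun u => P u w).comp (H.chain.measurable t)).mul
        ((hGm w t ht).mono (H.past_le t) le_rfl)
    · rw [norm_mul]
      refine mul_le_mul ?_ (hGC w t ht ω) (norm_nonneg _) zero_le_one
      rw [Real.norm_of_nonneg (Matrix.nonneg_of_mem_rowStochastic H.chain.stochastic)]
      exact Matrix.le_one_of_mem_rowStochastic H.chain.stochastic
  have hPGint : ∀ t ≥ S.t₀ + 1, Integrable (fun ω => ∑ w, P (m t ω) w * G w t ω) μ :=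
    fun t ht => integrable_finsetSum _ fun w _ => hPG t ht w
  -- the Markov property moves the corrector from the topology at `t` to the one at `t + 1`
  have hmarkov : ∀ t ≥ S.t₀ + 1, ∫ ω, ∑ w, P (m t ω) w * G w t ω ∂μ =
      ∫ ω, G (m (t + 1) ω) t ω ∂μ := fun t ht => by
    rw [integral_finsetSum _ fun w _ => hPG t ht w]
    have h3 : ∀ w, Integrable ({ω | m (t + 1) ω = w}.indicator (G w t)) μ := fun w =>
      (Integrable.of_bound ((hGm w t ht).mono (H.past_le t) le_rfl).aestronglyMeasurable (Cg * C₁)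
        (ae_of_all _ fun ω => hGC w t ht ω)).indicator
        (H.chain.measurable (t + 1) (measurableSet_singleton w))
    calc ∑ w, ∫ ω, P (m t ω) w * G w t ω ∂μ
        = ∑ w, ∫ ω, {ω | m (t + 1) ω = w}.indicator (G w t) ω ∂μ :=
          Finset.sum_congr rfl fun w _ => (integral_next_switch H.noise H.chain H.indep t w
            (hGm w t ht) (hGC w t ht)).symm
      _ = ∫ ω, ∑ w, {ω | m (t + 1) ω = w}.indicator (G w t) ω ∂μ :=
          (integral_finsetSum _ fun w _ => h3 w).symm
      _ = _ := by
          refine integral_congr_ae (ae_of_all _ fun ω => ?_)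
          change ∑ w, _ = _
          rw [Finset.sum_eq_single (m (t + 1) ω) (fun w _ hw => ?_) (by simp)]
          · simp [Set.indicator]
          · simp [Set.indicator, hw.symm]
  set C₃ := p * (N * (6 * S.stepConst ^ 2)) + q * (Fintype.card S.Edge * (11 * S.stepConst ^ 2))
    with hC₃
  have hC₃0 : 0 ≤ C₃ := by positivity
  have hCg0 : 0 ≤ Cg := Finset.sum_nonneg fun _ _ => Finset.sum_nonneg fun _ _ => abs_nonneg _
  refine exists_le_mul_rpow_of_corrector (b := fun t => -∫ ω, G (m t ω) t ω ∂μ)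
    (b' := fun t => -∫ ω, ∑ w, P (m t ω) w * G w t ω ∂μ) (B := Cg * C₁) (C := C₃ + Cg * C₂)
    (T := S.t₀ + 1) hs hs1 hsκ (by omega) (by positivity) ?_ ?_ ?_
  · intro t ht
    rw [abs_neg]
    refine (norm_integral_le_of_norm_le_const (f := fun ω => G (m t ω) t ω)
      (ae_of_all _ fun ω => hGC _ t ht ω)).trans_eq ?_
    simp
  · intro t ht
    rw [hmarkov t ht, neg_sub_neg, ← integral_sub (hGmix t ht (t + 1)) (hGmix _ (by omega) _)]
    have h3 : ∀ ω, ‖G (m (t + 1) ω) t ω - G (m (t + 1) ω) (t + 1) ω‖ ≤ Cg * (C₂ * (1 / t)) := by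
      intro ω
      simp only [hG, ← Finset.sum_sub_distrib, ← mul_sub]
      refine hsumC _ _ _ (by positivity) fun v => ?_
      rw [abs_sub_comm]
      have hnext := H.step (t := t + 1) (by omega) ω
      exact hdissip' v _ t _ _ _ _ _ (H.step ht ω) hnext.abs_state_le hnext.abs_est_le
    refine (norm_integral_le_of_norm_le_const (ae_of_all _ h3)).trans ?_
    rw [probReal_univ, mul_one, ← mul_assoc]
    exact mul_le_mul_of_nonneg_right (by linarith) (by positivity)
  · intro t ht
    obtain ⟨hfl, hfl0⟩ := H.integral_fluct ht
    have h3 := fun ω => S.lyap_le_of_step (H.step ht ω) H.two_le H.connected H.δ_pos hβ H.γ_pos.le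
      H.limit_pos hp hq h1 h2
    simp only [S.dissip_sub_eq_corrector hg] at h3
    have hU := H.integrable_lyap ht p q
    have hU' := H.integrable_lyap (t := t + 1) (by omega) p q
    have h4 := integral_le_of_forall_le hU' hU (hPGint t ht) (hGmix t ht t) hfl hfl0 h3
    refine h4.trans ?_
    rw [neg_sub_neg]
    exact add_le_add le_rfl (mul_le_mul_of_nonneg_right
      (le_add_of_nonneg_right (mul_nonneg hCg0 hC₂)) (sq_nonneg _))

end Model
end Setup

/-! ### From the compressed states to the states -/

section L2

variable {Ω : Type*} [MeasurableSpace Ω] {μ : Measure Ω}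

/-- The `L²` norm of the complexification of a real function. -/
theorem norm_sq_of_ae_eq {f : Lp ℂ 2 μ} {u : Ω → ℝ} (hf : f =ᵐ[μ] fun ω => (u ω : ℂ)) :
    ‖f‖ ^ 2 = ∫ ω, u ω ^ 2 ∂μ := by
  have h1 : ∫ ω, ‖f ω‖ ^ 2 ∂μ = ∫ ω, u ω ^ 2 ∂μ := by
    refine integral_congr_ae (hf.mono fun ω hω => ?_)
    simp [hω]
  rw [Lp.norm_def, (Lp.memLp f).eLpNorm_eq_integral_rpow_norm (by norm_num) (by norm_num)]
  simp only [ENNReal.toReal_ofNat, Real.rpow_ofNat]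
  rw [h1, ENNReal.toReal_ofReal (by positivity), ← Real.rpow_natCast, ← Real.rpow_mul]
  · norm_num
  · exact integral_nonneg fun _ => sq_nonneg _

/-- Mean-square rates pass through a stable linear recursion. -/
theorem SlowRate.isBigO_integral_sq {g : ℕ → ℝ} (hg : SlowRate g) {r : ℕ} (b : Fin r → ℝ)
    (hb : ∀ s : ℂ, s ^ r + ∑ k : Fin r, (b k : ℂ) * s ^ (k : ℕ) = 0 → ‖s‖ < 1) {ξ w : ℕ → Ω → ℝ}
    (hξ : ∀ t, MemLp (ξ t) 2 μ) (hw : ∀ t ω, ξ (t + r) ω + ∑ k : Fin r, b k * ξ (t + k) ω = w t ω)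
    (hwg : (fun t => ∫ ω, w t ω ^ 2 ∂μ) =O[atTop] fun t => g t ^ 2) :
    (fun t => ∫ ω, ξ t ω ^ 2 ∂μ) =O[atTop] fun t => g t ^ 2 := by
  set f : ℕ → Lp ℂ 2 μ := fun t => (hξ t).ofReal.toLp _ with hf
  have hfξ : ∀ t, f t =ᵐ[μ] fun ω => (ξ t ω : ℂ) := fun t => MemLp.coeFn_toLp _
  have hsq : ∀ {u : ℕ → Lp ℂ 2 μ} {v : ℕ → Ω → ℝ}, (∀ t, u t =ᵐ[μ] fun ω => (v t ω : ℂ)) →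
      ((fun t => ∫ ω, v t ω ^ 2 ∂μ) =O[atTop] fun t => g t ^ 2) = (u =O[atTop] g) := by
    intro u v huv
    simp_rw [← norm_sq_of_ae_eq (huv _)]
    rw [← Asymptotics.isBigO_norm_left (f' := u)]
    exact propext ⟨fun h => h.of_pow two_ne_zero, fun h => h.pow 2⟩
  rw [hsq hfξ]
  refine hg.isBigO_of_recursion (fun k => (b k : ℂ)) hb ?_
  rw [← hsq (v := w)]
  · exact hwg
  · intro t
    have h1 : ∀ k : Fin r, (((b k : ℂ) • f (t + k) : Lp ℂ 2 μ) : Ω → ℂ) =ᵐ[μ]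
        fun ω => (b k : ℂ) * ξ (t + k) ω := fun k =>
      (Lp.coeFn_smul _ _).trans ((hfξ (t + k)).mono fun ω hω => by simp [hω])
    filter_upwards [Lp.coeFn_add (f (t + r)) (∑ k : Fin r, (b k : ℂ) • f (t + k)), hfξ (t + r),
      Lp.coeFn_finsetSum Finset.univ fun k : Fin r => (b k : ℂ) • f (t + k),
      eventually_all.2 h1] with ω e1 e2 e3 e4
    rw [e1, Pi.add_apply, e2, e3, Finset.sum_apply, Finset.sum_congr rfl fun k _ => e4 k, ← hw t ω]
    push_cast
    rfl

end L2

namespace Setup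

variable {N r h : ℕ} {S : Setup N r h}

/-- The disagreement of the compressed states is the compression of the deviation. -/
theorem sum_deviation {Ω : Type*} (x : ℕ → Fin N → Ω → EuclideanSpace ℝ (Fin (r + 1))) (t : ℕ)
    (i : Fin N) (ω : Ω) : deviation x t i ω (Fin.last r) + ∑ k, S.b k * deviation x t i ω k.castSucc =
      (S.J *ᵥ S.compressed fun i => x t i ω) i := by
  have h1 : ∑ j, S.g (x t j ω) = S.g (∑ j, x t j ω) := by
    simp only [g_eq, WithLp.ofLp_sum, Finset.sum_apply, Finset.sum_add_distrib,
      Finset.mul_sum]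
    rw [Finset.sum_comm]
  have h2 : S.g (deviation x t i ω) = S.g (x t i ω) - 1 / (N : ℝ) * S.g (∑ j, x t j ω) := by
    simp only [g_eq, deviation, PiLp.sub_apply, PiLp.smul_apply, smul_eq_mul, mul_sub,
      Finset.sum_sub_distrib, Finset.mul_sum, mul_add]
    simp only [mul_left_comm]
    ring
  rw [J_mulVec_apply, add_comm (deviation x t i ω (Fin.last r)), ← g_eq, h2]
  simp only [compressed]
  rw [h1]

namespace Model

variable {Ω : Type*} [MeasurableSpace Ω] {μ : Measure Ω} [IsProbabilityMeasure μ]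
  {d : ℕ → Fin N → Fin N → Ω → ℝ} {m : ℕ → Ω → Fin h} {P : Matrix (Fin h) (Fin h) ℝ}
  {π : Fin h → ℝ} {x : ℕ → Fin N → Ω → EuclideanSpace ℝ (Fin (r + 1))}
  {z : ℕ → Fin N → Fin N → Ω → ℝ}

theorem memLp_state (H : S.Model μ d m P π x z) {t : ℕ} (ht : S.t₀ + 1 ≤ t) (i : Fin N) :
    MemLp (x t i) 2 μ := by
  obtain ⟨C, hC⟩ := exists_norm_state_le H.two_le H.γ_pos.le H.γ_deg H.abs_init_state
    H.abs_init_est H.trajectory ht i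
  exact .of_bound (((measurable_past_trajectory H.trajectory ht).1 i).mono
    (H.past_le t) le_rfl).aestronglyMeasurable C (ae_of_all _ hC)

theorem memLp_deviation (H : S.Model μ d m P π x z) {t : ℕ} (ht : S.t₀ + 1 ≤ t) (i : Fin N) :
    MemLp (deviation x t i) 2 μ :=
  (H.memLp_state ht i).sub
    ((memLp_finsetSum Finset.univ fun j _ => H.memLp_state ht j).const_smul (1 / (N : ℝ)))

theorem memLp_deviation_apply (H : S.Model μ d m P π x z) {t : ℕ} (ht : S.t₀ + 1 ≤ t) (i : Fin N)
    (k : Fin (r + 1)) : MemLp (fun ω => deviation x t i ω k) 2 μ :=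
  (H.memLp_deviation ht i).continuousLinearMap_comp (EuclideanSpace.proj (𝕜 := ℝ) k)

omit [IsProbabilityMeasure μ] in
theorem deviation_castSucc (H : S.Model μ d m P π x z) {t : ℕ} (ht : S.t₀ + 1 ≤ t) (i : Fin N)
    (ω : Ω) (k : Fin r) : deviation x (t + 1) i ω k.castSucc = deviation x t i ω k.succ := by
  simp [deviation, (H.trajectory ω).state_castSucc ht]

omit [IsProbabilityMeasure μ] in
/-- The coordinates of the deviation are shifts of the first one. -/
theorem deviation_eq_shift (H : S.Model μ d m P π x z) {t : ℕ} (ht : S.t₀ + 1 ≤ t) (i : Fin N)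
    (ω : Ω) (k : Fin (r + 1)) : deviation x t i ω k = deviation x (t + k) i ω 0 := by
  induction k using Fin.induction generalizing t with
  | zero => rfl
  | succ k ih =>
    rw [← H.deviation_castSucc ht, ih (Nat.le_succ_of_le ht), Fin.val_castSucc, Fin.val_succ,
      Nat.succ_add_eq_add_succ]

/-- Consensus of the compressed states at a rate carries over to the states. -/
theorem isBigO_deviation (H : S.Model μ d m P π x z)
    (hroots : ∀ s : ℂ, s ^ r + ∑ k : Fin r, (S.b k : ℂ) * s ^ (k : ℕ) = 0 → ‖s‖ < 1) {s K : ℝ}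
    (hs : 0 ≤ s)
    (hV : ∀ᶠ t : ℕ in atTop, ∫ ω, S.disagreement (S.compressed fun i => x t i ω) ∂μ ≤
      K * (t : ℝ) ^ (-s)) (i : Fin N) :
    (fun t => ∫ ω, ‖deviation x t i ω‖ ^ 2 ∂μ) =O[atTop] fun t : ℕ => (t : ℝ) ^ (-s) := by
  -- all sequences are shifted by `T`, because the trajectory satisfies its equations from then on
  set T := S.t₀ + 1 with hT
  have hT0 : (0 : ℝ) < (T : ℝ) := by positivity
  set g : ℕ → ℝ := fun t => ((t : ℝ) + T) ^ (-(s / 2)) with hg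
  have hg2 : ∀ t, g t ^ 2 = ((t + T : ℕ) : ℝ) ^ (-s) := fun t => by
    rw [hg, ← Real.rpow_natCast, ← Real.rpow_mul (by positivity)]
    push_cast
    congr 1
    ring
  have hξ : (fun t => ∫ ω, deviation x (t + T) i ω 0 ^ 2 ∂μ) =O[atTop] fun t => g t ^ 2 := by
    refine (slowRate_rpow (s / 2) hT0).isBigO_integral_sq S.b hroots
      (w := fun t ω => (S.J *ᵥ S.compressed fun i => x (t + T) i ω) i)
      (fun t => H.memLp_deviation_apply (by omega) i 0) (fun t ω => ?_) ?_
    · rw [← sum_deviation x]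
      have h1 := H.deviation_eq_shift (t := t + T) (by omega) i ω
      rw [h1 (Fin.last r), Fin.val_last, add_right_comm]
      congr 1
      refine Finset.sum_congr rfl fun k _ => ?_
      rw [h1 k.castSucc, Fin.val_castSucc, add_right_comm]
    · refine Asymptotics.IsBigO.of_bound K ?_
      filter_upwards [(tendsto_add_atTop_nat T).eventually hV] with t ht
      rw [Real.norm_of_nonneg (integral_nonneg fun _ => sq_nonneg _), Real.norm_of_nonneg (sq_nonneg _)]
      change _ ≤ K * g t ^ 2
      rw [hg2]
      refine le_trans (integral_mono_of_nonneg (ae_of_all _ fun ω => sq_nonneg _) ?_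
        (ae_of_all _ fun ω => ?_)) ht
      · simpa [lyap] using H.integrable_lyap (t := t + T) (by omega) 1 0
      · simp only [disagreement, dotProduct, ← sq]
        exact Finset.single_le_sum
          (f := fun i => (S.J *ᵥ S.compressed fun i => x (t + T) i ω) i ^ 2)
          (fun _ _ => sq_nonneg _) (Finset.mem_univ i)
  have hshift : ∀ k : ℕ, (fun t => ∫ ω, deviation x (t + k + T) i ω 0 ^ 2 ∂μ) =O[atTop]
      fun t => g t ^ 2 := fun k => by
    refine (hξ.comp_tendsto (tendsto_add_atTop_nat k)).trans (Asymptotics.IsBigO.of_bound 1 ?_)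
    refine Eventually.of_forall fun t => ?_
    simp only [Function.comp_apply]
    rw [one_mul, Real.norm_of_nonneg (sq_nonneg _), Real.norm_of_nonneg (sq_nonneg _), hg2, hg2]
    refine Real.rpow_le_rpow_of_nonpos (by positivity) ?_ (by linarith)
    push_cast
    linarith [(Nat.cast_nonneg k : (0 : ℝ) ≤ k)]
  have hsum : (fun t => ∫ ω, ‖deviation x (t + T) i ω‖ ^ 2 ∂μ) =O[atTop] fun t => g t ^ 2 := by
    have h1 : ∀ t, ∫ ω, ‖deviation x (t + T) i ω‖ ^ 2 ∂μ =
        ∑ k : Fin (r + 1), ∫ ω, deviation x (t + k + T) i ω 0 ^ 2 ∂μ := fun t => by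
      have h2 : ∀ k : Fin (r + 1), Integrable (fun ω => deviation x (t + k + T) i ω 0 ^ 2) μ :=
        fun k => (H.memLp_deviation_apply (t := t + k + T) (by omega) i 0).integrable_sq
      rw [← integral_finsetSum _ fun k _ => h2 k]
      refine integral_congr_ae (ae_of_all _ fun ω => ?_)
      simp only [EuclideanSpace.norm_sq_eq, Real.norm_eq_abs, sq_abs]
      refine Finset.sum_congr rfl fun k _ => ?_
      rw [H.deviation_eq_shift (by omega), add_right_comm]
    simp_rw [h1]
    exact Asymptotics.IsBigO.fun_sum fun (k : Fin (r + 1)) _ => hshift k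
  simp_rw [hg2] at hsum
  rw [← map_add_atTop_eq_nat T, Asymptotics.isBigO_map]
  exact hsum

/-- The rate of consensus, for weights that make the Lyapunov function decay at the rate `κ`. -/
theorem isBigO_deviation_of_weights (H : S.Model μ d m P π x z)
    (hroots : ∀ s : ℂ, s ^ r + ∑ k : Fin r, (S.b k : ℂ) * s ^ (k : ℕ) = 0 → ‖s‖ < 1)
    (hβ : 0 ≤ S.β) {κ p q s : ℝ} (hp : 0 < p) (hq : 0 ≤ q)
    (h1 : q * (S.γ * S.lamG π / S.lam₂ π H.two_le) ≤ p * (S.γ * S.lam₂ π H.two_le - κ))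
    (h2 : p * (S.γ * S.lamG π / S.lam₂ π H.two_le) ≤
      q * (2 * S.β * S.fM * piMin π - S.γ * S.alpha π H.two_le - κ))
    (hs : 0 ≤ s) (hs1 : s ≤ 1) (hsκ : s < κ) (i : Fin N) :
    (fun t => ∫ ω, ‖deviation x t i ω‖ ^ 2 ∂μ) =O[atTop] fun t : ℕ => (t : ℝ) ^ (-s) := by
  obtain ⟨K, hK⟩ := H.exists_integral_lyap_le hβ hp.le hq h1 h2 hs hs1 hsκ
  refine H.isBigO_deviation hroots (K := K / p) hs ?_ i
  filter_upwards [hK, eventually_ge_atTop (S.t₀ + 1)] with t ht htT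
  rw [div_mul_eq_mul_div, le_div_iff₀ hp, mul_comm, ← integral_const_mul]
  refine le_trans (integral_mono ?_ (H.integrable_lyap htT p q) fun ω => ?_) ht
  · simpa [lyap] using H.integrable_lyap htT p 0
  · exact le_add_of_nonneg_right (mul_nonneg hq (S.sqErr_nonneg _))

/-- Mean-square decay at a polynomial rate implies consensus. -/
theorem consensus_of_isBigO (H : S.Model μ d m P π x z) {s : ℝ} (hs : 0 < s)
    (hO : ∀ i, (fun t => ∫ ω, ‖deviation x t i ω‖ ^ 2 ∂μ) =O[atTop] fun t : ℕ => (t : ℝ) ^ (-s)) :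
    Consensus μ (S.t₀ + 1) x :=
  ⟨fun _ ht i => H.memLp_state ht i, fun i => (hO i).trans_tendsto
    ((tendsto_rpow_neg_atTop hs).comp tendsto_natCast_atTop_atTop)⟩

end Model
end Setup
end OneBit

theorem theorem4 {N r h : ℕ} (hN : 2 ≤ N) (S : OneBit.Setup N r h)
    -- the topologies are jointly connected
    (hconn : S.union.Connected)
    -- the roots of `s^(n-1) + b_(n-1) s^(n-2) + ⋯ + b₂ s + b₁` lie inside the unit circle
    (hroots : ∀ s : ℂ, s ^ r + ∑ k : Fin r, (S.b k : ℂ) * s ^ (k : ℕ) = 0 → ‖s‖ < 1)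
    (hδ : 0 < S.δ) (hγ : 0 < S.γ)
    -- the initial time
    (ht₀ : 0 < S.t₀) (ht₀γ : ∀ i, S.γ * (S.deg i : ℝ) - 1 < (S.t₀ : ℝ))
    -- `M` bounds the compressed initial states and the initial estimates
    (hMx : ∀ i, |S.g (S.x₀ i)| ≤ S.M)
    (hMz : ∀ i j, S.union.Adj i j → |S.z₀ i j| ≤ S.M)
    {Ω : Type*} [MeasurableSpace Ω] (μ : MeasureTheory.Measure Ω)
    [MeasureTheory.IsProbabilityMeasure μ]
    -- the communication noises
    (d : ℕ → Fin N → Fin N → Ω → ℝ) (hd : OneBit.IsGaussianNoise μ d S.δ)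
    -- the switching signal, its transition matrix and its stationary distribution
    (m : ℕ → Ω → Fin h) (P : Matrix (Fin h) (Fin h) ℝ) (hm : OneBit.IsMarkovChain μ m P)
    (hP : P.IsIrreducible) (π : Fin h → ℝ)
    (hπ : ∀ u, Filter.Tendsto (fun t => μ.real {ω | m t ω = u}) Filter.atTop (nhds (π u)))
    -- the noises are independent of the switching signal
    (hdm : ProbabilityTheory.IndepFun
      (fun ω (q : ℕ × Fin N × Fin N) => d q.1 q.2.1 q.2.2 ω) (fun ω t => m t ω) μ)
    -- the states and the estimates
    (x : ℕ → Fin N → Ω → EuclideanSpace ℝ (Fin (r + 1))) (z : ℕ → Fin N → Fin N → Ω → ℝ)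
    (hxz : ∀ ω, S.IsTrajectory (fun t => m t ω) (fun t i j => d t i j ω)
      (fun t i => x t i ω) (fun t i j => z t i j ω)) :
    (S.β > 1 / (2 * S.fM * OneBit.piMin π) *
        (S.γ * S.lamG π ^ 2 / S.lam₂ π hN ^ 3 + S.γ * S.alpha π hN) →
      OneBit.Consensus μ (S.t₀ + 1) x) ∧
    (S.γ > 1 / S.lam₂ π hN →
      S.β > 1 / (2 * S.fM * OneBit.piMin π) *
        (S.γ ^ 2 * S.lamG π ^ 2 / (S.lam₂ π hN ^ 2 * (S.γ * S.lam₂ π hN - 1))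
          + S.γ * S.alpha π hN + 1) →
      OneBit.Consensus μ (S.t₀ + 1) x ∧
      ∀ i, (fun t => ∫ ω, ‖OneBit.deviation x t i ω‖ ^ 2 ∂μ)
        =O[Filter.atTop] fun t : ℕ => 1 / (t : ℝ)) := by
  have H : S.Model μ d m P π x z :=
    ⟨hN, hconn, hδ, hγ, ht₀γ, hMx, hMz, hd, hm, hP, hπ, hdm, hxz⟩
  have hl := S.lam₂_pos hN hconn H.limit_pos
  have hG := S.lamG_pos hN hconn π
  have hf := S.fM_pos hN hδ
  have : Nonempty Ω := nonempty_of_isProbabilityMeasure μ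
  have : Nonempty (Fin h) := ⟨m 0 (Classical.arbitrary Ω)⟩
  have hπ0 := OneBit.piMin_pos H.limit_pos
  have hα := S.alpha_nonneg π hl.le hG.le
  have hc : 0 < S.γ * S.lamG π / S.lam₂ π hN := div_pos (mul_pos hγ hG) hl
  -- the threshold for `β`, in the form of a lower bound for the contraction of the estimates
  have hβ_lt : ∀ {X : ℝ}, S.β > 1 / (2 * S.fM * OneBit.piMin π) * X →
      X < 2 * S.β * S.fM * OneBit.piMin π := fun {X} hX => by
    rw [gt_iff_lt, one_div, inv_mul_lt_iff₀ (by positivity)] at hX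
    linarith
  have hβ_nonneg : ∀ {X : ℝ}, 0 ≤ X → S.β > 1 / (2 * S.fM * OneBit.piMin π) * X → 0 ≤ S.β :=
    fun hX0 hX => le_trans (by positivity) hX.le
  refine ⟨fun hβ => ?_, fun hγl hβ => ?_⟩
  · have hβ0 := hβ_nonneg (by positivity) hβ
    have hβ' := hβ_lt hβ
    obtain ⟨κ, p, q, hκ, hp, hq, h1, h2⟩ := OneBit.exists_weights (s := 0)
      (d := 2 * S.β * S.fM * OneBit.piMin π - S.γ * S.alpha π hN) hc (mul_pos hγ hl) (by
        have h3 : (S.γ * S.lamG π / S.lam₂ π hN) ^ 2 =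
            S.γ * S.lam₂ π hN * (S.γ * S.lamG π ^ 2 / S.lam₂ π hN ^ 3) := by
          field_simp
        rw [h3, sub_zero, sub_zero]
        exact mul_lt_mul_of_pos_left (by linarith) (mul_pos hγ hl))
    have hs : 0 < min (κ / 2) 1 := lt_min (by linarith) one_pos
    exact H.consensus_of_isBigO hs fun i => H.isBigO_deviation_of_weights hroots hβ0 hp hq.le h1 h2
      hs.le (min_le_right _ _) ((min_le_left _ _).trans_lt (by linarith)) i
  · have hγ1 : 1 < S.γ * S.lam₂ π hN := (div_lt_iff₀ hl).1 hγl
    have hγ1' : 0 < S.γ * S.lam₂ π hN - 1 := sub_pos.2 hγ1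
    have hβ0 := hβ_nonneg (by positivity) hβ
    have hβ' := hβ_lt hβ
    obtain ⟨κ, p, q, hκ, hp, hq, h1, h2⟩ := OneBit.exists_weights (s := 1)
      (d := 2 * S.β * S.fM * OneBit.piMin π - S.γ * S.alpha π hN) hc hγ1 (by
        have h3 : (S.γ * S.lamG π / S.lam₂ π hN) ^ 2 = (S.γ * S.lam₂ π hN - 1) *
            (S.γ ^ 2 * S.lamG π ^ 2 / (S.lam₂ π hN ^ 2 * (S.γ * S.lam₂ π hN - 1))) := by
          field_simp
        rw [h3]
        exact mul_lt_mul_of_pos_left (by linarith) hγ1')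
    have hO := H.isBigO_deviation_of_weights hroots hβ0 hp hq.le h1 h2 zero_le_one le_rfl hκ
    refine ⟨H.consensus_of_isBigO one_pos hO, fun i => (hO i).congr_right fun t => ?_⟩
    rw [Real.rpow_neg_one, one_div]
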